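/- **Setting.** Let $\mathbb K$ be a field of characteristic $0$, let $q,s\in\mathbb K$ be algebraically independent over $\mathbb Q$, and let $\lambda$ be a partition of $N\ge 1$. All operators act on the right, so in a product the leftmost factor is applied first. *Tableaux.* A reverse standard tableau (RST) $\mathbb T$ of shape $\lambda$ is a filling of the diagram of $\lambda$ (rows numbered from bottom to top, the longest row at the bottom) by $1,\dots,N$, each used once, strictly decreasing along rows (left to right) and columns (bottom to top). $\mathrm{CT}_{\mathbb T}[i]$ is the column index minus the row index of the cell of $i$, and $\mathbb T^{(k,l)}$ is $\mathbb T$ with $k,l$ exchanged. $V_\lambda$ is the $\mathbb K$-space with basis the RST of shape $\lambda$. With $m=\mathrm{CT}_{\mathbb T}[i+1]-\mathrm{CT}_{\mathbb T}[i]$, the Hecke generators $T_i$ ($1\le i<N$) act on it by: $\mathbb T T_i=s\mathbb T$ if $i,i+1$ are in the same row; $\mathbb TT_i=-\mathbb T$ if they are in the same column; $\mathbb TT_i=\mathbb T^{(i,i+1)}-\frac{1-s}{1-s^{m}}\mathbb T$ if $i$ is in a row of smaller index than $i+1$ and in another column; and $\mathbb TT_i=\frac{s-1}{1-s^m}\mathbb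 T+\frac{s(1-s^{m+1})(1-s^{m-1})}{(1-s^m)^2}\mathbb T^{(i,i+1)}$ if $i$ is in a row of larger index than $i+1$ and in another column. Put $$\nu(\mathbb T)=\prod_{\substack{i<j\\ \mathrm{CT}_{\mathbb T}[i]-\mathrm{CT}_{\mathbb T}[j]\le-2}}\frac{(1-s^{c-1})(1-s^{c+1})}{(1-s^{c})^2},\qquad c=\mathrm{CT}_{\mathbb T}[j]-\mathrm{CT}_{\mathbb T}[i].$$ *Operators.* On $\mathcal M_\lambda=\mathbb K[x_1,\dots,x_N]\otimes V_\lambda$ let $s_i^x$ exchange $x_i,x_{i+1}$, let $f\partial_i^x=\frac{f-fs_i^x}{x_i-x_{i+1}}$, let $\tau_1^x$ replace $x_1$ by $qx_1$, and let $x_i$ denote multiplication by $x_i$. Put $$\mathbf T_i=(1-s)\,\partial_i^x x_{i+1}+s_i^xT_i,\quad \mathbf T_i^{-1}=\tfrac1s(\mathbf T_i+1-s),\quad \mathbf w=\tau_1^x s_1^x\cdots s_{N-1}^x\,T_1\cdots T_{N-1},$$ $$\boldsymbol\xi_i=s^{i-N}\mathbf T_{i-1}^{-1}\cdots\mathbf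 T_1^{-1}\mathbf w\mathbf T_{N-1}\cdots\mathbf T_i,\quad \mathbf D_N=(1-\boldsymbol\xi_N)x_N^{-1},\quad \mathbf D_i=\tfrac1s\mathbf T_i\mathbf D_{i+1}\mathbf T_i,\quad \boldsymbol\Phi=\mathbf T_1^{-1}\cdots\mathbf T_{N-1}^{-1}x_N.$$ A superscript $*$ means that $(q,s)$ is replaced by $(q^{-1},s^{-1})$. *Macdonald polynomials.* The graph $G_\lambda^{q,s}$ has as vertices $4$-tuples $(\mathbb T,\zeta,v,\sigma)$, with $\zeta\in\mathbb K^N$ (the spectral vector), $v\in\mathbb N^N$ and $\sigma$ a permutation in one-line notation. Its root is $(\mathbb T_\lambda,(s^{\mathrm{CT}_{\mathbb T_\lambda}[i]})_i,0^N,[1,\dots,N])$, where $\mathbb T_\lambda$ is filled with $N,N-1,\dots,1$ column by column, each column from bottom to top, columns from left to right. From $(\mathbb T,\zeta,v,\sigma)$ there are the following arrows (with $us_i$ the vector $u$ with entries $i,i+1$ exchanged): (a) if $v[i]<v[i+1]$, an arrow $s_i$ to $(\mathbb T,\zeta s_i,vs_i,\sigma s_i)$; (b) if $v[i]=v[i+1]$,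 $\mathbb T'=\mathbb T^{(\sigma[i],\sigma[i+1])}$ is an RST and $\mathrm{CT}_{\mathbb T}[\sigma[i]]\ge\mathrm{CT}_{\mathbb T}[\sigma[i+1]]+2$, an arrow $s_i$ to $(\mathbb T',\zeta s_i,v,\sigma)$; (c) an arrow $\Psi$ to $(\mathbb T,[\zeta[2],\dots,\zeta[N],q\zeta[1]],[v[2],\dots,v[N],v[1]+1],[\sigma[2],\dots,\sigma[N],\sigma[1]])$. Start with the polynomial $\mathbb T_\lambda$ at the root and follow a finite path of such arrows, applying $\mathbf T_i+\frac{1-s}{1-\zeta[i+1]/\zeta[i]}$ for each arrow $s_i$ leaving a vertex with spectral vector $\zeta$, and $\boldsymbol\Phi$ for each arrow $\Psi$. The resulting polynomial is denoted $P_\zeta$, where $\zeta$ is the spectral vector of the end point of the path. Following the same path with parameters $(q^{-1},s^{-1})$ gives $P^*_\zeta$. (The assertion below about these polynomials holds for every choice of the paths.) **Theorem (biorthogonality).** For every $Q\in\mathcal M_\lambda$ the element $Q(1-\boldsymbol\xi_N)$ is divisible by $x_N$, so that the $\mathbf D_i$ are well defined on $\mathcal M_\lambda$. There is exactly one $\mathbb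 K$-bilinear form $\langle\,,\rangle$ on $\mathcal M_\lambda\times\mathcal M_\lambda$ (left argument with parameters $(q^{-1},s^{-1})$, right argument with parameters $(q,s)$) such that $\langle\mathbb T_1,\mathbb T_2\rangle=\delta_{\mathbb T_1,\mathbb T_2}\,\nu(\mathbb T_1)$ for all RST $\mathbb T_1,\mathbb T_2$ of shape $\lambda$, such that $\langle Px_i,Q\rangle=\langle P,Q\mathbf D_i\rangle$ for all $P,Q\in\mathcal M_\lambda$ and $1\le i\le N$, and such that elements homogeneous of different degrees in $x$ are orthogonal. This form satisfies: 1. each $\boldsymbol\xi_i$ is invertible on $\mathcal M_\lambda$, and $\langle P\boldsymbol\xi_i^*,Q\rangle=\langle P,Q\boldsymbol\xi_i^{-1}\rangle$ for all $P,Q\in\mathcal M_\lambda$ and $1\le i\le N$; 2. $\langle P^*_\zeta,P_{\zeta'}\rangle=0$ for all spectral vectors $\zeta\ne\zeta'$ of vertices of $G^{q,s}_\lambda$. -/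

import Mathlib

noncomputable section

namespace VectorMacdonald

open scoped TensorProduct

/-! Conventions. `N = n + 1`. Variables, entries of tableaux and coordinates of vectors are indexed
by `Fin (n + 1)` (the index `i` stands for `i + 1` on paper); `T_i`, `s_i` are indexed by
`i : Fin n` and act on the positions `i.castSucc`, `i.succ`. All operators act on the right on
paper; here they are elements of `Module.End`, and a paper product is written with `rightProd`. -/

/-- The right-action product `A₁ A₂ ⋯ A_k`: the operator `A₁` is applied first. -/
def rightProd {R : Type*} [Monoid R] (L : List R) : R := L.reverse.prod

/-! ### Reverse standard tableaux -/

/-- Reverse standard tableaux of shape `μ` with entries `Fin (n + 1)`: `cell i` is the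
`(row, column)` of the entry `i`. Entries strictly decrease along rows (increasing column index)
and along columns (increasing row index). -/
@[ext]
structure RST (n : ℕ) (μ : YoungDiagram) where
  cell : Fin (n + 1) → ℕ × ℕ
  bijOn : Set.BijOn cell Set.univ (μ.cells : Set (ℕ × ℕ))
  row_decr : ∀ i j, (cell i).1 = (cell j).1 → (cell i).2 < (cell j).2 → j < i
  col_decr : ∀ i j, (cell i).2 = (cell j).2 → (cell i).1 < (cell j).1 → j < i

namespace RST

variable {n : ℕ} {μ : YoungDiagram}

def row (T : RST n μ) (i : Fin (n + 1)) : ℕ := (T.cell i).1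

def col (T : RST n μ) (i : Fin (n + 1)) : ℕ := (T.cell i).2

/-- The content of the entry `i`. -/
def ct (T : RST n μ) (i : Fin (n + 1)) : ℤ := (T.col i : ℤ) - (T.row i : ℤ)

/-- `T.IsSwap k l T'`: exchanging the entries `k` and `l` in `T` gives the tableau `T'`. -/
def IsSwap (T : RST n μ) (k l : Fin (n + 1)) (T' : RST n μ) : Prop :=
  T'.cell = T.cell ∘ Equiv.swap k l

open Classical in
/-- The tableau `T^{(k,l)}` in which the entries `k` and `l` are exchanged, if this is again a
reverse standard tableau (and `T` otherwise). -/
def swap (T : RST n μ) (k l : Fin (n + 1)) : RST n μ :=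
  if h : ∃ T', T.IsSwap k l T' then h.choose else T

/-- The order in which the cells are filled in the root tableau: column by column from left to
right, and inside a column by increasing row index (from bottom to top). -/
def columnKey : ℕ × ℕ ↪ ℕ ×ₗ ℕ :=
  ⟨fun c => toLex (c.2, c.1), fun a b h => by
    have h' := toLex.injective h
    simp only [Prod.mk.injEq] at h'
    exact Prod.ext h'.2 h'.1⟩

theorem card_columnKey (hμ : μ.card = n + 1) : (μ.cells.map columnKey).card = n + 1 := by
  rw [Finset.card_map]; exact hμ

/-- The `k`-th cell of `μ` in the column-by-column order. -/
def columnCell (hμ : μ.card = n + 1) (k : Fin (n + 1)) : ℕ × ℕ :=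
  (ofLex ((μ.cells.map columnKey).orderEmbOfFin (card_columnKey hμ) k)).swap

theorem columnKey_columnCell (hμ : μ.card = n + 1) (k : Fin (n + 1)) :
    columnKey (columnCell hμ k) =
      (μ.cells.map columnKey).orderEmbOfFin (card_columnKey hμ) k := rfl

theorem columnCell_lt (hμ : μ.card = n + 1) {k l : Fin (n + 1)}
    (h : columnKey (columnCell hμ k) < columnKey (columnCell hμ l)) : k < l := by
  rw [columnKey_columnCell, columnKey_columnCell] at h
  exact (OrderEmbedding.lt_iff_lt _).1 h

theorem bijOn_columnCell (hμ : μ.card = n + 1) :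
    Set.BijOn (columnCell hμ) Set.univ (μ.cells : Set (ℕ × ℕ)) := by
  refine ⟨fun k _ => ?_, fun k _ l _ h => ?_, fun c hc => ?_⟩
  · have h := Finset.orderEmbOfFin_mem (μ.cells.map columnKey) (card_columnKey hμ) k
    rw [← columnKey_columnCell hμ, Finset.mem_map'] at h
    exact h
  · have h' := congrArg columnKey h
    rw [columnKey_columnCell, columnKey_columnCell] at h'
    exact ((μ.cells.map columnKey).orderEmbOfFin (card_columnKey hμ)).injective h'
  · have h : columnKey c ∈ Set.range
        ((μ.cells.map columnKey).orderEmbOfFin (card_columnKey hμ)) := by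
      rw [Finset.range_orderEmbOfFin]
      exact Finset.mem_coe.2 (Finset.mem_map_of_mem _ hc)
    obtain ⟨k, hk⟩ := h
    exact ⟨k, Set.mem_univ _, columnKey.injective hk⟩

/-- The root tableau `𝕋_μ`: the shape is filled column by column, from bottom to top and left to
right, by the entries in decreasing order. -/
def root (hμ : μ.card = n + 1) : RST n μ where
  cell i := columnCell hμ i.rev
  bijOn := (bijOn_columnCell hμ).comp Fin.revPerm.bijective.bijOn_univ
  row_decr i j h₁ h₂ := by
    refine Fin.rev_lt_rev.1 (columnCell_lt hμ ?_)
    exact Prod.Lex.toLex_lt_toLex.2 (Or.inl h₂)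
  col_decr i j h₁ h₂ := by
    refine Fin.rev_lt_rev.1 (columnCell_lt hμ ?_)
    exact Prod.Lex.toLex_lt_toLex.2 (Or.inr ⟨h₁, h₂⟩)

end RST

section Operators

variable {K : Type*} [Field K]

/-! ### The Hecke module `V_μ` -/

/-- The vector space `V_μ` with basis the reverse standard tableaux of shape `μ`. -/
abbrev Vmod (K : Type*) [Field K] (n : ℕ) (μ : YoungDiagram) : Type _ := RST n μ →₀ K

variable {n : ℕ} {μ : YoungDiagram}

/-- The vector `𝕋 T_i` of `V_μ` (Hecke parameter `s`). -/
def heckeOnTableau (s : K) (i : Fin n) (T : RST n μ) : Vmod K n μ :=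
  let m : ℤ := T.ct i.succ - T.ct i.castSucc
  let T' : RST n μ := T.swap i.castSucc i.succ
  if T.row i.castSucc = T.row i.succ then Finsupp.single T s
  else if T.col i.castSucc = T.col i.succ then Finsupp.single T (-1)
  else if T.row i.castSucc < T.row i.succ then
    Finsupp.single T' 1 - Finsupp.single T ((1 - s) / (1 - s ^ m))
  else
    Finsupp.single T ((s - 1) / (1 - s ^ m)) +
      Finsupp.single T' (s * (1 - s ^ (m + 1)) * (1 - s ^ (m - 1)) / (1 - s ^ m) ^ 2)

/-- The operator `T_i` on `V_μ`. -/
def heckeV (s : K) (i : Fin n) : Module.End K (Vmod K n μ) :=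
  Finsupp.linearCombination K (heckeOnTableau s i)

/-- `S = T_1 ⋯ T_{N-1}` on `V_μ`. -/
def heckeS (s : K) : Module.End K (Vmod K n μ) :=
  rightProd ((List.finRange n).map (heckeV s))

/-- The numbers `ν(𝕋)`. -/
def nu (s : K) (T : RST n μ) : K :=
  ∏ p : Fin (n + 1) × Fin (n + 1) with p.1 < p.2 ∧ T.ct p.1 - T.ct p.2 ≤ -2,
    (1 - s ^ (T.ct p.2 - T.ct p.1 - 1)) * (1 - s ^ (T.ct p.2 - T.ct p.1 + 1)) /
      (1 - s ^ (T.ct p.2 - T.ct p.1)) ^ 2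

/-! ### Operators on the polynomial ring -/

/-- The polynomial ring `K[x_1, …, x_N]`. -/
abbrev Pol (K : Type*) [Field K] (n : ℕ) : Type _ := MvPolynomial (Fin (n + 1)) K

/-- `s_i^x`: exchange of the variables `x_i`, `x_{i+1}`. -/
def sX (i : Fin n) : Module.End K (Pol K n) :=
  (MvPolynomial.rename (Equiv.swap i.castSucc i.succ)).toLinearMap

/-- `τ_1^x`: replaces `x_1` by `q x_1`. -/
def tauX (q : K) : Module.End K (Pol K n) :=
  (MvPolynomial.aeval fun j : Fin (n + 1) =>
    if j = 0 then MvPolynomial.C q * MvPolynomial.X j else MvPolynomial.X j).toLinearMap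

/-- `θ^x = s_1^x ⋯ s_{N-1}^x`. -/
def thetaX : Module.End K (Pol K n) := rightProd ((List.finRange n).map sX)

theorem X_sub_X_ne_zero (i : Fin n) :
    (MvPolynomial.X i.castSucc - MvPolynomial.X i.succ : Pol K n) ≠ 0 :=
  sub_ne_zero.2 fun h => (Fin.castSucc_lt_succ (i := i)).ne (MvPolynomial.X_injective h)

theorem X_sub_X_dvd (i : Fin n) (f : Pol K n) :
    (MvPolynomial.X i.castSucc - MvPolynomial.X i.succ : Pol K n) ∣ f - sX i f := by
  induction f using MvPolynomial.induction_on with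
  | C a => simp [sX]
  | add f g hf hg =>
    rw [map_add, add_sub_add_comm]
    exact dvd_add hf hg
  | mul_X f k hf =>
    have e : f * MvPolynomial.X k - sX i (f * MvPolynomial.X k) =
        (f - sX i f) * MvPolynomial.X k + sX i f *
          (MvPolynomial.X k - MvPolynomial.X (Equiv.swap i.castSucc i.succ k)) := by
      simp only [sX, AlgHom.toLinearMap_apply, map_mul, MvPolynomial.rename_X]
      ring
    rw [e]
    refine dvd_add (hf.mul_right _) (Dvd.dvd.mul_left ?_ _)
    by_cases h₁ : k = i.castSucc
    · rw [h₁, Equiv.swap_apply_left]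
    · by_cases h₂ : k = i.succ
      · rw [h₂, Equiv.swap_apply_right]
        exact (dvd_neg.2 (dvd_refl _)).trans (dvd_of_eq (neg_sub _ _))
      · rw [Equiv.swap_apply_of_ne_of_ne h₁ h₂, sub_self]
        exact dvd_zero _

/-- The divided difference `∂_i`, i.e. `f ↦ (f - f s_i) / (x_i - x_{i+1})`. -/
def dividedDiff (i : Fin n) : Module.End K (Pol K n) where
  toFun f := (X_sub_X_dvd i f).choose
  map_add' f g := by
    refine mul_left_cancel₀ (X_sub_X_ne_zero (K := K) i) ?_
    rw [mul_add, ← (X_sub_X_dvd i (f + g)).choose_spec, ← (X_sub_X_dvd i f).choose_spec,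
      ← (X_sub_X_dvd i g).choose_spec, map_add, add_sub_add_comm]
  map_smul' c f := by
    refine mul_left_cancel₀ (X_sub_X_ne_zero (K := K) i) ?_
    rw [RingHom.id_apply, mul_smul_comm, ← (X_sub_X_dvd i (c • f)).choose_spec,
      ← (X_sub_X_dvd i f).choose_spec, map_smul, smul_sub]

theorem X_sub_X_mul_dividedDiff (i : Fin n) (f : Pol K n) :
    (MvPolynomial.X i.castSucc - MvPolynomial.X i.succ) * dividedDiff i f = f - sX i f :=
  (X_sub_X_dvd i f).choose_spec.symm

/-- `δ_i^x = (1 - s) ∂_i^x x_{i+1}`. -/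
def deltaX (s : K) (i : Fin n) : Module.End K (Pol K n) :=
  (1 - s) • (LinearMap.mulLeft K (MvPolynomial.X i.succ) ∘ₗ dividedDiff i)

/-- Division by the last variable `x_N` (monomials not divisible by `x_N` are discarded; it is
only applied to polynomials divisible by `x_N`). -/
def divXLast : Module.End K (Pol K n) where
  toFun f := f.divMonomial (Finsupp.single (Fin.last n) 1)
  map_add' f g := MvPolynomial.add_divMonomial f g _
  map_smul' c f := by
    ext d
    simp only [MvPolynomial.coeff_divMonomial, MvPolynomial.coeff_smul, RingHom.id_apply]

/-! ### Operators on vector valued polynomials -/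

/-- The space `M_μ = K[x_1, …, x_N] ⊗ V_μ` of vector valued polynomials. -/
abbrev Mmod (K : Type*) [Field K] (n : ℕ) (μ : YoungDiagram) : Type _ :=
  Pol K n ⊗[K] Vmod K n μ

/-- The element `x^v 𝕋`. -/
def monTab (v : Fin (n + 1) →₀ ℕ) (T : RST n μ) : Mmod K n μ :=
  MvPolynomial.monomial v 1 ⊗ₜ[K] Finsupp.single T 1

/-- The element `𝕋`. -/
def ofTab (T : RST n μ) : Mmod K n μ := (1 : Pol K n) ⊗ₜ[K] Finsupp.single T 1

/-- Multiplication by `x_i`. -/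
def mulX (i : Fin (n + 1)) : Module.End K (Mmod K n μ) :=
  TensorProduct.map (LinearMap.mulLeft K (MvPolynomial.X i)) LinearMap.id

/-- Bold `T_i = δ_i^x + s_i^x T_i`. -/
def bT (s : K) (i : Fin n) : Module.End K (Mmod K n μ) :=
  TensorProduct.map (deltaX s i) LinearMap.id + TensorProduct.map (sX i) (heckeV s i)

/-- Bold `T_i⁻¹ = s⁻¹ (T_i + (1 - s))`. -/
def bTinv (s : K) (i : Fin n) : Module.End K (Mmod K n μ) :=
  s⁻¹ • (bT s i + (1 - s) • 1)

/-- Bold `w = τ_1^x θ^x S`. -/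
def bw (q s : K) : Module.End K (Mmod K n μ) :=
  TensorProduct.map (rightProd [tauX q, thetaX]) (heckeS s)

/-- The Cherednik operators
`ξ_i = s^{i-N} T_{i-1}⁻¹ ⋯ T_1⁻¹ w T_{N-1} ⋯ T_i` (bold operators). -/
def cherednik (q s : K) (i : Fin (n + 1)) : Module.End K (Mmod K n μ) :=
  s ^ ((i : ℤ) - (n : ℤ)) •
    rightProd
      (((List.finRange n).filter (fun j : Fin n => (j : ℕ) < (i : ℕ))).reverse.map (bTinv s) ++
        [bw q s] ++
        ((List.finRange n).filter (fun j : Fin n => (i : ℕ) ≤ (j : ℕ))).reverse.map (bT s))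

/-- `F_N = 1 - ξ_N`. -/
def bF (q s : K) : Module.End K (Mmod K n μ) := 1 - cherednik q s (Fin.last n)

/-- Division by `x_N` on vector valued polynomials. -/
def divX : Module.End K (Mmod K n μ) := TensorProduct.map divXLast LinearMap.id

/-- The Dunkl operators: `D_N = F_N x_N⁻¹` and `D_i = s⁻¹ T_i D_{i+1} T_i`. -/
def dunkl (q s : K) (i : Fin (n + 1)) : Module.End K (Mmod K n μ) :=
  Fin.reverseInduction (motive := fun _ => Module.End K (Mmod K n μ))
    (rightProd [bF q s, divX])
    (fun j D => s⁻¹ • rightProd [bT s j, D, bT s j]) i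

/-- The raising operator `Φ = T_1⁻¹ ⋯ T_{N-1}⁻¹ x_N`. -/
def raising (s : K) : Module.End K (Mmod K n μ) :=
  rightProd ((List.finRange n).map (bTinv s) ++ [mulX (Fin.last n)])

/-! ### The bilinear form -/

/-- The conditions defining the bilinear form between `M_μ` with parameters `(q⁻¹, s⁻¹)` (left
argument) and `M_μ` with parameters `(q, s)` (right argument). -/
structure IsForm (q s : K) (B : Mmod K n μ →ₗ[K] Mmod K n μ →ₗ[K] K) : Prop where
  /-- Components of different degrees are orthogonal. -/
  degree : ∀ (u v : Fin (n + 1) →₀ ℕ) (T T' : RST n μ), u.degree ≠ v.degree →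
    B (monTab u T) (monTab v T') = 0
  tableau_self : ∀ T : RST n μ, B (ofTab T) (ofTab T) = nu s T
  tableau_ne : ∀ T T' : RST n μ, T ≠ T' → B (ofTab T) (ofTab T') = 0
  adjoint : ∀ (i : Fin (n + 1)) (P Q : Mmod K n μ), B (mulX i P) Q = B P (dunkl q s i Q)

/-! ### The Yang-Baxter graph and the Macdonald polynomials -/

/-- The labels of arrows: `s_i` and the affine label `Ψ`. -/
inductive Arrow (n : ℕ) where
  | s (i : Fin n)
  | Psi

/-- The 4-tuples `(𝕋, ζ, v, σ)`. -/
structure Vertex (K : Type*) (n : ℕ) (μ : YoungDiagram) where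
  tab : RST n μ
  zeta : Fin (n + 1) → K
  vec : Fin (n + 1) → ℕ
  sigma : Fin (n + 1) → Fin (n + 1)

/-- The root `(𝕋_μ, (s^{CT[i]})_i, 0, id)` of the graph. -/
def rootVertex (s : K) (hμ : μ.card = n + 1) : Vertex K n μ where
  tab := RST.root hμ
  zeta i := s ^ (RST.root hμ).ct i
  vec _ := 0
  sigma i := i

/-- `u s_i`, exchanging the coordinates `i` and `i + 1`. -/
def swapVec {α : Type*} (i : Fin n) (u : Fin (n + 1) → α) : Fin (n + 1) → α :=
  u ∘ Equiv.swap i.castSucc i.succ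

/-- The shifted vector `[u_2, …, u_N, g(u_1)]`. -/
def shiftVec {α : Type*} (g : α → α) (u : Fin (n + 1) → α) : Fin (n + 1) → α :=
  Fin.snoc (fun j : Fin n => u j.succ) (g (u 0))

namespace Vertex

/-- `v[i] = v[i+1]` and `𝕋^{(σ[i],σ[i+1])}` is a reverse standard tableau. -/
def CanJump (X : Vertex K n μ) (i : Fin n) : Prop :=
  X.vec i.castSucc = X.vec i.succ ∧
    ∃ T', X.tab.IsSwap (X.sigma i.castSucc) (X.sigma i.succ) T'

open Classical in
/-- The action of an arrow label on 4-tuples. -/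
def act (q : K) (X : Vertex K n μ) : Arrow n → Vertex K n μ
  | .s i =>
    if X.vec i.castSucc ≠ X.vec i.succ then
      ⟨X.tab, swapVec i X.zeta, swapVec i X.vec, swapVec i X.sigma⟩
    else if X.CanJump i then
      ⟨X.tab.swap (X.sigma i.castSucc) (X.sigma i.succ), swapVec i X.zeta, X.vec, X.sigma⟩
    else X
  | .Psi =>
    ⟨X.tab, shiftVec (fun z => q * z) X.zeta, shiftVec (fun a => a + 1) X.vec,
      shiftVec id X.sigma⟩

/-- The labels of the arrows that leave the vertex `X` in the graph and are not falls: steps and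
correct jumps. -/
def IsArrow (X : Vertex K n μ) : Arrow n → Prop
  | .s i =>
    X.vec i.castSucc < X.vec i.succ ∨
      (X.CanJump i ∧ X.tab.ct (X.sigma i.succ) + 2 ≤ X.tab.ct (X.sigma i.castSucc))
  | .Psi => True

/-- `p` labels a path without fall starting at the vertex `X`. -/
def IsPath (q : K) : Vertex K n μ → List (Arrow n) → Prop
  | _, [] => True
  | X, a :: p => X.IsArrow a ∧ IsPath q (X.act q a) p

/-- The end point of the path `p` that starts at `X`. -/
def endpoint (q : K) (X : Vertex K n μ) (p : List (Arrow n)) : Vertex K n μ :=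
  p.foldl (fun Y a => Y.act q a) X

/-- The effect on polynomials of the arrow `a` leaving `X`: `T_i + (1-s)/(1-ζ[i+1]/ζ[i])` for
`s_i`, and `Φ` for `Ψ`. -/
def arrowOp (s : K) (X : Vertex K n μ) : Arrow n → Module.End K (Mmod K n μ)
  | .s i => bT s i + ((1 - s) / (1 - X.zeta i.succ / X.zeta i.castSucc)) • 1
  | .Psi => raising s

/-- The result of following the path `p` from the vertex `X` carrying the polynomial `P`. -/
def follow (q s : K) : Vertex K n μ → Mmod K n μ → List (Arrow n) → Mmod K n μ
  | _, P, [] => P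
  | X, P, a :: p => follow q s (X.act q a) (X.arrowOp s a P) p

end Vertex

/-- `p` is a path without fall in the graph `G_μ^{q,s}`, starting from the root. -/
def IsGraphPath (q s : K) (hμ : μ.card = n + 1) (p : List (Arrow n)) : Prop :=
  (rootVertex s hμ).IsPath q p

/-- The spectral vector `ζ` of the end point of the path `p` from the root. -/
def spectralVector (q s : K) (hμ : μ.card = n + 1) (p : List (Arrow n)) : Fin (n + 1) → K :=
  ((rootVertex s hμ).endpoint q p).zeta

/-- The Macdonald polynomial `P_p` attached to the path `p` from the root, with parameters
`(q, s)`; it is `P_ζ` for `ζ` the spectral vector of the end point of `p`. -/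
def macdonald (q s : K) (hμ : μ.card = n + 1) (p : List (Arrow n)) : Mmod K n μ :=
  (rootVertex s hμ).follow q s (ofTab (RST.root hμ)) p

end Operators

end VectorMacdonald

end

open VectorMacdonald

/-!
The theorem is a statement about representations of the double affine Hecke algebra, and almost
everything follows from the relations between the operators `T_i`, `w` and `x_j` on vector valued
polynomials.

*The relations.* On `V_μ` the Hecke relations are identities between rational functions of `s`,
once the generators are extended to all placements of the entries in cells, where every exchange of
entries is defined (`fillingOp_sq`, `fillingOp_braid`). On `M_μ` an operator is determined by its
action on constants and its commutation rules with the multiplications, and in this way the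
relations of `V_μ` pass to the bold operators (`GenericParams.dahaRel`). The word calculus in
`IsCyclicShift` then shows that the last two Cherednik operators commute.

*Dunkl operators.* Modulo left multiples of `x_N`, the operator `1 - ξ_N` commutes with all
multiplications, and it annihilates the constants; hence its values are divisible by `x_N`, and
`x_N D_N = 1 - ξ_N` (`GenericParams.mulX_dunkl_last`). Cancelling variables in this equation turns
relations for the `ξ_i` into relations for the `D_i`; in particular, the Dunkl operators commute
(`DahaRel.commute_dunkl_last_two`, `DahaRel.family_commute`).

*The form.* As the Dunkl operators commute, they can be substituted for the variables of a
polynomial, and `(f v, Q) ↦ (v, (f(D) Q)₀)` is a form for which `D_i` is adjoint to `x_i`; here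
`(·)₀` is the constant term and `( , )` the form on `V_μ` with orthogonal tableaux and norms `ν`
(`GenericParams.exists_isPairing`). Since `D_i` lowers the degree by one, different degrees are
orthogonal. Conversely, orthogonality of degrees prescribes the values of the form at constants, and
adjointness prescribes all others, which gives uniqueness.

*Isometries.* On `V_μ` the generators with parameters `s⁻¹` and `s` together preserve the form,
because `ν` changes by the right factor when two consecutive entries are exchanged
(`nuForm_heckeV`). By induction on the left argument the same holds for the bold `T_i` and `w` on
`M_μ`: the commutation rules of `T_i`, `w` with the `D_j` mirror those with the `x_j`. The `ξ_i` are
composed of these isometries up to powers of `s`, and are therefore isometries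
(`IsPairing.cherednik_isometry`); that is, `ξ_i` with inverse parameters is adjoint to `ξ_i⁻¹`.

*Orthogonality.* Along every path of the graph the polynomial stays a simultaneous eigenvector of
the `ξ_i`, and the spectral vector lists its eigenvalues: the arrows `s_i` apply intertwiners, and
the raising operator shifts the eigenvalues cyclically (`IsSpectral.act`). For inverse parameters
the eigenvalues are inverted. If `ζ_i ≠ ζ'_i`, the isometry `ξ_i` multiplies `⟨P*_ζ, P_ζ'⟩` by
`ζ'_i / ζ_i ≠ 1`, so that this number vanishes.
-/

noncomputable section

namespace VectorMacdonald

open scoped TensorProduct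

/-! ### Words in the braid group -/

/-- The word `σ (k - 1) ⋯ σ 0`. -/
def descProd {G : Type*} [Monoid G] (σ : ℕ → G) : ℕ → G
  | 0 => 1
  | k + 1 => σ k * descProd σ k

/-- The word `σ 0 ⋯ σ (k - 1)`. -/
def ascProd {G : Type*} [Monoid G] (σ : ℕ → G) : ℕ → G
  | 0 => 1
  | k + 1 => ascProd σ k * σ k

theorem descProd_succ {G : Type*} [Monoid G] (σ : ℕ → G) (k : ℕ) :
    descProd σ (k + 1) = σ k * descProd σ k := rfl

theorem ascProd_succ {G : Type*} [Monoid G] (σ : ℕ → G) (k : ℕ) :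
    ascProd σ (k + 1) = ascProd σ k * σ k := rfl

section Braid

variable {G : Type*} [Group G]

/-- The elements `σ 0, …, σ (n - 1)` satisfy the braid relations of type `A_n`. -/
structure IsBraid (n : ℕ) (σ : ℕ → G) : Prop where
  braid : ∀ i, i + 1 < n → σ i * σ (i + 1) * σ i = σ (i + 1) * σ i * σ (i + 1)
  comm : ∀ i j, i + 1 < j → j < n → Commute (σ i) (σ j)

namespace IsBraid

variable {n : ℕ} {σ : ℕ → G}

theorem commute_descProd (h : IsBraid n σ) {i : ℕ} (hi : i < n) :
    ∀ k, k < i → Commute (σ i) (descProd σ k)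
  | 0, _ => Commute.one_right _
  | k + 1, hk =>
    ((h.comm k i hk hi).symm).mul_right (h.commute_descProd hi k (by omega))

theorem commute_ascProd (h : IsBraid n σ) {i : ℕ} (hi : i < n) :
    ∀ k, k < i → Commute (σ i) (ascProd σ k)
  | 0, _ => Commute.one_right _
  | k + 1, hk =>
    (h.commute_ascProd hi k (by omega)).mul_right (h.comm k i hk hi).symm

theorem mul_descProd (h : IsBraid n σ) {i k : ℕ} (hik : i + 1 < k) (hk : k ≤ n) :
    σ i * descProd σ k = descProd σ k * σ (i + 1) := by
  induction k, hik using Nat.le_induction with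
  | base =>
    have hc := (h.commute_descProd (i := i + 1) (by omega) i (by omega)).eq
    simp only [descProd_succ]
    rw [← mul_assoc, ← mul_assoc, h.braid i (by omega), mul_assoc (_ * _), hc]
    simp only [mul_assoc]
  | succ k hik ih =>
    rw [descProd_succ, ← mul_assoc, (h.comm i k (by omega) (by omega)).eq, mul_assoc,
      ih (by omega), mul_assoc]

theorem mul_ascProd (h : IsBraid n σ) {i k : ℕ} (hik : i + 1 < k) (hk : k ≤ n) :
    σ (i + 1) * ascProd σ k = ascProd σ k * σ i := by
  induction k, hik using Nat.le_induction with
  | base =>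
    have hc := (h.commute_ascProd (i := i + 1) (by omega) i (by omega)).eq
    have hb := h.braid i (by omega)
    simp only [ascProd_succ]
    rw [← mul_assoc, ← mul_assoc, hc]
    simp only [mul_assoc] at hb ⊢
    rw [hb]
  | succ k hik ih =>
    rw [ascProd_succ, ← mul_assoc, ih (by omega), mul_assoc,
      (h.comm i k (by omega) (by omega)).eq, mul_assoc]

theorem descProd_mul_descProd (h : IsBraid n σ) {k : ℕ} (hk : k < n) :
    descProd σ k * descProd σ n = descProd σ n * (descProd σ (k + 1) * (σ 0)⁻¹) := by
  induction k with
  | zero => simp [descProd]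
  | succ k ih =>
    rw [descProd_succ, mul_assoc, ih (by omega), ← mul_assoc, h.mul_descProd hk le_rfl,
      descProd_succ σ (k + 1)]
    simp only [mul_assoc]

theorem ascProd_mul_descProd (h : IsBraid n σ) {k : ℕ} (hk : k < n) :
    ascProd σ n * descProd σ k = descProd σ (k + 1) * (σ 0)⁻¹ * ascProd σ n := by
  induction k with
  | zero => simp [descProd]
  | succ k ih =>
    rw [descProd_succ, ← mul_assoc, ← h.mul_ascProd hk le_rfl, mul_assoc, ih (by omega),
      descProd_succ σ (k + 1)]
    simp only [mul_assoc]

theorem descProd_sq (h : IsBraid n σ) {m : ℕ} (hm : n = m + 1) :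
    descProd σ n * descProd σ n * σ 0 = σ m * (descProd σ n * descProd σ n) := by
  have e := h.descProd_mul_descProd (k := m) (by omega)
  rw [← hm] at e
  have e' : descProd σ n = σ m * descProd σ m := by rw [hm, descProd_succ]
  calc _ = σ m * (descProd σ m * descProd σ n) * σ 0 := by rw [← mul_assoc (σ m), ← e']
    _ = _ := by rw [e]; simp only [mul_assoc, inv_mul_cancel, mul_one]

end IsBraid

theorem mul_inv_descProd_mul (σ : ℕ → G) (W : G) {n m : ℕ} (hm : n = m + 1) :
    W * (descProd σ n)⁻¹ * σ m = W * (descProd σ m)⁻¹ := by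
  rw [hm, descProd_succ]; simp [mul_assoc]

/-- An element `W` that shifts the braid generators cyclically. -/
structure IsCyclicShift (n : ℕ) (σ : ℕ → G) (W : G) : Prop extends IsBraid n σ where
  shift : ∀ i, i + 1 < n → W * σ (i + 1) = σ i * W
  shift_sq : ∀ m, n = m + 1 → W * W * σ 0 = σ m * (W * W)

namespace IsCyclicShift

variable {n m : ℕ} {σ : ℕ → G} {W : G}

theorem descProd_mul (h : IsCyclicShift n σ W) {k : ℕ} (hk : k < n) :
    descProd σ k * W = W * (descProd σ (k + 1) * (σ 0)⁻¹) := by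
  induction k with
  | zero => simp [descProd]
  | succ k ih =>
    rw [descProd_succ, mul_assoc, ih (by omega), ← mul_assoc, ← h.shift k hk,
      descProd_succ σ (k + 1)]
    simp only [mul_assoc]

theorem ascProd_mul (h : IsCyclicShift n σ W) {k : ℕ} (hk : k < n) :
    ascProd σ k * W = W * ((σ 0)⁻¹ * ascProd σ (k + 1)) := by
  induction k with
  | zero => simp [ascProd]
  | succ k ih =>
    rw [ascProd_succ, mul_assoc, ← h.shift k hk, ← mul_assoc, ih (by omega),
      ascProd_succ σ (k + 1)]
    simp only [mul_assoc]

theorem commute_last (h : IsCyclicShift n σ W) {i : ℕ} (hi : i + 1 < n) :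
    Commute (σ i) (W * (descProd σ n)⁻¹) := by
  have e : σ (i + 1) * (descProd σ n)⁻¹ = (descProd σ n)⁻¹ * σ i := by
    rw [eq_inv_mul_iff_mul_eq, ← mul_assoc, ← h.mul_descProd hi le_rfl, mul_assoc,
      mul_inv_cancel, mul_one]
  change σ i * (W * _) = W * _ * σ i
  rw [← mul_assoc, ← h.shift i hi, mul_assoc, e, mul_assoc]

theorem shift_last (h : IsCyclicShift n σ W) (hm : n = m + 1) :
    σ m * W * (W * (descProd σ n)⁻¹) = W * (descProd σ n)⁻¹ * σ m * W := by
  have e := h.descProd_mul (k := m) (by omega)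
  have e' : (descProd σ m)⁻¹ * W = W * (σ 0 * (descProd σ n)⁻¹) := by
    rw [inv_mul_eq_iff_eq_mul, ← mul_assoc, e, ← hm]; simp [mul_assoc]
  rw [mul_inv_descProd_mul σ W hm, mul_assoc W _ W, e', ← mul_assoc, ← mul_assoc, ← mul_assoc,
    mul_assoc (σ m), ← h.shift_sq m hm]

theorem commute_last_descProd (h : IsCyclicShift n σ W) :
    ∀ k, k < n → Commute (descProd σ k) (W * (descProd σ n)⁻¹)
  | 0, _ => Commute.one_left _
  | k + 1, hk => (h.commute_last hk).mul_left (h.commute_last_descProd k (by omega))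

/-- In terms of `ξ = W (σ (n - 1) ⋯ σ 0)⁻¹`, this says that the last two Cherednik operators `ξ`
and `s⁻¹ σ (n - 1) ξ σ (n - 1)` commute. -/
theorem last_comm (h : IsCyclicShift n σ W) (hm : n = m + 1) :
    W * (descProd σ n)⁻¹ * σ m * (W * (descProd σ n)⁻¹ * σ m) =
      σ m * (W * (descProd σ n)⁻¹ * σ m * (W * (descProd σ n)⁻¹)) := by
  have hc : (descProd σ m)⁻¹ * (W * (descProd σ n)⁻¹) = W * (descProd σ n)⁻¹ * (descProd σ m)⁻¹ :=
    ((h.commute_last_descProd m (by omega)).inv_left).eq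
  calc _ = W * (descProd σ n)⁻¹ * σ m * W * (descProd σ m)⁻¹ := by
        nth_rewrite 2 [mul_inv_descProd_mul σ W hm]; simp only [mul_assoc]
    _ = σ m * W * (W * (descProd σ n)⁻¹ * (descProd σ m)⁻¹) := by
        rw [← h.shift_last hm]; simp only [mul_assoc]
    _ = _ := by rw [← hc, mul_inv_descProd_mul σ W hm]; simp only [mul_assoc]

end IsCyclicShift

end Braid

/-! ### The double affine Hecke relations -/

/-- The relations between the Hecke generators `t i`, the affine element `W` and the
multiplications `X j`, written for operators that are composed from right to left. Only `t i` with
`i < n` and `X j` with `j ≤ n` are constrained. -/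
structure DahaRel {K R : Type*} [Field K] [Ring R] [Algebra K R] (n : ℕ) (q s : K) (t : ℕ → Rˣ)
    (W : Rˣ) (X : ℕ → R) : Prop extends IsCyclicShift n t W where
  q_ne : q ≠ 0
  s_ne : s ≠ 0
  smul_inv : ∀ i < n, s • (↑(t i)⁻¹ : R) = t i + (1 - s) • 1
  t_X_t : ∀ i < n, (t i : R) * X i * t i = s • X (i + 1)
  t_X : ∀ i j, i < n → j ≤ n → j ≠ i → j ≠ i + 1 → Commute (t i : R) (X j)
  X_X : ∀ i j, i ≤ n → j ≤ n → Commute (X i) (X j)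
  W_X_zero : (W : R) * X 0 = q • (X n * W)
  W_X_succ : ∀ j < n, (W : R) * X (j + 1) = X j * W
  X_cancel : ∀ j ≤ n, ∀ A B : R, X j * A = X j * B → A = B

/-- A family of operators in which `Y i = s⁻¹ t_i Y (i + 1) t_i`, as is the case both for the
Cherednik operators and for the Dunkl operators. -/
def IsHeckeFamily {K R : Type*} [Field K] [Ring R] [Algebra K R] (n : ℕ) (s : K) (t : ℕ → Rˣ)
    (Y : ℕ → R) : Prop :=
  ∀ i < n, Y i = s⁻¹ • (t i * Y (i + 1) * t i)

namespace DahaRel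

variable {K R : Type*} [Field K] [Ring R] [Algebra K R] {n m : ℕ} {q s : K} {t : ℕ → Rˣ}
  {W : Rˣ} {X Y D : ℕ → R}

theorem braid' (h : DahaRel n q s t W X) {i : ℕ} (hi : i + 1 < n) :
    (t i * (t (i + 1) * t i) : R) = t (i + 1) * (t i * t (i + 1)) := by
  have := congrArg (Units.val) (h.braid i hi)
  simpa only [Units.val_mul, mul_assoc] using this

theorem inv_eq (h : DahaRel n q s t W X) {i : ℕ} (hi : i < n) :
    (↑(t i)⁻¹ : R) = s⁻¹ • (t i + (1 - s) • 1) := by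
  rw [← h.smul_inv i hi, smul_smul, inv_mul_cancel₀ h.s_ne, one_smul]

theorem sq_eq (h : DahaRel n q s t W X) {i : ℕ} (hi : i < n) :
    (t i * t i : R) = (s - 1) • (t i : R) + s • 1 := by
  have := congrArg (fun x => (t i : R) * x) (h.smul_inv i hi)
  simp only [mul_smul_comm, Units.mul_inv, mul_add, mul_one] at this
  rw [this]; module

theorem inv_X_succ (h : DahaRel n q s t W X) {i : ℕ} (hi : i < n) :
    ↑(t i)⁻¹ * X (i + 1) = s⁻¹ • (X i * t i) := by
  rw [eq_inv_smul_iff₀ h.s_ne, ← mul_smul_comm, ← h.t_X_t i hi]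
  simp [mul_assoc]

theorem X_succ_inv (h : DahaRel n q s t W X) {i : ℕ} (hi : i < n) :
    X (i + 1) * ↑(t i)⁻¹ = s⁻¹ • (t i * X i) := by
  rw [eq_inv_smul_iff₀ h.s_ne, ← smul_mul_assoc, ← h.t_X_t i hi]
  simp [mul_assoc]

theorem t_X_self (h : DahaRel n q s t W X) {i : ℕ} (hi : i < n) :
    t i * X i = s • (X (i + 1) * ↑(t i)⁻¹) := by
  rw [h.X_succ_inv hi, smul_smul, mul_inv_cancel₀ h.s_ne, one_smul]

theorem X_t_self (h : DahaRel n q s t W X) {i : ℕ} (hi : i < n) :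
    X i * t i = s • (↑(t i)⁻¹ * X (i + 1)) := by
  rw [h.inv_X_succ hi, smul_smul, mul_inv_cancel₀ h.s_ne, one_smul]

theorem inv_X_self (h : DahaRel n q s t W X) {i : ℕ} (hi : i < n) :
    ↑(t i)⁻¹ * X i = X (i + 1) * ↑(t i)⁻¹ + (s⁻¹ * (1 - s)) • X i := by
  conv_lhs => rw [h.inv_eq hi, smul_mul_assoc, add_mul, h.t_X_self hi, smul_mul_assoc, one_mul]
  rw [smul_add, smul_smul, inv_mul_cancel₀ h.s_ne, one_smul, smul_smul]

/-! ### Hecke families -/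

/-- If the last member of a Hecke family commutes with the generators not adjacent to it, then so
does every other member. -/
theorem commute_family (h : DahaRel n q s t W X) (hY : IsHeckeFamily n s t Y)
    (hn : ∀ i, i + 1 < n → Commute (t i : R) (Y n)) {i j : ℕ} (hi : i < n) (hj : j ≤ n)
    (h₁ : j ≠ i) (h₂ : j ≠ i + 1) : Commute (t i : R) (Y j) := by
  have hgt : ∀ d i, i + 1 + d < n → Commute (t i : R) (Y (n - d)) := by
    intro d
    induction d with
    | zero => intro i hi; exact hn i (by omega)
    | succ d ih =>
      intro i hi
      rw [hY (n - (d + 1)) (by omega), show n - (d + 1) + 1 = n - d by omega]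
      have hc : Commute (t i : R) (t (n - (d + 1))) :=
        (h.comm i (n - (d + 1)) (by omega) (by omega)).units_val
      exact ((hc.mul_right (ih i (by omega))).mul_right hc).smul_right _
  have hgt' : ∀ i j, i + 1 < j → j ≤ n → Commute (t i : R) (Y j) := by
    intro i j h₁ h₂
    have := hgt (n - j) i (by omega)
    rwa [show n - (n - j) = j by omega] at this
  rcases lt_or_gt_of_ne h₁ with hlt | hlt
  swap
  · exact hgt' i j (by omega) hj
  -- `Y i` is a multiple of `t i * t (i + 1) * Y (i + 2) * t (i + 1) * t i`, through which
  -- `t (i + 1)` is moved by the braid relation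
  have base : ∀ i, i + 1 < n → Commute (t (i + 1) : R) (Y i) := by
    intro i hi
    have e : Y i = (s⁻¹ * s⁻¹) • (t i * t (i + 1) * Y (i + 2) * (t (i + 1) * t i)) := by
      rw [hY i (by omega), hY (i + 1) hi]
      simp only [mul_smul_comm, smul_mul_assoc, smul_smul, mul_assoc]
    have hc := (hgt' i (i + 2) (by omega) (by omega)).eq
    have hb := h.braid' hi
    rw [e]
    refine Commute.smul_right ?_ _
    calc (t (i + 1) * (t i * t (i + 1) * Y (i + 2) * (t (i + 1) * t i)) : R)
        = (t (i + 1) * (t i * t (i + 1))) * Y (i + 2) * (t (i + 1) * t i) := by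
          simp only [mul_assoc]
      _ = t i * t (i + 1) * (t i * Y (i + 2)) * (t (i + 1) * t i) := by
          rw [← hb]; simp only [mul_assoc]
      _ = t i * t (i + 1) * Y (i + 2) * (t i * (t (i + 1) * t i)) := by
          rw [hc]; simp only [mul_assoc]
      _ = _ := by rw [hb]; simp only [mul_assoc]
  have hlow : ∀ d i, i + 1 + d < n → Commute (t (i + 1 + d) : R) (Y i) := by
    intro d
    induction d with
    | zero => intro i hi; exact base i (by omega)
    | succ d ih =>
      intro i hi
      rw [hY i (by omega)]
      have hc : Commute (t (i + 1 + (d + 1)) : R) (t i) :=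
        (h.comm i (i + 1 + (d + 1)) (by omega) (by omega)).symm.units_val
      have := ih (i + 1) (by omega)
      rw [show i + 1 + 1 + d = i + 1 + (d + 1) by omega] at this
      exact ((hc.mul_right this).mul_right hc).smul_right _
  have := hlow (i - j - 1) j (by omega)
  rwa [show j + 1 + (i - j - 1) = i by omega] at this

/-- The members of a Hecke family commute as soon as the last two do. -/
theorem family_commute (h : DahaRel n q s t W X) (hY : IsHeckeFamily n s t Y)
    (hn : ∀ i, i + 1 < n → Commute (t i : R) (Y n)) (hl : ∀ m, n = m + 1 → Commute (Y m) (Y n))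
    {i j : ℕ} (hi : i ≤ n) (hj : j ≤ n) : Commute (Y i) (Y j) := by
  have hlast : ∀ d, d + 1 ≤ n → Commute (Y (n - (d + 1))) (Y n) := by
    intro d
    induction d with
    | zero => intro hd; exact hl _ (by omega)
    | succ d ih =>
      intro hd
      rw [hY _ (by omega), show n - (d + 1 + 1) + 1 = n - (d + 1) by omega]
      have hc := hn (n - (d + 1 + 1)) (by omega)
      exact ((hc.mul_left (ih (by omega))).mul_left hc).smul_left _
  have key : ∀ d i, i + d < n → Commute (Y i) (Y (n - d)) := by
    intro d
    induction d with
    | zero =>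
      intro i hi
      have := hlast (n - i - 1) (by omega)
      rwa [show n - (n - i - 1 + 1) = i by omega] at this
    | succ d ih =>
      intro i hi
      rw [hY (n - (d + 1)) (by omega), show n - (d + 1) + 1 = n - d by omega]
      have hc : Commute (Y i) (t (n - (d + 1)) : R) :=
        (h.commute_family hY hn (by omega) (by omega) (by omega) (by omega)).symm
      exact ((hc.mul_right (ih i (by omega))).mul_right hc).smul_right _
  have key' : ∀ i j, i < j → j ≤ n → Commute (Y i) (Y j) := by
    intro i j h₁ h₂
    have := key (n - j) i (by omega)
    rwa [show n - (n - j) = j by omega] at this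
  rcases lt_trichotomy i j with hlt | rfl | hlt
  · exact key' i j hlt hj
  · exact Commute.refl _
  · exact (key' j i hlt hi).symm

theorem family_mul_t (h : DahaRel n q s t W X) (hY : IsHeckeFamily n s t Y) {i : ℕ} (hi : i < n) :
    Y i * t i = t i * Y (i + 1) + (s - 1) • Y i := by
  conv_lhs => rw [hY i hi, smul_mul_assoc, mul_assoc, h.sq_eq hi]
  conv_rhs => rw [hY i hi]
  simp only [mul_add, mul_smul_comm, mul_one, smul_add, smul_smul]
  rw [inv_mul_cancel₀ h.s_ne, one_smul, add_comm, mul_comm]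

theorem family_succ_mul_t (h : DahaRel n q s t W X) (hY : IsHeckeFamily n s t Y) {i : ℕ}
    (hi : i < n) : Y (i + 1) * t i = t i * Y i + (1 - s) • Y i := by
  have e : (t i * Y i : R) = (s - 1) • Y i + Y (i + 1) * t i := by
    conv_lhs =>
      rw [hY i hi, mul_smul_comm, mul_assoc, ← mul_assoc (t i : R), h.sq_eq hi, add_mul, smul_add,
        smul_mul_assoc, smul_mul_assoc, one_mul, smul_smul, smul_smul, inv_mul_cancel₀ h.s_ne,
        one_smul]
    conv_rhs => rw [hY i hi, smul_smul, mul_comm, mul_assoc]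
  rw [e]; module

/-- The first member of a Hecke family, in terms of the `k`-th one. -/
theorem family_zero (h : DahaRel n q s t W X) (hY : IsHeckeFamily n s t Y) :
    ∀ k ≤ n, Y 0 = (s⁻¹) ^ k • (↑(ascProd t k) * Y k * ↑(descProd t k))
  | 0, _ => by simp [ascProd, descProd]
  | k + 1, hk => by
    rw [h.family_zero hY k (by omega), hY k (by omega), ascProd_succ, descProd_succ]
    simp only [mul_smul_comm, smul_mul_assoc, smul_smul, Units.val_mul, mul_assoc, pow_succ]

/-! ### Divisibility by the last variable -/

theorem commute_descProd_X (h : DahaRel n q s t W X) {j : ℕ} (hj : j ≤ n) :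
    ∀ k < j, Commute (↑(descProd t k) : R) (X j)
  | 0, _ => by simp [descProd]
  | k + 1, hk => by
    rw [descProd_succ, Units.val_mul]
    exact (h.t_X k j (by omega) hj (by omega) (by omega)).mul_left
      (h.commute_descProd_X hj k (by omega))

theorem descProd_inv_X_self (h : DahaRel n q s t W X) :
    ∀ k ≤ n, ↑(descProd t k)⁻¹ * X k = (s⁻¹) ^ k • (X 0 * ↑(ascProd t k))
  | 0, _ => by simp [ascProd, descProd]
  | k + 1, hk => by
    rw [descProd_succ, mul_inv_rev, Units.val_mul, mul_assoc, h.inv_X_succ (by omega),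
      mul_smul_comm, ← mul_assoc, h.descProd_inv_X_self k (by omega), ascProd_succ, Units.val_mul,
      smul_mul_assoc, smul_smul, mul_assoc, pow_succ, mul_comm s⁻¹]

theorem descProd_inv_X (h : DahaRel n q s t W X) {j : ℕ} : ∀ k ≤ n, j < k →
    ∃ C, ↑(descProd t k)⁻¹ * X j = X (j + 1) * ↑(descProd t k)⁻¹ + X 0 * C
  | k + 1, hk, hj => by
    rw [descProd_succ, mul_inv_rev, Units.val_mul, mul_assoc]
    rcases (Nat.lt_succ_iff.1 hj).lt_or_eq with hlt | rfl
    · obtain ⟨C, hC⟩ := h.descProd_inv_X k (by omega) hlt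
      refine ⟨C * ↑(t k)⁻¹, ?_⟩
      rw [(h.t_X k j hk (by omega) (by omega) (by omega)).units_inv_left.eq, ← mul_assoc, hC,
        add_mul, mul_assoc, mul_assoc]
    · refine ⟨(s⁻¹ * (1 - s)) • (s⁻¹) ^ j • ↑(ascProd t j), ?_⟩
      rw [h.inv_X_self hk, mul_add, mul_smul_comm, h.descProd_inv_X_self j (by omega), ← mul_assoc,
        (h.commute_descProd_X hk j (by omega)).units_inv_left.eq, mul_assoc]
      simp only [mul_smul_comm]

/-- Modulo the left multiples of the last variable, `1 - ξ` commutes with the multiplications. -/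
theorem one_sub_last_mul_X (h : DahaRel n q s t W X) {j : ℕ} (hj : j ≤ n) :
    ∃ C, (1 - ↑(W * (descProd t n)⁻¹)) * X j = X j * (1 - ↑(W * (descProd t n)⁻¹)) + X n * C := by
  rcases hj.lt_or_eq with hlt | rfl
  · obtain ⟨C, hC⟩ := h.descProd_inv_X n le_rfl hlt
    refine ⟨-(q • (W * C)), ?_⟩
    rw [Units.val_mul, sub_mul, mul_assoc, hC, mul_add, ← mul_assoc, h.W_X_succ j hlt, ← mul_assoc,
      h.W_X_zero]
    simp only [mul_sub, mul_neg, mul_smul_comm, smul_mul_assoc, mul_assoc, one_mul, mul_one]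
    abel
  · refine ⟨↑(W * (descProd t j)⁻¹) - (s⁻¹) ^ j • q • (W * ↑(ascProd t j)), ?_⟩
    rw [sub_mul, Units.val_mul, mul_assoc, h.descProd_inv_X_self j le_rfl, mul_smul_comm,
      ← mul_assoc, h.W_X_zero]
    simp only [mul_sub, mul_smul_comm, smul_mul_assoc, mul_assoc, one_mul, mul_one]
    abel

/-! ### Dunkl operators -/

/-- The relations defining the Dunkl operators. -/
structure IsDunkl {K R : Type*} [Field K] [Ring R] [Algebra K R] (n : ℕ) (s : K) (t : ℕ → Rˣ)
    (W : Rˣ) (X : ℕ → R) (D : ℕ → R) : Prop where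
  family : IsHeckeFamily n s t D
  X_mul_last : X n * D n = 1 - ↑(W * (descProd t n)⁻¹)

theorem commute_dunkl_last (h : DahaRel n q s t W X) (hD : IsDunkl n s t W X D) {i : ℕ}
    (hi : i + 1 < n) : Commute (t i : R) (D n) := by
  refine h.X_cancel n le_rfl _ _ ?_
  have hx := (h.t_X i n (by omega) le_rfl (by omega) (by omega)).eq
  have hξ := (h.commute_last hi).units_val.eq
  rw [← mul_assoc, ← hx, mul_assoc, hD.X_mul_last, ← mul_assoc, hD.X_mul_last, mul_sub, sub_mul,
    hξ, mul_one, one_mul]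

/-- After multiplication by `X m * X n`, both products of the last two Dunkl operators become
expressions in `t m` and `ξ`, which agree because the last two Cherednik operators commute. -/
theorem commute_dunkl_last_two (h : DahaRel n q s t W X) (hD : IsDunkl n s t W X D)
    (hm : n = m + 1) : Commute (D m) (D n) := by
  have hmn : m < n := by omega
  set ξ : R := ↑(W * (descProd t n)⁻¹) with hξ
  have hT : (t m : R) * ↑(t m)⁻¹ = 1 := Units.mul_inv _
  have hT' : (↑(t m)⁻¹ : R) * t m = 1 := Units.inv_mul _
  have hxD : X n * D n = 1 - ξ := hD.X_mul_last
  have hyT : X m * t m = s • (↑(t m)⁻¹ * X n) := by rw [h.X_t_self hmn, hm]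
  have hTX : s • (X n * ↑(t m)⁻¹) = t m * X m := by rw [h.t_X_self hmn, hm]
  have hxy : X m * X n = X n * X m := (h.X_X m n hmn.le le_rfl).eq
  have hcomm : ξ * t m * (ξ * t m) = t m * (ξ * t m * ξ) := by
    have := congrArg Units.val (h.last_comm hm)
    simpa only [Units.val_mul, hξ] using this
  have hyξ : X m * (ξ * t m) = ξ * t m * X n := by
    have hc := (h.commute_descProd_X (j := n) le_rfl m hmn).units_inv_left.eq
    have e : ξ * t m = W * ↑(descProd t m)⁻¹ := by
      have := congrArg Units.val (mul_inv_descProd_mul t W hm)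
      simpa only [Units.val_mul, hξ] using this
    rw [e, mul_assoc, hc, ← mul_assoc, ← mul_assoc, ← h.W_X_succ m hmn, hm]
  have key : t m * D n * t m * D n = D n * t m * D n * t m := by
    refine h.X_cancel n le_rfl _ _ (h.X_cancel m hmn.le _ _ ?_)
    have e₁ : X m * (X n * (t m * D n * t m * D n)) =
        s • (1 - ξ) - t m * ξ * t m * (1 - ξ) :=
      calc _ = X n * (X m * t m) * D n * t m * D n := by
            rw [← mul_assoc, hxy]; simp only [mul_assoc]
        _ = (s • (X n * ↑(t m)⁻¹)) * (X n * D n) * t m * D n := by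
            rw [hyT]; simp only [mul_assoc, mul_smul_comm, smul_mul_assoc]
        _ = s • (X n * (↑(t m)⁻¹ * t m) * D n) -
              (s • (X n * ↑(t m)⁻¹)) * ξ * t m * D n := by
            rw [hxD]
            simp only [mul_assoc, smul_mul_assoc, mul_sub, sub_mul, mul_one]
        _ = s • (X n * D n) - t m * (X m * (ξ * t m)) * D n := by
            rw [hT', hTX]; simp only [mul_assoc, mul_one]
        _ = s • (X n * D n) - t m * ξ * t m * (X n * D n) := by
            rw [hyξ]; simp only [mul_assoc]
        _ = _ := by rw [hxD]
    have e₂ : X m * (X n * (D n * t m * D n * t m)) =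
        s • (↑(t m)⁻¹ * (1 - ξ) * t m) - ξ * t m * (1 - ξ) * t m :=
      calc _ = X m * (X n * D n) * t m * D n * t m := by simp only [mul_assoc]
        _ = (X m * t m) * D n * t m - X m * (ξ * t m) * D n * t m := by
            rw [hxD]; simp only [mul_assoc, mul_sub, sub_mul, mul_one]
        _ = s • (↑(t m)⁻¹ * (X n * D n) * t m) - ξ * t m * (X n * D n) * t m := by
            rw [hyT, hyξ]; simp only [mul_assoc, smul_mul_assoc]
        _ = _ := by rw [hxD]
    have e₃ : s • (↑(t m)⁻¹ * (1 - ξ) * t m) =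
        s • (1 : R) - (t m + (1 - s) • 1) * (ξ * t m) := by
      rw [← h.smul_inv m hmn]
      simp only [mul_sub, sub_mul, mul_one, smul_sub, smul_mul_assoc, hT', mul_assoc]
    have e₄ : ξ * t m * (1 - ξ) * t m =
        ξ * ((s - 1) • (t m : R) + s • 1) - ξ * t m * (ξ * t m) := by
      rw [← h.sq_eq hmn]
      simp only [mul_sub, sub_mul, mul_one, mul_assoc]
    rw [e₁, e₂, e₃, e₄, hcomm]
    simp only [mul_sub, mul_add, add_mul, smul_mul_assoc, mul_smul_comm, mul_one, one_mul,
      mul_assoc]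
    module
  change D m * D n = D n * D m
  rw [hD.family m hmn, ← hm]
  simp only [smul_mul_assoc, mul_smul_comm]
  rw [key]
  simp only [mul_assoc]

theorem commute_dunkl (h : DahaRel n q s t W X) (hD : IsDunkl n s t W X D) {i j : ℕ}
    (hi : i ≤ n) (hj : j ≤ n) : Commute (D i) (D j) :=
  h.family_commute hD.family (fun _ hi => h.commute_dunkl_last hD hi)
    (fun _ hm => h.commute_dunkl_last_two hD hm) hi hj

theorem commute_t_dunkl (h : DahaRel n q s t W X) (hD : IsDunkl n s t W X D) {i j : ℕ}
    (hi : i < n) (hj : j ≤ n) (h₁ : j ≠ i) (h₂ : j ≠ i + 1) : Commute (t i : R) (D j) :=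
  h.commute_family hD.family (fun _ hi => h.commute_dunkl_last hD hi) hi hj h₁ h₂

theorem dunkl_mul_W (h : DahaRel n q s t W X) (hD : IsDunkl n s t W X D) {j : ℕ} (hj : j < n) :
    D j * W = W * D (j + 1) := by
  have key : ∀ d, d + 1 ≤ n → D (n - (d + 1)) * W = W * D (n - d) := by
    intro d
    induction d with
    | zero =>
      intro hd
      obtain ⟨m, hm⟩ : ∃ m, n = m + 1 := ⟨n - 1, by omega⟩
      have hmn : m < n := by omega
      rw [show n - (0 + 1) = m by omega, Nat.sub_zero]
      refine h.X_cancel m (by omega) _ _ ?_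
      have hW : X m * W = W * X n := by rw [hm, h.W_X_succ m hmn]
      have hs : (↑(t m)⁻¹ : R) * ↑(W * (descProd t n)⁻¹) * t m * W =
          W * ↑(W * (descProd t n)⁻¹) := by
        have := congrArg Units.val (h.shift_last hm)
        rw [← Units.inv_mul_cancel_left (t m) ((W : R) * _), ← mul_assoc (t m : R)]
        simp only [Units.val_mul, mul_assoc] at this ⊢
        rw [this]
      calc X m * (D m * W) = ↑(t m)⁻¹ * (X n * D n) * t m * W := by
            rw [hD.family m hmn, ← hm, ← mul_assoc, mul_smul_comm, ← mul_assoc, ← mul_assoc,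
              h.X_t_self hmn, ← hm]
            simp only [smul_mul_assoc, smul_smul, inv_mul_cancel₀ h.s_ne, one_smul, mul_assoc]
        _ = W * (X n * D n) := by
            rw [hD.X_mul_last]
            simp only [mul_sub, sub_mul, mul_one]
            rw [hs, Units.inv_mul, one_mul]
        _ = X m * (W * D n) := by rw [← mul_assoc, ← hW, mul_assoc]
    | succ d ih =>
      intro hd
      rw [hD.family (n - (d + 1 + 1)) (by omega), hD.family (n - (d + 1)) (by omega),
        show n - (d + 1 + 1) + 1 = n - (d + 1) by omega, show n - (d + 1) + 1 = n - d by omega]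
      have hw := congrArg Units.val (h.shift (n - (d + 1 + 1)) (by omega))
      rw [show n - (d + 1 + 1) + 1 = n - (d + 1) by omega] at hw
      simp only [Units.val_mul] at hw
      rw [smul_mul_assoc, mul_smul_comm, mul_assoc, ← hw, mul_assoc, ← mul_assoc (D _),
        ih (by omega), ← mul_assoc, ← mul_assoc, ← hw]
      simp only [mul_assoc]
  have := key (n - j - 1) (by omega)
  rwa [show n - (n - j - 1 + 1) = j by omega, show n - (n - j - 1) = j + 1 by omega] at this

theorem W_mul_dunkl_zero (h : DahaRel n q s t W X) (hD : IsDunkl n s t W X D) :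
    W * D 0 = q⁻¹ • (D n * W) := by
  refine h.X_cancel n le_rfl _ _ ?_
  have e : X 0 * D 0 = ↑(descProd t n)⁻¹ * (1 - ↑(W * (descProd t n)⁻¹)) * ↑(descProd t n) := by
    rw [h.family_zero hD.family n le_rfl, mul_smul_comm, ← mul_assoc, ← mul_assoc,
      ← smul_mul_assoc, ← smul_mul_assoc, ← h.descProd_inv_X_self n le_rfl, mul_assoc _ (X n),
      hD.X_mul_last]
  have hq : X n * W = q⁻¹ • (W * X 0) := by
    rw [h.W_X_zero, smul_smul, inv_mul_cancel₀ h.q_ne, one_smul]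
  rw [← mul_assoc, hq, mul_smul_comm, ← mul_assoc, hD.X_mul_last, smul_mul_assoc, mul_assoc, e]
  simp [mul_sub, sub_mul, mul_assoc]

/-! ### The raising operator -/

/-- Together with `family_mul_raising`, this says that the raising operator shifts the eigenvalues
of the Cherednik operators cyclically and multiplies one of them by `q`. -/
theorem last_mul_raising (h : DahaRel n q s t W X) (hY : IsHeckeFamily n s t Y)
    (hn : Y n = ↑(W * (descProd t n)⁻¹)) :
    Y n * (X n * ↑(ascProd t n)⁻¹) = q • (X n * ↑(ascProd t n)⁻¹ * Y 0) := by
  rw [h.family_zero hY n le_rfl, hn, Units.val_mul, mul_assoc, ← mul_assoc _ (X n),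
    h.descProd_inv_X_self n le_rfl]
  simp only [mul_smul_comm, smul_mul_assoc, ← mul_assoc, h.W_X_zero]
  simp [mul_assoc, smul_smul, mul_comm q]

theorem family_mul_raising (h : DahaRel n q s t W X) (hY : IsHeckeFamily n s t Y)
    (hn : Y n = ↑(W * (descProd t n)⁻¹)) {j : ℕ} (hj : j < n) :
    Y j * (X n * ↑(ascProd t n)⁻¹) = X n * ↑(ascProd t n)⁻¹ * Y (j + 1) := by
  have key : ∀ d, d + 1 ≤ n → Y (n - (d + 1)) * (X n * ↑(ascProd t n)⁻¹) =
      X n * ↑(ascProd t n)⁻¹ * Y (n - d) := by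
    intro d
    induction d with
    | zero =>
      intro hd
      obtain ⟨m, hm⟩ : ∃ m, n = m + 1 := ⟨n - 1, by omega⟩
      have hmn : m < n := by omega
      rw [show n - (0 + 1) = m by omega, Nat.sub_zero, hY m hmn, ← hm, hn]
      have e₁ : (↑(W * (descProd t n)⁻¹) * t m : R) = W * ↑(descProd t m)⁻¹ := by
        have := congrArg Units.val (mul_inv_descProd_mul t W hm)
        simpa only [Units.val_mul] using this
      have e₂ : (W * ↑(descProd t m)⁻¹ : R) * X n = X m * (W * ↑(descProd t m)⁻¹) := by
        rw [mul_assoc, (h.commute_descProd_X (j := n) le_rfl m hmn).units_inv_left.eq,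
          ← mul_assoc, ← mul_assoc, ← h.W_X_succ m hmn, hm]
      have e₃ : (t m)⁻¹ * (W * (descProd t m)⁻¹ * (ascProd t n)⁻¹) =
          (ascProd t n)⁻¹ * (W * (descProd t n)⁻¹) := by
        have a₁ := h.ascProd_mul_descProd hmn
        have a₂ := h.ascProd_mul (k := m) hmn
        rw [← hm] at a₁ a₂
        have a₃ : W * (ascProd t n)⁻¹ * t 0 = (ascProd t m)⁻¹ * W := by
          rw [eq_inv_mul_iff_mul_eq, ← mul_assoc, ← mul_assoc, a₂]; simp [mul_assoc]
        have a₄ : (descProd t m)⁻¹ * (ascProd t n)⁻¹ =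
            (ascProd t n)⁻¹ * t 0 * (descProd t n)⁻¹ := by
          rw [← mul_inv_rev, a₁]; simp [mul_assoc]
        have a₅ : (ascProd t n)⁻¹ = (t m)⁻¹ * (ascProd t m)⁻¹ := by
          rw [hm, ascProd_succ, mul_inv_rev]
        conv_rhs => rw [a₅, mul_assoc, ← mul_assoc _ W, ← a₃]
        rw [mul_assoc W, a₄]
        simp only [mul_assoc]
      have e₄ := congrArg Units.val e₃
      simp only [Units.val_mul] at e₄
      rw [smul_mul_assoc, mul_assoc _ _ (t m : R), e₁, mul_assoc, ← mul_assoc _ (X n), e₂,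
        mul_assoc (X m), ← mul_assoc, h.t_X_self hmn, ← hm, smul_mul_assoc, smul_smul,
        inv_mul_cancel₀ h.s_ne, one_smul, mul_assoc, e₄]
      simp only [Units.val_mul, mul_assoc]
    | succ d ih =>
      intro hd
      have hx := (h.t_X (n - (d + 1 + 1)) n (by omega) le_rfl (by omega) (by omega)).eq
      have ha : (t (n - (d + 1 + 1)) : R) * ↑(ascProd t n)⁻¹ =
          ↑(ascProd t n)⁻¹ * t (n - (d + 1)) := by
        have := h.mul_ascProd (i := n - (d + 1 + 1)) (k := n) (by omega) le_rfl
        rw [show n - (d + 1 + 1) + 1 = n - (d + 1) by omega] at this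
        have := congrArg (fun u => ((ascProd t n)⁻¹ * u * (ascProd t n)⁻¹ : Rˣ)) this
        simpa [mul_assoc] using (congrArg Units.val this).symm
      have hΦ : (t (n - (d + 1 + 1)) : R) * (X n * ↑(ascProd t n)⁻¹) =
          X n * ↑(ascProd t n)⁻¹ * t (n - (d + 1)) := by
        rw [← mul_assoc, hx, mul_assoc, ha, mul_assoc]
      rw [hY (n - (d + 1 + 1)) (by omega), hY (n - (d + 1)) (by omega),
        show n - (d + 1 + 1) + 1 = n - (d + 1) by omega, show n - (d + 1) + 1 = n - d by omega,
        smul_mul_assoc, mul_smul_comm, mul_assoc, hΦ, mul_assoc, ← mul_assoc (Y _),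
        ih (by omega), ← mul_assoc, ← mul_assoc, hΦ]
      simp only [mul_assoc]
  have := key (n - j - 1) (by omega)
  rwa [show n - (n - j - 1 + 1) = j by omega, show n - (n - j - 1) = j + 1 by omega] at this

end DahaRel

/-! ### Combinatorics of reverse standard tableaux -/

namespace RST

variable {n : ℕ} {μ : YoungDiagram}

theorem cell_injective (T : RST n μ) : Function.Injective T.cell :=
  Set.injOn_univ.1 T.bijOn.injOn

theorem cell_mem (T : RST n μ) (i : Fin (n + 1)) : T.cell i ∈ μ :=
  T.bijOn.mapsTo (Set.mem_univ i)

theorem exists_cell_eq (T : RST n μ) {c : ℕ × ℕ} (hc : c ∈ μ) : ∃ k, T.cell k = c := by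
  obtain ⟨k, -, hk⟩ := T.bijOn.surjOn (show c ∈ (μ.cells : Set (ℕ × ℕ)) from hc)
  exact ⟨k, hk⟩

theorem exists_entry_of_le (T : RST n μ) {j : Fin (n + 1)} {r c : ℕ} (hr : r ≤ T.row j)
    (hc : c ≤ T.col j) : ∃ k, T.row k = r ∧ T.col k = c := by
  obtain ⟨k, hk⟩ := T.exists_cell_eq (μ.up_left_mem hr hc (T.cell_mem j))
  exact ⟨k, congrArg Prod.fst hk, congrArg Prod.snd hk⟩

/-- An entry exceeds every other entry that lies weakly above it and weakly to its right. -/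
theorem lt_of_le_of_le (T : RST n μ) {i j : Fin (n + 1)} (hne : i ≠ j) (hr : T.row i ≤ T.row j)
    (hc : T.col i ≤ T.col j) : j < i := by
  obtain ⟨k, hk₁, hk₂⟩ := T.exists_entry_of_le hr le_rfl
  rcases hc.lt_or_eq with hc | hc
  · have h₁ : k < i := T.row_decr i k hk₁.symm (by change T.col i < T.col k; omega)
    rcases hr.lt_or_eq with hr | hr
    · exact (T.col_decr k j hk₂ (by change T.row k < T.row j; omega)).trans h₁
    · have : k = j := T.cell_injective (Prod.ext (hk₁.trans hr) hk₂)
      rwa [this] at h₁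
  · rcases hr.lt_or_eq with hr | hr
    · exact T.col_decr i j hc hr
    · exact absurd (T.cell_injective (Prod.ext hr hc)) hne

/-- The largest entry lies in the cell common to the first row and the first column. -/
theorem ct_last (T : RST n μ) : T.ct (Fin.last n) = 0 := by
  obtain ⟨k, hk₁, hk₂⟩ := T.exists_entry_of_le (j := Fin.last n) (Nat.zero_le _) (Nat.zero_le _)
  have : k = Fin.last n := by
    by_contra hne
    exact absurd (T.lt_of_le_of_le hne (by omega) (by omega)) (not_lt.2 (Fin.le_last k))
  subst this
  simp [ct, hk₁, hk₂]

/-- Two entries on a common diagonal differ by at least three, since two further entries of the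
rectangle spanned by their cells lie between them. -/
theorem add_three_le_of_ct_eq (T : RST n μ) {i j : Fin (n + 1)} (hij : i < j)
    (h : T.ct i = T.ct j) : (i : ℕ) + 3 ≤ j := by
  unfold ct at h
  have hr : T.row j < T.row i := by
    by_contra hle
    exact absurd (T.lt_of_le_of_le hij.ne (by omega) (by omega)) hij.not_gt
  obtain ⟨k, hk₁, hk₂⟩ := T.exists_entry_of_le (j := i) (r := T.row j + 1) (c := T.col j)
    (by omega) (by omega)
  obtain ⟨l, hl₁, hl₂⟩ := T.exists_entry_of_le (j := i) (r := T.row j) (c := T.col j + 1)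
    (by omega) (by omega)
  have hkl : k ≠ l := fun e => by subst e; omega
  have h₁ : k < j := T.lt_of_le_of_le (fun e => by subst e; omega) (by omega) (by omega)
  have h₂ : l < j := T.lt_of_le_of_le (fun e => by subst e; omega) (by omega) (by omega)
  have h₃ : i < k := T.lt_of_le_of_le (fun e => by subst e; omega) (by omega) (by omega)
  have h₄ : i < l := T.lt_of_le_of_le (fun e => by subst e; omega) (by omega) (by omega)
  simp only [Fin.lt_def, ne_eq, Fin.ext_iff] at *
  omega

theorem ct_succ_of_row_eq (T : RST n μ) {i : Fin n} (h : T.row i.castSucc = T.row i.succ) :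
    T.ct i.succ = T.ct i.castSucc - 1 := by
  have hlt : i.castSucc < i.succ := Fin.castSucc_lt_succ
  have hc : T.col i.succ < T.col i.castSucc := by
    by_contra hle
    exact absurd (T.lt_of_le_of_le hlt.ne h.le (by omega)) hlt.not_gt
  obtain ⟨k, hk₁, hk₂⟩ := T.exists_entry_of_le (j := i.castSucc) (r := T.row i.succ)
    (c := T.col i.succ + 1) h.ge (by omega)
  have h₁ : k < i.succ := T.lt_of_le_of_le (fun e => by subst e; omega) (by omega) (by omega)
  have h₂ : k = i.castSucc := by
    by_contra hne
    have h₃ : i.castSucc < k := T.lt_of_le_of_le hne (by omega) (by omega)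
    simp only [Fin.lt_def, Fin.val_castSucc, Fin.val_succ] at h₁ h₃
    omega
  subst h₂
  unfold ct
  omega

theorem ct_succ_of_col_eq (T : RST n μ) {i : Fin n} (h : T.col i.castSucc = T.col i.succ) :
    T.ct i.succ = T.ct i.castSucc + 1 := by
  have hlt : i.castSucc < i.succ := Fin.castSucc_lt_succ
  have hc : T.row i.succ < T.row i.castSucc := by
    by_contra hle
    exact absurd (T.lt_of_le_of_le hlt.ne (by omega) h.le) hlt.not_gt
  obtain ⟨k, hk₁, hk₂⟩ := T.exists_entry_of_le (j := i.castSucc) (r := T.row i.succ + 1)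
    (c := T.col i.succ) (by omega) h.ge
  have h₁ : k < i.succ := T.lt_of_le_of_le (fun e => by subst e; omega) (by omega) (by omega)
  have h₂ : k = i.castSucc := by
    by_contra hne
    have h₃ : i.castSucc < k := T.lt_of_le_of_le hne (by omega) (by omega)
    simp only [Fin.lt_def, Fin.val_castSucc, Fin.val_succ] at h₁ h₃
    omega
  subst h₂
  unfold ct
  omega

theorem ct_castSucc_ne_ct_succ (T : RST n μ) (i : Fin n) : T.ct i.castSucc ≠ T.ct i.succ := by
  intro h
  have := T.add_three_le_of_ct_eq Fin.castSucc_lt_succ h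
  simp at this

theorem col_lt_of_row_lt (T : RST n μ) {i : Fin n} (h : T.row i.castSucc < T.row i.succ) :
    T.col i.succ < T.col i.castSucc := by
  have hlt : i.castSucc < i.succ := Fin.castSucc_lt_succ
  by_contra hle
  exact absurd (T.lt_of_le_of_le hlt.ne h.le (by omega)) hlt.not_gt

/-- Exchanging two consecutive numbers preserves the order of every other pair. -/
theorem lt_of_swap_lt {i : Fin n} {k l : Fin (n + 1)}
    (h : Equiv.swap i.castSucc i.succ k < Equiv.swap i.castSucc i.succ l)
    (hkl : ¬ (k = i.succ ∧ l = i.castSucc)) : k < l := by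
  have hv : ∀ x : Fin (n + 1), (Equiv.swap i.castSucc i.succ x : ℕ) =
      if (x : ℕ) = i then (i : ℕ) + 1 else if (x : ℕ) = i + 1 then (i : ℕ) else x := by
    intro x
    rw [Equiv.swap_apply_def]
    simp only [Fin.ext_iff, Fin.val_castSucc, Fin.val_succ]
    split_ifs <;> simp
  simp only [Fin.lt_def, hv, Fin.ext_iff, Fin.val_castSucc, Fin.val_succ] at *
  split_ifs at h <;> omega

/-- Consecutive entries in different rows and columns can be exchanged. -/
theorem isSwap_swap (T : RST n μ) {i : Fin n} (hr : T.row i.castSucc ≠ T.row i.succ)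
    (hc : T.col i.castSucc ≠ T.col i.succ) :
    T.IsSwap i.castSucc i.succ (T.swap i.castSucc i.succ) := by
  have hex : ∃ T', T.IsSwap i.castSucc i.succ T' := by
    refine ⟨⟨T.cell ∘ Equiv.swap i.castSucc i.succ, ?_, ?_, ?_⟩, rfl⟩
    · exact T.bijOn.comp (Equiv.bijective _).bijOn_univ
    · intro k l h₁ h₂
      refine lt_of_swap_lt (T.row_decr _ _ h₁ h₂) ?_
      rintro ⟨rfl, rfl⟩
      simp only [Function.comp, Equiv.swap_apply_left, Equiv.swap_apply_right] at h₁
      exact hr h₁.symm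
    · intro k l h₁ h₂
      refine lt_of_swap_lt (T.col_decr _ _ h₁ h₂) ?_
      rintro ⟨rfl, rfl⟩
      simp only [Function.comp, Equiv.swap_apply_left, Equiv.swap_apply_right] at h₁
      exact hc h₁.symm
  rw [swap, dif_pos hex]
  exact hex.choose_spec

end RST

/-! ### The Hecke action on arbitrary fillings -/

section Fillings

variable {K : Type*} [Field K] {n : ℕ} {μ : YoungDiagram}

/-- The content of a cell. -/
def cellContent (c : ℕ × ℕ) : ℤ := (c.2 : ℤ) - (c.1 : ℤ)

/-- The diagonal coefficient of a Hecke generator exchanging two entries in the cells `c`, `d`. -/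
def diagCoeff (s : K) (c d : ℕ × ℕ) : K := (s - 1) / (1 - s ^ (cellContent d - cellContent c))

/-- The off-diagonal coefficient of a Hecke generator exchanging two entries in the cells `c`,
`d`. -/
def offCoeff (s : K) (c d : ℕ × ℕ) : K :=
  if c.1 = d.1 ∨ c.2 = d.2 then 0
  else if c.1 < d.1 then 1
  else s * (1 - s ^ (cellContent d - cellContent c + 1)) *
    (1 - s ^ (cellContent d - cellContent c - 1)) / (1 - s ^ (cellContent d - cellContent c)) ^ 2

theorem offCoeff_of_lt (s : K) {c d : ℕ × ℕ} (h : c.1 < d.1) (h' : c.2 ≠ d.2) :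
    offCoeff s c d = 1 := by
  rw [offCoeff, if_neg (fun e => e.elim h.ne h'), if_pos h]

theorem offCoeff_of_gt (s : K) {c d : ℕ × ℕ} (h : d.1 < c.1) (h' : c.2 ≠ d.2) :
    offCoeff s c d = s * (1 - s ^ (cellContent d - cellContent c + 1)) *
      (1 - s ^ (cellContent d - cellContent c - 1)) /
        (1 - s ^ (cellContent d - cellContent c)) ^ 2 := by
  rw [offCoeff, if_neg (fun e => e.elim h.ne' h'), if_neg h.not_gt]

/-- If the cells `c`, `d` lie in a common row or column, then their contents differ by one. This
is what holds for the cells of consecutive entries of a tableau. -/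
def Adjacent (c d : ℕ × ℕ) : Prop :=
  c.1 = d.1 ∨ c.2 = d.2 → cellContent d - cellContent c = 1 ∨ cellContent d - cellContent c = -1

theorem diagCoeff_add_diagCoeff {s : K} (hs0 : s ≠ 0) (hs : ∀ m : ℤ, m ≠ 0 → s ^ m ≠ 1)
    {c d : ℕ × ℕ} (h : cellContent c ≠ cellContent d) :
    diagCoeff s c d + diagCoeff s d c = s - 1 := by
  have h₁ := hs (cellContent d - cellContent c) (sub_ne_zero.2 h.symm)
  unfold diagCoeff
  rw [← neg_sub (cellContent d), zpow_neg]
  set x := s ^ (cellContent d - cellContent c)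
  have hx : x ≠ 0 := zpow_ne_zero _ hs0
  have h₂ : 1 - x ≠ 0 := sub_ne_zero.2 h₁.symm
  have h₃ : 1 - x⁻¹ ≠ 0 := sub_ne_zero.2 fun e => h₁ (inv_eq_one.1 e.symm)
  have h₄ : x - 1 ≠ 0 := sub_ne_zero.2 h₁
  field_simp
  ring

theorem offCoeff_mul_offCoeff {s : K} (hs0 : s ≠ 0) (hs : ∀ m : ℤ, m ≠ 0 → s ^ m ≠ 1)
    {c d : ℕ × ℕ} (h : cellContent c ≠ cellContent d) (hadj : Adjacent c d) :
    offCoeff s c d * offCoeff s d c = (s - 1) * diagCoeff s c d + s - diagCoeff s c d ^ 2 := by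
  have h₁ := hs (cellContent d - cellContent c) (sub_ne_zero.2 h.symm)
  have hs1 : s - 1 ≠ 0 := sub_ne_zero.2 (by simpa using hs 1 one_ne_zero)
  have hs1' : 1 - s ≠ 0 := sub_ne_zero.2 (by simpa using (hs 1 one_ne_zero).symm)
  by_cases hl : c.1 = d.1 ∨ c.2 = d.2
  · unfold offCoeff
    rw [if_pos hl, zero_mul]
    unfold diagCoeff
    rcases hadj hl with e | e
    · rw [e, zpow_one]; field_simp; ring
    · rw [e, zpow_neg, zpow_one]; field_simp; ring
  · have hl' : ¬ (d.1 = c.1 ∨ d.2 = c.2) := fun e => hl (e.imp Eq.symm Eq.symm)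
    unfold offCoeff diagCoeff
    rw [if_neg hl, if_neg hl', ← neg_sub (cellContent d)]
    generalize cellContent d - cellContent c = m at h₁
    rw [zpow_add_one₀ hs0, zpow_sub_one₀ hs0, zpow_add_one₀ hs0, zpow_sub_one₀ hs0, zpow_neg]
    set x := s ^ m
    have hx : x ≠ 0 := zpow_ne_zero _ hs0
    have h₂ : 1 - x ≠ 0 := sub_ne_zero.2 h₁.symm
    have h₄ : x - 1 ≠ 0 := sub_ne_zero.2 h₁
    have h₅ : 1 - x⁻¹ ≠ 0 := sub_ne_zero.2 fun e => h₁ (inv_eq_one.1 e.symm)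
    rcases lt_or_gt_of_ne (fun e => hl (Or.inl e)) with hlt | hlt
    · rw [if_pos hlt, if_neg hlt.not_gt]
      field_simp
      ring
    · rw [if_neg hlt.not_gt, if_pos hlt]
      field_simp
      ring

theorem diagCoeff_mul_diagCoeff {s : K} (hs0 : s ≠ 0) (hs : ∀ m : ℤ, m ≠ 0 → s ^ m ≠ 1)
    {c d e : ℕ × ℕ} (h₁ : cellContent c ≠ cellContent d) (h₂ : cellContent d ≠ cellContent e)
    (h₃ : cellContent c ≠ cellContent e) :
    diagCoeff s c d * diagCoeff s d e =
      diagCoeff s c e * (diagCoeff s c d + diagCoeff s d e - (s - 1)) := by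
  have k₁ := hs (cellContent d - cellContent c) (sub_ne_zero.2 h₁.symm)
  have k₂ := hs (cellContent e - cellContent d) (sub_ne_zero.2 h₂.symm)
  have k₃ := hs (cellContent e - cellContent c) (sub_ne_zero.2 h₃.symm)
  unfold diagCoeff
  have hxy : s ^ (cellContent e - cellContent c) =
      s ^ (cellContent d - cellContent c) * s ^ (cellContent e - cellContent d) := by
    rw [← zpow_add₀ hs0]; congr 1; ring
  rw [hxy] at k₃ ⊢
  generalize s ^ (cellContent d - cellContent c) = x at k₁ k₃ ⊢
  generalize s ^ (cellContent e - cellContent d) = y at k₂ k₃ ⊢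
  have h₂ : 1 - x ≠ 0 := sub_ne_zero.2 k₁.symm
  have h₃ : 1 - y ≠ 0 := sub_ne_zero.2 k₂.symm
  have h₄ : 1 - x * y ≠ 0 := sub_ne_zero.2 k₃.symm
  field_simp
  ring

/-- The Hecke operator exchanging the entries `k` and `l`, on the space spanned by all placements
of the entries in cells, standard or not. Every exchange is defined there, so that the Hecke
relations reduce to identities between the coefficients. -/
def fillingOp (s : K) (k l : Fin (n + 1)) : Module.End K ((Fin (n + 1) → ℕ × ℕ) →₀ K) :=
  Finsupp.linearCombination K fun f =>
    Finsupp.single f (diagCoeff s (f k) (f l)) +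
      Finsupp.single (f ∘ Equiv.swap k l) (offCoeff s (f k) (f l))

theorem fillingOp_single (s : K) (k l : Fin (n + 1)) (f : Fin (n + 1) → ℕ × ℕ) :
    fillingOp s k l (Finsupp.single f 1) =
      diagCoeff s (f k) (f l) • Finsupp.single f 1 +
        offCoeff s (f k) (f l) • Finsupp.single (f ∘ Equiv.swap k l) 1 := by
  simp [fillingOp]

theorem fillingOp_sq {s : K} (hs0 : s ≠ 0) (hs : ∀ m : ℤ, m ≠ 0 → s ^ m ≠ 1)
    {k l : Fin (n + 1)} {f : Fin (n + 1) → ℕ × ℕ} (h : cellContent (f k) ≠ cellContent (f l))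
    (hadj : Adjacent (f k) (f l)) :
    fillingOp s k l (fillingOp s k l (Finsupp.single f 1)) =
      (s - 1) • fillingOp s k l (Finsupp.single f 1) + s • Finsupp.single f 1 := by
  have e : (f ∘ Equiv.swap k l) ∘ Equiv.swap k l = f := by
    funext x; simp
  rw [fillingOp_single, map_add, map_smul, map_smul, fillingOp_single, fillingOp_single, e]
  simp only [Function.comp, Equiv.swap_apply_left, Equiv.swap_apply_right]
  have h₁ := diagCoeff_add_diagCoeff hs0 hs h
  have h₂ := offCoeff_mul_offCoeff hs0 hs h hadj
  match_scalars
  · linear_combination h₂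
  · linear_combination offCoeff s (f k) (f l) * h₁

theorem fillingOp_comm (s : K) {k l k' l' : Fin (n + 1)} (h₁ : k' ≠ k) (h₂ : k' ≠ l) (h₃ : l' ≠ k)
    (h₄ : l' ≠ l) : Commute (fillingOp s k l) (fillingOp s k' l') := by
  refine Finsupp.lhom_ext' fun f => LinearMap.ext_ring ?_
  have e : (f ∘ Equiv.swap k l) ∘ Equiv.swap k' l' = (f ∘ Equiv.swap k' l') ∘ Equiv.swap k l := by
    have hc : Equiv.swap k l * Equiv.swap k' l' = Equiv.swap k' l' * Equiv.swap k l := by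
      rw [Equiv.mul_swap_eq_swap_mul, Equiv.swap_apply_of_ne_of_ne h₁ h₂,
        Equiv.swap_apply_of_ne_of_ne h₃ h₄]
    funext x
    exact congrArg f (DFunLike.congr_fun hc x)
  simp only [LinearMap.comp_apply, Finsupp.lsingle_apply, Module.End.mul_apply, fillingOp_single,
    map_add, map_smul, e, Function.comp, Equiv.swap_apply_of_ne_of_ne h₁ h₂,
    Equiv.swap_apply_of_ne_of_ne h₃ h₄, Equiv.swap_apply_of_ne_of_ne h₁.symm h₃.symm,
    Equiv.swap_apply_of_ne_of_ne h₂.symm h₄.symm]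
  module

theorem fillingOp_braid {s : K} (hs0 : s ≠ 0) (hs : ∀ m : ℤ, m ≠ 0 → s ^ m ≠ 1)
    {k l m : Fin (n + 1)} (hkl : k ≠ l) (hlm : l ≠ m) (hkm : k ≠ m) {f : Fin (n + 1) → ℕ × ℕ}
    (h₁ : cellContent (f k) ≠ cellContent (f l)) (h₂ : cellContent (f l) ≠ cellContent (f m))
    (h₃ : cellContent (f k) ≠ cellContent (f m)) (a₁ : Adjacent (f k) (f l))
    (a₂ : Adjacent (f l) (f m)) :
    fillingOp s k l (fillingOp s l m (fillingOp s k l (Finsupp.single f 1))) =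
      fillingOp s l m (fillingOp s k l (fillingOp s l m (Finsupp.single f 1))) := by
  have e₁ : (f ∘ Equiv.swap k l) ∘ Equiv.swap k l = f := by funext x; simp
  have e₂ : (f ∘ Equiv.swap l m) ∘ Equiv.swap l m = f := by funext x; simp
  have e₃ : ((f ∘ Equiv.swap k l) ∘ Equiv.swap l m) ∘ Equiv.swap k l =
      ((f ∘ Equiv.swap l m) ∘ Equiv.swap k l) ∘ Equiv.swap l m := by
    have hc : Equiv.swap k l * Equiv.swap l m * Equiv.swap k l =
        Equiv.swap l m * Equiv.swap k l * Equiv.swap l m := by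
      rw [Equiv.swap_mul_swap_mul_swap hkl hkm, Equiv.swap_comm k l, Equiv.swap_comm l m,
        Equiv.swap_mul_swap_mul_swap hlm.symm hkm.symm, Equiv.swap_comm]
    funext x
    exact congrArg f (DFunLike.congr_fun hc x)
  have c₁ := diagCoeff_add_diagCoeff hs0 hs h₁
  have c₂ := diagCoeff_add_diagCoeff hs0 hs h₂
  have p₁ := offCoeff_mul_offCoeff hs0 hs h₁ a₁
  have p₂ := offCoeff_mul_offCoeff hs0 hs h₂ a₂
  have p₃ := diagCoeff_mul_diagCoeff hs0 hs h₁ h₂ h₃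
  simp only [fillingOp_single, map_add, map_smul, e₁, e₂, e₃, Function.comp_apply,
    Equiv.swap_apply_left, Equiv.swap_apply_right, Equiv.swap_apply_of_ne_of_ne hkm.symm hlm.symm,
    Equiv.swap_apply_of_ne_of_ne hkl hkm]
  match_scalars
  · linear_combination diagCoeff s (f k) (f m) * (p₁ - p₂) +
      (diagCoeff s (f k) (f l) - diagCoeff s (f l) (f m)) * p₃
  · linear_combination offCoeff s (f k) (f l) * (p₃ + diagCoeff s (f k) (f m) * c₁)
  · linear_combination -offCoeff s (f l) (f m) * (p₃ + diagCoeff s (f k) (f m) * c₂)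
  all_goals ring

end Fillings

/-! ### The Hecke action on tableaux -/

section HeckeModule

variable {K : Type*} [Field K] {n : ℕ} {μ : YoungDiagram}

/-- A tableau regarded as a filling of cells. -/
def toFilling : Vmod K n μ →ₗ[K] (Fin (n + 1) → ℕ × ℕ) →₀ K :=
  Finsupp.lmapDomain K K RST.cell

theorem toFilling_single (T : RST n μ) :
    toFilling (Finsupp.single T (1 : K)) = Finsupp.single T.cell 1 := by
  simp [toFilling]

theorem toFilling_injective : Function.Injective (toFilling : Vmod K n μ →ₗ[K] _) :=
  Finsupp.mapDomain_injective fun _ _ h => RST.ext h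

namespace RST

theorem adjacent (T : RST n μ) (i : Fin n) : Adjacent (T.cell i.castSucc) (T.cell i.succ) := by
  rintro (h | h)
  · right
    change T.ct i.succ - T.ct i.castSucc = -1
    have := T.ct_succ_of_row_eq h
    omega
  · left
    change T.ct i.succ - T.ct i.castSucc = 1
    have := T.ct_succ_of_col_eq h
    omega

end RST

/-- The four cases in the definition of the Hecke action have the common form of a diagonal term
and a multiple of the exchanged tableau: for entries in a common row or column the contents differ
by one, and the diagonal coefficient specializes to `s` or `-1`. -/
theorem heckeV_single {s : K} (hs0 : s ≠ 0) (hs : ∀ m : ℤ, m ≠ 0 → s ^ m ≠ 1) (i : Fin n)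
    (T : RST n μ) :
    heckeV s i (Finsupp.single T 1) =
      diagCoeff s (T.cell i.castSucc) (T.cell i.succ) • Finsupp.single T 1 +
      offCoeff s (T.cell i.castSucc) (T.cell i.succ) •
        Finsupp.single (T.swap i.castSucc i.succ) 1 := by
  have hne := T.ct_castSucc_ne_ct_succ i
  have hm := hs (T.ct i.succ - T.ct i.castSucc) (by omega)
  have hs1 : 1 - s ≠ 0 := sub_ne_zero.2 (by simpa using (hs 1 one_ne_zero).symm)
  have hs1' : s - 1 ≠ 0 := sub_ne_zero.2 (by simpa using (hs 1 one_ne_zero))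
  have hd : diagCoeff s (T.cell i.castSucc) (T.cell i.succ) =
    (s - 1) / (1 - s ^ (T.ct i.succ - T.ct i.castSucc)) := rfl
  rw [heckeV, Finsupp.linearCombination_single, one_smul, heckeOnTableau]
  by_cases hr : T.row i.castSucc = T.row i.succ
  · have ho : offCoeff s (T.cell i.castSucc) (T.cell i.succ) = 0 := if_pos (Or.inl hr)
    have e : T.ct i.succ - T.ct i.castSucc = -1 := by rw [T.ct_succ_of_row_eq hr]; ring
    have hd' : diagCoeff s (T.cell i.castSucc) (T.cell i.succ) = s := by
      have : 1 - s⁻¹ = (s - 1) / s := by field_simp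
      rw [hd, e, zpow_neg, zpow_one, this]; field_simp
    simp [hr, ho, hd']
  by_cases hc : T.col i.castSucc = T.col i.succ
  · have ho : offCoeff s (T.cell i.castSucc) (T.cell i.succ) = 0 := if_pos (Or.inr hc)
    have e : T.ct i.succ - T.ct i.castSucc = 1 := by rw [T.ct_succ_of_col_eq hc]; ring
    have hd' : diagCoeff s (T.cell i.castSucc) (T.cell i.succ) = -1 := by
      rw [hd, e, zpow_one]; field_simp; ring
    simp [hr, hc, ho, hd']
  have hl : ¬ ((T.cell i.castSucc).1 = (T.cell i.succ).1 ∨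
    (T.cell i.castSucc).2 = (T.cell i.succ).2) := fun h => h.elim hr hc
  rw [if_neg hr, if_neg hc, hd, offCoeff, if_neg hl]
  by_cases hlt : T.row i.castSucc < T.row i.succ
  · rw [if_pos hlt, if_pos (show (T.cell i.castSucc).1 < (T.cell i.succ).1 from hlt), one_smul,
      Finsupp.smul_single, smul_eq_mul, mul_one, sub_eq_add_neg, ← Finsupp.single_neg, add_comm]
    congr 2
    ring
  · rw [if_neg hlt, if_neg (show ¬ (T.cell i.castSucc).1 < (T.cell i.succ).1 from hlt),
      Finsupp.smul_single, Finsupp.smul_single, smul_eq_mul, mul_one, smul_eq_mul, mul_one]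
    rfl

/-- The Hecke action on tableaux is the restriction of the operators on fillings: a coefficient
leading to a filling that is not standard vanishes. -/
theorem toFilling_heckeV {s : K} (hs0 : s ≠ 0) (hs : ∀ m : ℤ, m ≠ 0 → s ^ m ≠ 1) (i : Fin n)
    (v : Vmod K n μ) :
    toFilling (heckeV s i v) = fillingOp s i.castSucc i.succ (toFilling v) := by
  suffices h : toFilling ∘ₗ heckeV s i = fillingOp s i.castSucc i.succ ∘ₗ
      (toFilling : Vmod K n μ →ₗ[K] _) from LinearMap.congr_fun h v
  refine Finsupp.lhom_ext' fun T => LinearMap.ext_ring ?_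
  simp only [LinearMap.comp_apply, Finsupp.lsingle_apply, heckeV_single hs0 hs, map_add, map_smul,
    toFilling_single, fillingOp_single]
  by_cases hl : T.row i.castSucc = T.row i.succ ∨ T.col i.castSucc = T.col i.succ
  · have : offCoeff s (T.cell i.castSucc) (T.cell i.succ) = 0 := if_pos hl
    rw [this, zero_smul, zero_smul]
  · rw [T.isSwap_swap (fun e => hl (Or.inl e)) (fun e => hl (Or.inr e))]

theorem heckeV_sq {s : K} (hs0 : s ≠ 0) (hs : ∀ m : ℤ, m ≠ 0 → s ^ m ≠ 1) (i : Fin n) :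
    (heckeV s i * heckeV s i : Module.End K (Vmod K n μ)) = (s - 1) • heckeV s i + s • 1 := by
  refine Finsupp.lhom_ext' fun T => LinearMap.ext_ring (toFilling_injective ?_)
  have := fillingOp_sq hs0 hs (T.ct_castSucc_ne_ct_succ i) (T.adjacent i)
  simpa only [LinearMap.comp_apply, Finsupp.lsingle_apply, Module.End.mul_apply,
    LinearMap.add_apply, LinearMap.smul_apply, Module.End.one_apply, map_add, map_smul,
    toFilling_heckeV hs0 hs, toFilling_single] using this

theorem heckeV_comm {s : K} (hs0 : s ≠ 0) (hs : ∀ m : ℤ, m ≠ 0 → s ^ m ≠ 1) {i j : Fin n}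
    (hij : (i : ℕ) + 1 < j) :
    Commute (heckeV s i : Module.End K (Vmod K n μ)) (heckeV s j) := by
  refine LinearMap.ext fun v => toFilling_injective ?_
  have := LinearMap.congr_fun (fillingOp_comm (n := n) s (k := i.castSucc) (l := i.succ)
    (k' := j.castSucc) (l' := j.succ) (by simp [Fin.ext_iff]; omega) (by simp [Fin.ext_iff]; omega)
    (by simp [Fin.ext_iff]; omega) (by simp [Fin.ext_iff]; omega)).eq (toFilling v)
  simpa [toFilling_heckeV hs0 hs] using this

theorem heckeV_braid {s : K} (hs0 : s ≠ 0) (hs : ∀ m : ℤ, m ≠ 0 → s ^ m ≠ 1) {i j : Fin n}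
    (hij : (i : ℕ) + 1 = j) :
    (heckeV s i * heckeV s j * heckeV s i : Module.End K (Vmod K n μ)) =
      heckeV s j * heckeV s i * heckeV s j := by
  refine Finsupp.lhom_ext' fun T => LinearMap.ext_ring (toFilling_injective ?_)
  have e : j.castSucc = i.succ := Fin.ext (by simp [hij])
  have hk : T.ct i.castSucc ≠ T.ct j.succ := fun h => by
    have := T.add_three_le_of_ct_eq (i := i.castSucc) (j := j.succ)
      (by simp [Fin.lt_def]; omega) h
    simp at this
    omega
  have h₂ := T.ct_castSucc_ne_ct_succ j
  have a₂ := T.adjacent j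
  rw [e] at h₂ a₂
  have := fillingOp_braid hs0 hs (k := i.castSucc) (l := i.succ) (m := j.succ)
    (by simp [Fin.ext_iff]) (by simp [Fin.ext_iff]; omega) (by simp [Fin.ext_iff]; omega)
    (T.ct_castSucc_ne_ct_succ i) h₂ hk (T.adjacent i) a₂
  simpa [toFilling_heckeV hs0 hs, toFilling_single, e] using this

/-- The induction step in the computation of the Jucys--Murphy elements: if `Y` acts on tableaux
by the content of the entry `i + 1`, then `s⁻¹ T_i Y T_i` acts by the content of `i`. -/
theorem heckeV_content_step {s : K} (hs0 : s ≠ 0) (hs : ∀ m : ℤ, m ≠ 0 → s ^ m ≠ 1) (i : Fin n)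
    (Y : Module.End K (Vmod K n μ))
    (hY : ∀ T, Y (Finsupp.single T 1) = s ^ T.ct i.succ • Finsupp.single T 1) (T : RST n μ) :
    heckeV s i (Y (heckeV s i (Finsupp.single T 1))) =
      (s * s ^ T.ct i.castSucc) • Finsupp.single T 1 := by
  let Z : Module.End K ((Fin (n + 1) → ℕ × ℕ) →₀ K) := Finsupp.linearCombination K fun f =>
    s ^ cellContent (f i.succ) • Finsupp.single f 1
  have hZ : ∀ f, Z (Finsupp.single f 1) = s ^ cellContent (f i.succ) • Finsupp.single f 1 :=
    fun f => by simp [Z]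
  have hYZ : ∀ v, toFilling (Y v) = Z (toFilling v) := fun v => by
    suffices h : toFilling ∘ₗ Y = Z ∘ₗ (toFilling : Vmod K n μ →ₗ[K] _) from
      LinearMap.congr_fun h v
    refine Finsupp.lhom_ext' fun T => LinearMap.ext_ring ?_
    simp only [LinearMap.comp_apply, Finsupp.lsingle_apply, hY, map_smul, toFilling_single, hZ]
    rfl
  apply toFilling_injective
  have hne : cellContent (T.cell i.castSucc) ≠ cellContent (T.cell i.succ) :=
    T.ct_castSucc_ne_ct_succ i
  have e : (T.cell ∘ Equiv.swap i.castSucc i.succ) ∘ Equiv.swap i.castSucc i.succ = T.cell := by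
    funext x; simp
  simp only [toFilling_heckeV hs0 hs, hYZ, map_smul, toFilling_single, fillingOp_single, map_add,
    hZ, e, Function.comp_apply, Equiv.swap_apply_left, Equiv.swap_apply_right]
  have h₁ := diagCoeff_add_diagCoeff hs0 hs hne
  have h₂ := offCoeff_mul_offCoeff hs0 hs hne (T.adjacent i)
  have h₃ : diagCoeff s (T.cell i.castSucc) (T.cell i.succ) * s ^ cellContent (T.cell i.succ) +
      diagCoeff s (T.cell i.succ) (T.cell i.castSucc) * s ^ cellContent (T.cell i.castSucc) =
        0 := by
    have hx := hs (cellContent (T.cell i.succ) - cellContent (T.cell i.castSucc))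
      (sub_ne_zero.2 hne.symm)
    have hc := zpow_ne_zero (cellContent (T.cell i.castSucc)) hs0
    have hd := zpow_ne_zero (cellContent (T.cell i.succ)) hs0
    unfold diagCoeff
    rw [zpow_sub₀ hs0] at hx
    rw [zpow_sub₀ hs0, zpow_sub₀ hs0]
    generalize s ^ cellContent (T.cell i.castSucc) = x at *
    generalize s ^ cellContent (T.cell i.succ) = y at *
    have hxy : x - y ≠ 0 := fun e => hx (by rw [sub_eq_zero.1 e, div_self hd])
    have hyx : y - x ≠ 0 := fun e => hxy (by rw [← neg_sub, e, neg_zero])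
    have e₁ : 1 - y / x = (x - y) / x := by field_simp
    have e₂ : 1 - x / y = (y - x) / y := by field_simp
    rw [e₁, e₂]
    field_simp
    ring
  change _ = (s * s ^ cellContent (T.cell i.castSucc)) • _
  match_scalars
  · linear_combination s ^ cellContent (T.cell i.castSucc) * h₂ +
      diagCoeff s (T.cell i.castSucc) (T.cell i.succ) *
        (h₃ - s ^ cellContent (T.cell i.castSucc) * h₁)
  · linear_combination offCoeff s (T.cell i.castSucc) (T.cell i.succ) * h₃

/-! ### The form on the Hecke module -/

/-- The form on `V_μ` with orthogonal tableaux and norms `ν`. -/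
def nuForm (s : K) : Vmod K n μ →ₗ[K] Vmod K n μ →ₗ[K] K :=
  Finsupp.linearCombination K fun T => nu s T • Finsupp.lapply T

theorem nuForm_single (s : K) (T : RST n μ) (v : Vmod K n μ) :
    nuForm s (Finsupp.single T 1) v = nu s T * v T := by
  simp [nuForm]

theorem RST.swap_swap (T : RST n μ) {i : Fin n} (hr : T.row i.castSucc ≠ T.row i.succ)
    (hc : T.col i.castSucc ≠ T.col i.succ) :
    (T.swap i.castSucc i.succ).swap i.castSucc i.succ = T := by
  have h := T.isSwap_swap hr hc
  have h' := (T.swap i.castSucc i.succ).isSwap_swap (i := i)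
    (by simpa [RST.row, show (T.swap i.castSucc i.succ).cell = _ from h] using fun e => hr e.symm)
    (by simpa [RST.col, show (T.swap i.castSucc i.succ).cell = _ from h] using fun e => hc e.symm)
  refine RST.ext (h'.trans ?_)
  rw [show (T.swap i.castSucc i.succ).cell = _ from h]
  funext x
  simp

/-- Exchanging the consecutive entries adds exactly one factor to the product defining `ν`. -/
theorem nu_swap (s : K) (T : RST n μ) {i : Fin n} (h : T.row i.castSucc < T.row i.succ) :
    nu s (T.swap i.castSucc i.succ) =
      (1 - s ^ (T.ct i.castSucc - T.ct i.succ - 1)) *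
        (1 - s ^ (T.ct i.castSucc - T.ct i.succ + 1)) /
          (1 - s ^ (T.ct i.castSucc - T.ct i.succ)) ^ 2 * nu s T := by
  have hlt := T.col_lt_of_row_lt h
  have hsw := T.isSwap_swap h.ne hlt.ne'
  set T' := T.swap i.castSucc i.succ with hT'
  set τ := Equiv.swap i.castSucc i.succ with hτ
  have hct : ∀ k, T'.ct k = T.ct (τ k) := fun k => by
    simp only [RST.ct, RST.row, RST.col, show T'.cell = _ from hsw, Function.comp_apply]
    rfl
  have hτl : τ i.castSucc = i.succ := Equiv.swap_apply_left _ _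
  have hτr : τ i.succ = i.castSucc := Equiv.swap_apply_right _ _
  have hττ : ∀ k, τ (τ k) = k := fun k => Equiv.swap_apply_self _ _ _
  have hmem : (i.castSucc, i.succ) ∈ (Finset.univ.filter fun p : Fin (n + 1) × Fin (n + 1) =>
      p.1 < p.2 ∧ T'.ct p.1 - T'.ct p.2 ≤ -2) := by
    simp only [Finset.mem_filter, Finset.mem_univ, true_and, hct, hτl, hτr]
    exact ⟨Fin.castSucc_lt_succ, by unfold RST.ct; omega⟩
  unfold nu
  rw [← Finset.mul_prod_erase _ _ hmem]
  simp only [hct, hτl, hτr]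
  congr 1
  refine Finset.prod_equiv (Equiv.prodCongr τ τ) ?_ (fun p _ => rfl)
  rintro ⟨k, l⟩
  simp only [Finset.mem_erase, Finset.mem_filter, Finset.mem_univ, true_and, ne_eq, Prod.mk.injEq,
    Equiv.prodCongr_apply, Prod.map_apply]
  refine ⟨fun ⟨h₁, h₂, h₃⟩ => ⟨?_, h₃⟩, fun ⟨h₁, h₃⟩ => ⟨?_, ?_, h₃⟩⟩
  · refine RST.lt_of_swap_lt (i := i) (by rw [← hτ, hττ, hττ]; exact h₂) ?_
    rintro ⟨e₁, e₂⟩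
    exact h₁ ⟨by rw [← hττ k, e₁, hτr], by rw [← hττ l, e₂, hτl]⟩
  · rintro ⟨rfl, rfl⟩
    rw [hτl, hτr] at h₁
    exact absurd h₁ (Fin.castSucc_lt_succ).not_gt
  · refine RST.lt_of_swap_lt (i := i) h₁ ?_
    rintro ⟨rfl, rfl⟩
    rw [hτl, hτr] at h₃
    unfold RST.ct at h₃
    omega

/-- The adjoint of the generator with parameter `s⁻¹` is the inverse of the generator with
parameter `s`. -/
theorem nuForm_heckeV {s : K} (hs0 : s ≠ 0) (hs : ∀ m : ℤ, m ≠ 0 → s ^ m ≠ 1) (i : Fin n)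
    (v w : Vmod K n μ) :
    nuForm s (heckeV s⁻¹ i v) w = nuForm s v (s⁻¹ • (heckeV s i w + (1 - s) • w)) := by
  have hs' : ∀ m : ℤ, m ≠ 0 → s⁻¹ ^ m ≠ 1 := fun m hm => by
    rw [inv_zpow']; exact hs _ (neg_ne_zero.2 hm)
  suffices h : nuForm s ∘ₗ heckeV s⁻¹ i =
      (nuForm s).compl₂ (s⁻¹ • (heckeV s i + (1 - s) • (1 : Module.End K (Vmod K n μ)))) from
    LinearMap.congr_fun₂ h v w
  refine Finsupp.lhom_ext' fun T => LinearMap.ext_ring (Finsupp.lhom_ext' fun U =>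
    LinearMap.ext_ring ?_)
  have hdiag : diagCoeff s⁻¹ (T.cell i.castSucc) (T.cell i.succ) =
      s⁻¹ * (diagCoeff s (T.cell i.castSucc) (T.cell i.succ) + (1 - s)) := by
    have hx := hs (T.ct i.succ - T.ct i.castSucc)
      (sub_ne_zero.2 (T.ct_castSucc_ne_ct_succ i).symm)
    change (s⁻¹ - 1) / (1 - s⁻¹ ^ (T.ct i.succ - T.ct i.castSucc)) =
      s⁻¹ * ((s - 1) / (1 - s ^ (T.ct i.succ - T.ct i.castSucc)) + (1 - s))
    rw [inv_zpow]
    have hx0 := zpow_ne_zero (T.ct i.succ - T.ct i.castSucc) hs0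
    generalize s ^ (T.ct i.succ - T.ct i.castSucc) = x at *
    have h₁ : x - 1 ≠ 0 := sub_ne_zero.2 hx
    have h₂ : 1 - x ≠ 0 := sub_ne_zero.2 hx.symm
    have e₁ : 1 - x⁻¹ = (x - 1) / x := by field_simp
    rw [e₁]
    field_simp
    ring
  have hoff : offCoeff s⁻¹ (T.cell i.castSucc) (T.cell i.succ) *
      (nu s (T.swap i.castSucc i.succ) * Finsupp.single U (1 : K) (T.swap i.castSucc i.succ)) =
      s⁻¹ * (nu s T * (offCoeff s (U.cell i.castSucc) (U.cell i.succ) *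
        Finsupp.single (U.swap i.castSucc i.succ) (1 : K) T)) := by
    by_cases hT : T.row i.castSucc = T.row i.succ ∨ T.col i.castSucc = T.col i.succ
    · have h₀ : offCoeff s⁻¹ (T.cell i.castSucc) (T.cell i.succ) = 0 := if_pos hT
      rw [h₀, zero_mul]
      by_cases hU : U.row i.castSucc = U.row i.succ ∨ U.col i.castSucc = U.col i.succ
      · have h₁ : offCoeff s (U.cell i.castSucc) (U.cell i.succ) = 0 := if_pos hU
        rw [h₁, zero_mul, mul_zero, mul_zero]
      · have hsw : (U.swap i.castSucc i.succ).cell = _ :=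
          U.isSwap_swap (fun e => hU (Or.inl e)) (fun e => hU (Or.inr e))
        have hne : T ≠ U.swap i.castSucc i.succ := by
          rintro rfl
          simp only [RST.row, RST.col, hsw, Function.comp_apply, Equiv.swap_apply_left,
            Equiv.swap_apply_right] at hT hU
          exact hU (hT.imp Eq.symm Eq.symm)
        rw [Finsupp.single_eq_of_ne hne]
        simp
    have hr : T.row i.castSucc ≠ T.row i.succ := fun e => hT (Or.inl e)
    have hc : T.col i.castSucc ≠ T.col i.succ := fun e => hT (Or.inr e)
    by_cases hTU : T.swap i.castSucc i.succ = U
    · subst hTU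
      have hsw : (T.swap i.castSucc i.succ).cell = _ := T.isSwap_swap hr hc
      have hct : T.ct i.castSucc ≠ T.ct i.succ := T.ct_castSucc_ne_ct_succ i
      rw [T.swap_swap hr hc, Finsupp.single_eq_same, Finsupp.single_eq_same, mul_one, mul_one, hsw]
      simp only [Function.comp_apply, Equiv.swap_apply_left, Equiv.swap_apply_right]
      rcases lt_or_gt_of_ne hr with hlt | hlt
      · rw [nu_swap s T hlt,
          offCoeff_of_lt (c := T.cell i.castSucc) (d := T.cell i.succ) s⁻¹ hlt hc,
          offCoeff_of_gt (c := T.cell i.succ) (d := T.cell i.castSucc) s hlt hc.symm]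
        change 1 * ((1 - s ^ (T.ct i.castSucc - T.ct i.succ - 1)) *
          (1 - s ^ (T.ct i.castSucc - T.ct i.succ + 1)) /
            (1 - s ^ (T.ct i.castSucc - T.ct i.succ)) ^ 2 * nu s T) =
          s⁻¹ * (nu s T * (s * (1 - s ^ (T.ct i.castSucc - T.ct i.succ + 1)) *
            (1 - s ^ (T.ct i.castSucc - T.ct i.succ - 1)) /
              (1 - s ^ (T.ct i.castSucc - T.ct i.succ)) ^ 2))
        field_simp
      · have hν := nu_swap s (T.swap i.castSucc i.succ) (i := i) (by
          simpa only [RST.row, hsw, Function.comp_apply, Equiv.swap_apply_left,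
            Equiv.swap_apply_right] using hlt)
        rw [T.swap_swap hr hc] at hν
        rw [hν, offCoeff_of_gt (c := T.cell i.castSucc) (d := T.cell i.succ) s⁻¹ hlt hc,
          offCoeff_of_lt (c := T.cell i.succ) (d := T.cell i.castSucc) s hlt hc.symm]
        simp only [RST.ct, RST.row, RST.col, hsw, Function.comp_apply, Equiv.swap_apply_left,
          Equiv.swap_apply_right]
        change s⁻¹ * (1 - s⁻¹ ^ (T.ct i.succ - T.ct i.castSucc + 1)) *
          (1 - s⁻¹ ^ (T.ct i.succ - T.ct i.castSucc - 1)) /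
            (1 - s⁻¹ ^ (T.ct i.succ - T.ct i.castSucc)) ^ 2 * _ =
          s⁻¹ * ((1 - s ^ (T.ct i.succ - T.ct i.castSucc - 1)) *
            (1 - s ^ (T.ct i.succ - T.ct i.castSucc + 1)) /
              (1 - s ^ (T.ct i.succ - T.ct i.castSucc)) ^ 2 * _ * 1)
        have hx := hs (T.ct i.succ - T.ct i.castSucc) (sub_ne_zero.2 hct.symm)
        have hx0 := zpow_ne_zero (T.ct i.succ - T.ct i.castSucc) hs0
        simp only [inv_zpow]
        rw [zpow_add_one₀ hs0, zpow_sub_one₀ hs0]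
        generalize s ^ (T.ct i.succ - T.ct i.castSucc) = x at *
        have h₁ : x - 1 ≠ 0 := sub_ne_zero.2 hx
        have h₂ : 1 - x ≠ 0 := sub_ne_zero.2 hx.symm
        have e₁ : 1 - x⁻¹ = (x - 1) / x := by field_simp
        rw [e₁]
        field_simp
        ring
    · rw [Finsupp.single_eq_of_ne hTU]
      by_cases hU : U.row i.castSucc = U.row i.succ ∨ U.col i.castSucc = U.col i.succ
      · have h₁ : offCoeff s (U.cell i.castSucc) (U.cell i.succ) = 0 := if_pos hU
        rw [h₁]
        simp
      · have hne : T ≠ U.swap i.castSucc i.succ := by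
          rintro rfl
          exact hTU (U.swap_swap (fun e => hU (Or.inl e)) (fun e => hU (Or.inr e)))
        rw [Finsupp.single_eq_of_ne hne]
        simp
  simp only [LinearMap.comp_apply, Finsupp.lsingle_apply, LinearMap.compl₂_apply,
    heckeV_single (inv_ne_zero hs0) hs', heckeV_single hs0 hs, map_add, map_smul,
    LinearMap.add_apply, LinearMap.smul_apply, nuForm_single, Module.End.one_apply, smul_eq_mul,
    hoff, hdiag]
  by_cases hUT : U = T
  · subst hUT
    ring
  · rw [Finsupp.single_eq_of_ne (Ne.symm hUT)]
    ring

end HeckeModule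

/-! ### Sequences indexed by natural numbers -/

/-- A finite sequence, continued by a constant. -/
def extendNat {A : Type*} {m : ℕ} (f : Fin m → A) (d : A) (k : ℕ) : A :=
  if h : k < m then f ⟨k, h⟩ else d

theorem extendNat_val {A : Type*} {m : ℕ} (f : Fin m → A) (d : A) (i : Fin m) :
    extendNat f d i = f i := by
  rw [extendNat, dif_pos i.isLt]

theorem prod_finRange_eq_ascProd {R : Type*} [Monoid R] {n : ℕ} (f : Fin n → R) (g : ℕ → R)
    (h : ∀ i : Fin n, g i = f i) : ((List.finRange n).map f).prod = ascProd g n := by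
  have e : (List.finRange n).map f = (List.range n).map g := by
    rw [← List.map_coe_finRange_eq_range, List.map_map]
    exact List.map_congr_left fun i _ => (h i).symm
  have hr : ∀ k, ((List.range k).map g).prod = ascProd g k := fun k => by
    induction k with
    | zero => rfl
    | succ k ih => rw [List.range_succ, List.map_append, List.prod_append, ih]; simp [ascProd]
  rw [e, hr]

theorem rightProd_finRange_eq_descProd {R : Type*} [Monoid R] {n : ℕ} (f : Fin n → R) (g : ℕ → R)
    (h : ∀ i : Fin n, g i = f i) : rightProd ((List.finRange n).map f) = descProd g n := by
  have e : (List.finRange n).map f = (List.range n).map g := by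
    rw [← List.map_coe_finRange_eq_range, List.map_map]
    exact List.map_congr_left fun i _ => (h i).symm
  have hr : ∀ k, ((List.range k).map g).reverse.prod = descProd g k := fun k => by
    induction k with
    | zero => rfl
    | succ k ih =>
      rw [List.range_succ, List.map_append, List.reverse_append, List.prod_append, ih]
      simp [descProd]
  rw [rightProd, e, hr]

theorem map_descProd {R S : Type*} [Monoid R] [Monoid S] (φ : R →* S) (g : ℕ → R) (k : ℕ) :
    φ (descProd g k) = descProd (fun i => φ (g i)) k := by
  induction k with
  | zero => exact map_one φ
  | succ k ih => rw [descProd_succ, map_mul, ih]; rfl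

theorem map_ascProd {R S : Type*} [Monoid R] [Monoid S] (φ : R →* S) (g : ℕ → R) (k : ℕ) :
    φ (ascProd g k) = ascProd (fun i => φ (g i)) k := by
  induction k with
  | zero => exact map_one φ
  | succ k ih => rw [ascProd_succ, map_mul, ih]; rfl

section

variable {K : Type*} [Field K] {n : ℕ} {μ : YoungDiagram}

/-! ### Operators on polynomials -/

open MvPolynomial in
theorem sX_mul (i : Fin n) (f g : Pol K n) : sX i (f * g) = sX i f * sX i g := by
  simp [sX]

open MvPolynomial in
theorem sX_X (i : Fin n) (j : Fin (n + 1)) :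
    sX i (X j : Pol K n) = X (Equiv.swap i.castSucc i.succ j) := by
  simp [sX]

theorem dividedDiff_mul (i : Fin n) (f g : Pol K n) :
    dividedDiff i (f * g) = dividedDiff i f * g + sX i f * dividedDiff i g := by
  refine mul_left_cancel₀ (X_sub_X_ne_zero (K := K) i) ?_
  rw [X_sub_X_mul_dividedDiff, mul_add, ← mul_assoc, X_sub_X_mul_dividedDiff, mul_left_comm,
    X_sub_X_mul_dividedDiff, sX_mul]
  ring

open MvPolynomial in
theorem dividedDiff_X_castSucc (i : Fin n) : dividedDiff i (X i.castSucc : Pol K n) = 1 := by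
  refine mul_left_cancel₀ (X_sub_X_ne_zero (K := K) i) ?_
  rw [X_sub_X_mul_dividedDiff, sX_X, Equiv.swap_apply_left, mul_one]

open MvPolynomial in
theorem dividedDiff_X_succ (i : Fin n) : dividedDiff i (X i.succ : Pol K n) = -1 := by
  refine mul_left_cancel₀ (X_sub_X_ne_zero (K := K) i) ?_
  rw [X_sub_X_mul_dividedDiff, sX_X, Equiv.swap_apply_right]
  ring

open MvPolynomial in
theorem dividedDiff_X_ne {i : Fin n} {j : Fin (n + 1)} (h₁ : j ≠ i.castSucc) (h₂ : j ≠ i.succ) :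
    dividedDiff i (X j : Pol K n) = 0 := by
  refine mul_left_cancel₀ (X_sub_X_ne_zero (K := K) i) ?_
  rw [X_sub_X_mul_dividedDiff, sX_X, Equiv.swap_apply_of_ne_of_ne h₁ h₂, mul_zero, sub_self]

theorem dividedDiff_one (i : Fin n) : dividedDiff i (1 : Pol K n) = 0 := by
  refine mul_left_cancel₀ (X_sub_X_ne_zero (K := K) i) ?_
  rw [X_sub_X_mul_dividedDiff, mul_zero]
  simp [sX]

theorem deltaX_apply (s : K) (i : Fin n) (f : Pol K n) :
    deltaX s i f = (1 - s) • (MvPolynomial.X i.succ * dividedDiff i f) := rfl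

/-! ### Vector valued polynomials -/

theorem mulX_tmul (j : Fin (n + 1)) (f : Pol K n) (v : Vmod K n μ) :
    mulX j (f ⊗ₜ[K] v) = (MvPolynomial.X j * f) ⊗ₜ[K] v := rfl

theorem mulX_comm (i j : Fin (n + 1)) :
    Commute (mulX i : Module.End K (Mmod K n μ)) (mulX j) := by
  refine TensorProduct.ext' fun f v => ?_
  simp only [Module.End.mul_apply, mulX_tmul, mul_left_comm]

/-- Vector valued polynomials are generated by constants under the multiplications. -/
theorem Mmod.induction {p : Mmod K n μ → Prop} (const : ∀ v : Vmod K n μ, p (1 ⊗ₜ[K] v))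
    (add : ∀ P Q, p P → p Q → p (P + Q)) (mul : ∀ j P, p P → p (mulX j P)) (P : Mmod K n μ) :
    p P := by
  induction P using TensorProduct.induction_on with
  | zero => rw [← TensorProduct.tmul_zero _ (1 : Pol K n)]; exact const 0
  | add P Q hP hQ => exact add P Q hP hQ
  | tmul f v =>
    induction f using MvPolynomial.induction_on generalizing v with
    | C a =>
      rw [← mul_one (MvPolynomial.C a), ← MvPolynomial.smul_eq_C_mul, TensorProduct.smul_tmul]
      exact const _
    | add f g hf hg => rw [TensorProduct.add_tmul]; exact add _ _ (hf v) (hg v)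
    | mul_X f j hf => rw [mul_comm, ← mulX_tmul]; exact mul j _ (hf v)

/-- Operators that agree on constants agree if agreement is preserved by the multiplications. -/
theorem Mmod.end_ext {A B : Module.End K (Mmod K n μ)}
    (const : ∀ v : Vmod K n μ, A (1 ⊗ₜ[K] v) = B (1 ⊗ₜ[K] v))
    (mul : ∀ j P, A P = B P → A (mulX j P) = B (mulX j P)) : A = B :=
  LinearMap.ext (Mmod.induction const (fun P Q hP hQ => by rw [map_add, map_add, hP, hQ]) mul)

theorem mulX_injective (j : Fin (n + 1)) :
    Function.Injective (mulX j : Module.End K (Mmod K n μ)) :=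
  Module.Flat.rTensor_preserves_injective_linearMap (M := Vmod K n μ)
    (LinearMap.mulLeft K (MvPolynomial.X j : Pol K n))
    (mul_right_injective₀ (MvPolynomial.X_ne_zero j))

theorem bT_tmul (s : K) (i : Fin n) (f : Pol K n) (v : Vmod K n μ) :
    bT s i (f ⊗ₜ[K] v) = deltaX s i f ⊗ₜ[K] v + sX i f ⊗ₜ[K] heckeV s i v := rfl

theorem bT_const (s : K) (i : Fin n) (v : Vmod K n μ) :
    bT s i ((1 : Pol K n) ⊗ₜ[K] v) = 1 ⊗ₜ[K] heckeV s i v := by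
  rw [bT_tmul, deltaX_apply, dividedDiff_one, mul_zero, smul_zero, TensorProduct.zero_tmul,
    zero_add]
  simp [sX]

theorem bT_mulX_castSucc (s : K) (i : Fin n) (P : Mmod K n μ) :
    bT s i (mulX i.castSucc P) = mulX i.succ (bT s i P) + (1 - s) • mulX i.succ P := by
  induction P using TensorProduct.induction_on with
  | zero => simp
  | add P Q hP hQ => simp only [map_add, hP, hQ, smul_add]; abel
  | tmul f v =>
    rw [mulX_tmul, bT_tmul, bT_tmul, map_add, mulX_tmul, mulX_tmul, mulX_tmul, sX_mul, sX_X,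
      Equiv.swap_apply_left, deltaX_apply, deltaX_apply, dividedDiff_mul, dividedDiff_X_castSucc,
      sX_X, Equiv.swap_apply_left, one_mul, mul_smul_comm, mul_add, smul_add,
      TensorProduct.add_tmul, TensorProduct.smul_tmul' (1 - s) (_ * f)]
    abel

theorem bT_mulX_succ (s : K) (i : Fin n) (P : Mmod K n μ) :
    bT s i (mulX i.succ P) = mulX i.castSucc (bT s i P) - (1 - s) • mulX i.succ P := by
  induction P using TensorProduct.induction_on with
  | zero => simp
  | add P Q hP hQ => simp only [map_add, hP, hQ, smul_add]; abel
  | tmul f v =>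
    rw [mulX_tmul, bT_tmul, bT_tmul, map_add, mulX_tmul, mulX_tmul, sX_mul, sX_X,
      Equiv.swap_apply_right, deltaX_apply, deltaX_apply, dividedDiff_mul, dividedDiff_X_succ,
      sX_X, Equiv.swap_apply_right, neg_one_mul, mul_smul_comm, mul_add, mul_neg, smul_add,
      smul_neg, TensorProduct.add_tmul, TensorProduct.neg_tmul,
      TensorProduct.smul_tmul' (1 - s) (_ * f), mul_left_comm]
    abel

theorem bT_mulX_of_ne (s : K) {i : Fin n} {j : Fin (n + 1)} (h₁ : j ≠ i.castSucc)
    (h₂ : j ≠ i.succ) (P : Mmod K n μ) : bT s i (mulX j P) = mulX j (bT s i P) := by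
  induction P using TensorProduct.induction_on with
  | zero => simp
  | add P Q hP hQ => simp only [map_add, hP, hQ]
  | tmul f v =>
    rw [mulX_tmul, bT_tmul, bT_tmul, map_add, mulX_tmul, mulX_tmul, sX_mul, sX_X,
      Equiv.swap_apply_of_ne_of_ne h₁ h₂, deltaX_apply, deltaX_apply, dividedDiff_mul,
      dividedDiff_X_ne h₁ h₂, sX_X, Equiv.swap_apply_of_ne_of_ne h₁ h₂, zero_mul, zero_add,
      mul_smul_comm, mul_left_comm]

theorem bT_bT {s : K} (hs0 : s ≠ 0) (hs : ∀ m : ℤ, m ≠ 0 → s ^ m ≠ 1) (i : Fin n)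
    (P : Mmod K n μ) : bT s i (bT s i P) = (s - 1) • bT s i P + s • P := by
  suffices h : bT s i * bT s i = (s - 1) • bT s i + s • (1 : Module.End K (Mmod K n μ)) from
    LinearMap.congr_fun h P
  refine Mmod.end_ext (fun v => ?_) fun j P hP => ?_
  · have := LinearMap.congr_fun (heckeV_sq hs0 hs i) v
    simp only [Module.End.mul_apply, LinearMap.add_apply, LinearMap.smul_apply,
      Module.End.one_apply] at this ⊢
    rw [bT_const, bT_const, this, TensorProduct.tmul_add, TensorProduct.tmul_smul,
      TensorProduct.tmul_smul]
  · simp only [Module.End.mul_apply, LinearMap.add_apply, LinearMap.smul_apply,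
      Module.End.one_apply] at hP ⊢
    by_cases h₁ : j = i.castSucc
    · subst h₁
      simp only [bT_mulX_castSucc, bT_mulX_succ, map_add, map_smul, hP]
      module
    by_cases h₂ : j = i.succ
    · subst h₂
      simp only [bT_mulX_castSucc, bT_mulX_succ, map_add, map_sub, map_smul, hP]
      module
    · simp only [bT_mulX_of_ne s h₁ h₂, hP, map_add, map_smul]

theorem bT_braid {s : K} (hs0 : s ≠ 0) (hs : ∀ m : ℤ, m ≠ 0 → s ^ m ≠ 1) {i j : Fin n}
    (hij : (i : ℕ) + 1 = j) :
    (bT s i * bT s j * bT s i : Module.End K (Mmod K n μ)) = bT s j * bT s i * bT s j := by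
  have e : i.succ = j.castSucc := Fin.ext (by simp [hij])
  have hj : ∀ P : Mmod K n μ, bT s i (mulX j.succ P) = mulX j.succ (bT s i P) :=
    bT_mulX_of_ne s (by simp [Fin.ext_iff]; omega) (by simp [Fin.ext_iff]; omega)
  have hi : ∀ P : Mmod K n μ, bT s j (mulX i.castSucc P) = mulX i.castSucc (bT s j P) :=
    bT_mulX_of_ne s (by simp [Fin.ext_iff]; omega) (by simp [Fin.ext_iff]; omega)
  have h₁ := bT_mulX_castSucc (μ := μ) s i
  have h₂ := bT_mulX_succ (μ := μ) s i
  have h₃ := bT_mulX_castSucc (μ := μ) s j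
  have h₄ := bT_mulX_succ (μ := μ) s j
  rw [e] at h₁ h₂
  refine Mmod.end_ext (fun v => ?_) fun k P hP => ?_
  · have := LinearMap.congr_fun (heckeV_braid hs0 hs hij) v
    simp only [Module.End.mul_apply, bT_const] at this ⊢
    rw [this]
  · simp only [Module.End.mul_apply] at hP ⊢
    by_cases k₁ : k = i.castSucc
    · subst k₁
      simp only [h₁, h₃, hi, hj, map_add, map_smul, hP, bT_bT hs0 hs]
      module
    by_cases k₂ : k = j.castSucc
    · subst k₂
      simp only [h₁, h₂, h₃, h₄, hi, hj, map_add, map_sub, map_smul, hP]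
      module
    by_cases k₃ : k = j.succ
    · subst k₃
      simp only [h₂, h₃, h₄, hi, hj, map_add, map_sub, map_smul, hP, bT_bT hs0 hs]
      module
    · simp only [bT_mulX_of_ne s k₁ (e ▸ k₂), bT_mulX_of_ne s k₂ k₃, hP]

theorem bT_comm {s : K} (hs0 : s ≠ 0) (hs : ∀ m : ℤ, m ≠ 0 → s ^ m ≠ 1) {i j : Fin n}
    (hij : (i : ℕ) + 1 < j) : Commute (bT s i : Module.End K (Mmod K n μ)) (bT s j) := by
  refine Mmod.end_ext (fun v => ?_) fun k P hP => ?_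
  · have := LinearMap.congr_fun (heckeV_comm hs0 hs hij).eq v
    simp only [Module.End.mul_apply, bT_const] at this ⊢
    rw [this]
  · simp only [Module.End.mul_apply] at hP ⊢
    have n₁ : j.castSucc ≠ i.castSucc := by simp [Fin.ext_iff]; omega
    have n₂ : j.castSucc ≠ i.succ := by simp [Fin.ext_iff]; omega
    have n₃ : j.succ ≠ i.castSucc := by simp [Fin.ext_iff]; omega
    have n₄ : j.succ ≠ i.succ := by simp [Fin.ext_iff]; omega
    by_cases hi : k = i.castSucc ∨ k = i.succ
    · have hj : k ≠ j.castSucc ∧ k ≠ j.succ := by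
        rcases hi with rfl | rfl
        · exact ⟨n₁.symm, n₃.symm⟩
        · exact ⟨n₂.symm, n₄.symm⟩
      rw [bT_mulX_of_ne s hj.1 hj.2]
      rcases hi with rfl | rfl
      · simp only [bT_mulX_castSucc, map_add, map_smul, bT_mulX_of_ne s n₂.symm n₄.symm, hP]
      · simp only [bT_mulX_succ, map_sub, map_smul, bT_mulX_of_ne s n₂.symm n₄.symm,
          bT_mulX_of_ne s n₁.symm n₃.symm, hP]
    · rw [not_or] at hi
      rw [bT_mulX_of_ne s hi.1 hi.2]
      by_cases hj : k = j.castSucc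
      · subst hj
        simp only [bT_mulX_castSucc, map_add, map_smul, bT_mulX_of_ne s n₃ n₄, hP]
      by_cases hj' : k = j.succ
      · subst hj'
        simp only [bT_mulX_succ, map_sub, map_smul, bT_mulX_of_ne s n₃ n₄, bT_mulX_of_ne s n₁ n₂,
          hP]
      · simp only [bT_mulX_of_ne s hj hj', bT_mulX_of_ne s hi.1 hi.2, hP]

end

section

variable {K : Type*} [Field K] {n : ℕ} {μ : YoungDiagram}

/-! ### The affine element -/

/-- The cyclic permutation effected by `θ^x = s_1 ⋯ s_{N-1}` on the variables. -/
def thetaPerm (n : ℕ) : Equiv.Perm (Fin (n + 1)) :=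
  descProd (extendNat (fun i : Fin n => Equiv.swap i.castSucc i.succ) 1) n

theorem thetaPerm_aux (n : ℕ) : ∀ k ≤ n, ∀ x : Fin (n + 1),
    ((descProd (extendNat (fun i : Fin n => Equiv.swap i.castSucc i.succ) 1) k x :
      Fin (n + 1)) : ℕ) = if (x : ℕ) = 0 then k else if (x : ℕ) ≤ k then (x : ℕ) - 1 else x
  | 0, _, x => by
    change (x : ℕ) = _
    split_ifs <;> omega
  | k + 1, hk, x => by
    have ih := thetaPerm_aux n k (by omega) x
    have hs : extendNat (fun i : Fin n => Equiv.swap i.castSucc i.succ) 1 k =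
        Equiv.swap (⟨k, by omega⟩ : Fin (n + 1)) ⟨k + 1, by omega⟩ :=
      extendNat_val _ _ (⟨k, hk⟩ : Fin n)
    rw [descProd_succ, Equiv.Perm.mul_apply, hs, Equiv.swap_apply_def]
    simp only [Fin.ext_iff, ih]
    have hx := x.isLt
    split_ifs <;> (try simp only [ih]) <;> (try split_ifs) <;> omega

theorem thetaPerm_zero (n : ℕ) : thetaPerm n 0 = Fin.last n :=
  Fin.ext (by rw [thetaPerm, thetaPerm_aux n n le_rfl]; simp)

theorem thetaPerm_succ (j : Fin n) : thetaPerm n j.succ = j.castSucc :=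
  Fin.ext (by rw [thetaPerm, thetaPerm_aux n n le_rfl]; simp)

/-- Renaming of variables by permutations. -/
def renameHom : Equiv.Perm (Fin (n + 1)) →* Module.End K (Pol K n) where
  toFun σ := (MvPolynomial.rename σ).toLinearMap
  map_one' := by ext; simp
  map_mul' σ τ := by
    refine LinearMap.ext fun f => ?_
    simp only [AlgHom.toLinearMap_apply, Module.End.mul_apply, MvPolynomial.rename_rename]
    rfl

theorem thetaX_eq : (thetaX : Module.End K (Pol K n)) = renameHom (thetaPerm n) := by
  rw [thetaPerm, map_descProd, thetaX]
  refine rightProd_finRange_eq_descProd _ _ fun i => ?_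
  rw [extendNat_val]
  rfl

open MvPolynomial in
theorem thetaX_mul_X (j : Fin (n + 1)) (f : Pol K n) :
    thetaX (X j * f) = X (thetaPerm n j) * thetaX f := by
  rw [thetaX_eq]
  simp [renameHom]

open MvPolynomial in
theorem tauX_X_zero_mul (q : K) (f : Pol K n) : tauX q (X 0 * f) = q • (X 0 * tauX q f) := by
  simp [tauX, smul_eq_C_mul, mul_assoc]

open MvPolynomial in
theorem tauX_X_succ_mul (q : K) (j : Fin n) (f : Pol K n) :
    tauX q (X j.succ * f) = X j.succ * tauX q f := by
  simp [tauX]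

theorem tauX_mul_tauX (q q' : K) :
    (tauX q * tauX q' : Module.End K (Pol K n)) = tauX (q * q') := by
  refine LinearMap.ext fun f => ?_
  induction f using MvPolynomial.induction_on with
  | C a => simp [tauX]
  | add f g hf hg => rw [map_add, map_add, hf, hg]
  | mul_X f j hf =>
    rw [Module.End.mul_apply] at hf ⊢
    rw [mul_comm]
    refine Fin.cases ?_ (fun j => ?_) j
    · rw [tauX_X_zero_mul, map_smul, tauX_X_zero_mul, tauX_X_zero_mul, hf, smul_smul, mul_comm q']
    · rw [tauX_X_succ_mul, tauX_X_succ_mul, tauX_X_succ_mul, hf]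

theorem tauX_one : (tauX 1 : Module.End K (Pol K n)) = 1 := by
  refine LinearMap.ext fun f => ?_
  simp [tauX]

theorem bw_tmul (q s : K) (f : Pol K n) (v : Vmod K n μ) :
    bw q s (f ⊗ₜ[K] v) = thetaX (tauX q f) ⊗ₜ[K] heckeS s v := by
  simp [bw, rightProd]

theorem bw_const (q s : K) (v : Vmod K n μ) :
    bw q s ((1 : Pol K n) ⊗ₜ[K] v) = 1 ⊗ₜ[K] heckeS s v := by
  rw [bw_tmul, thetaX_eq]
  simp [tauX, renameHom]

theorem bw_mulX_zero (q s : K) (P : Mmod K n μ) :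
    bw q s (mulX 0 P) = q • mulX (Fin.last n) (bw q s P) := by
  induction P using TensorProduct.induction_on with
  | zero => simp
  | add P Q hP hQ => simp only [map_add, hP, hQ, smul_add]
  | tmul f v =>
    rw [mulX_tmul, bw_tmul, bw_tmul, mulX_tmul, tauX_X_zero_mul, map_smul, thetaX_mul_X,
      thetaPerm_zero, TensorProduct.smul_tmul']

theorem bw_mulX_succ (q s : K) (j : Fin n) (P : Mmod K n μ) :
    bw q s (mulX j.succ P) = mulX j.castSucc (bw q s P) := by
  induction P using TensorProduct.induction_on with
  | zero => simp
  | add P Q hP hQ => simp only [map_add, hP, hQ]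
  | tmul f v =>
    rw [mulX_tmul, bw_tmul, bw_tmul, mulX_tmul, tauX_X_succ_mul, thetaX_mul_X, thetaPerm_succ]

/-! ### Generic parameters -/

/-- The parameters are nonzero and multiplicatively independent. -/
structure GenericParams (q s : K) : Prop where
  q_ne : q ≠ 0
  s_ne : s ≠ 0
  indep : ∀ a b : ℤ, q ^ a * s ^ b = 1 → a = 0 ∧ b = 0

namespace GenericParams

variable {q s : K}

theorem zpow_ne_one (h : GenericParams q s) (m : ℤ) (hm : m ≠ 0) : s ^ m ≠ 1 := fun e =>
  hm (h.indep 0 m (by rw [zpow_zero, one_mul, e])).2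

theorem inv (h : GenericParams q s) : GenericParams q⁻¹ s⁻¹ where
  q_ne := inv_ne_zero h.q_ne
  s_ne := inv_ne_zero h.s_ne
  indep a b e := by
    rw [inv_zpow', inv_zpow'] at e
    have := h.indep _ _ e
    omega

theorem eq_of_zpow_mul_zpow_eq (h : GenericParams q s) {a b a' b' : ℤ}
    (e : q ^ a * s ^ b = q ^ a' * s ^ b') : a = a' ∧ b = b' := by
  have := h.indep (a - a') (b - b') (by
    have h₁ := zpow_ne_zero a' h.q_ne
    have h₂ := zpow_ne_zero b' h.s_ne
    rw [zpow_sub₀ h.q_ne, zpow_sub₀ h.s_ne]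
    field_simp
    exact e)
  omega

/-! ### Invertibility of the generators -/

/-- The operator `T_i` on `V_μ` as a unit. -/
def heckeUnit (μ : YoungDiagram) (h : GenericParams q s) (i : Fin n) :
    (Module.End K (Vmod K n μ))ˣ :=
  have e : heckeV s i * (s⁻¹ • (heckeV s i + (1 - s) • 1)) =
      (1 : Module.End K (Vmod K n μ)) := by
    rw [mul_smul_comm, mul_add, heckeV_sq h.s_ne h.zpow_ne_one, mul_smul_comm, mul_one,
      inv_smul_eq_iff₀ h.s_ne]
    module
  ⟨heckeV s i, s⁻¹ • (heckeV s i + (1 - s) • 1), e, by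
    refine Eq.trans ?_ e
    simp only [smul_mul_assoc, mul_smul_comm, add_mul, mul_add, mul_one, one_mul]⟩

theorem val_heckeUnit (h : GenericParams q s) (i : Fin n) :
    (h.heckeUnit μ i : Module.End K (Vmod K n μ)) = heckeV s i := rfl

/-- Bold `T_i` as a unit, with inverse `bTinv s i`. -/
def bTUnit (μ : YoungDiagram) (h : GenericParams q s) (i : Fin n) :
    (Module.End K (Mmod K n μ))ˣ :=
  have e : bT s i * bTinv s i = (1 : Module.End K (Mmod K n μ)) := by
    refine LinearMap.ext fun P => ?_
    simp only [bTinv, Module.End.mul_apply, LinearMap.smul_apply, LinearMap.add_apply, map_smul,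
      map_add, bT_bT h.s_ne h.zpow_ne_one, Module.End.one_apply]
    rw [inv_smul_eq_iff₀ h.s_ne]
    module
  ⟨bT s i, bTinv s i, e, by
    refine Eq.trans ?_ e
    rw [bTinv]
    simp only [smul_mul_assoc, mul_smul_comm, add_mul, mul_add, mul_one, one_mul]⟩

theorem val_bTUnit (h : GenericParams q s) (i : Fin n) :
    (h.bTUnit μ i : Module.End K (Mmod K n μ)) = bT s i := rfl

theorem val_inv_bTUnit (h : GenericParams q s) (i : Fin n) :
    (↑(h.bTUnit μ i)⁻¹ : Module.End K (Mmod K n μ)) = bTinv s i := rfl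

/-- The sequence of units of `V_μ` given by the Hecke generators. -/
def heckeSeq (n : ℕ) (μ : YoungDiagram) (h : GenericParams q s) :
    ℕ → (Module.End K (Vmod K n μ))ˣ :=
  extendNat (h.heckeUnit μ) 1

/-- The sequence of units given by the bold Hecke generators. -/
def bTSeq (n : ℕ) (μ : YoungDiagram) (h : GenericParams q s) : ℕ → (Module.End K (Mmod K n μ))ˣ :=
  extendNat (h.bTUnit μ) 1

theorem bTSeq_val (h : GenericParams q s) (i : Fin n) : h.bTSeq n μ i = h.bTUnit μ i :=
  extendNat_val _ _ i

theorem isBraid_heckeSeq (h : GenericParams q s) : IsBraid n (h.heckeSeq n μ) where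
  braid i hi := by
    refine Units.ext ?_
    have := heckeV_braid (μ := μ) h.s_ne h.zpow_ne_one (i := (⟨i, by omega⟩ : Fin n))
      (j := ⟨i + 1, hi⟩) rfl
    simpa [heckeSeq, val_heckeUnit, extendNat, hi, Nat.lt_of_succ_lt hi] using this
  comm i j hij hj := by
    refine Units.ext ?_
    have := (heckeV_comm (μ := μ) h.s_ne h.zpow_ne_one (i := (⟨i, by omega⟩ : Fin n))
      (j := ⟨j, hj⟩) hij).eq
    simpa [heckeSeq, val_heckeUnit, extendNat, hj, show i < n by omega] using this

theorem isBraid_bTSeq (h : GenericParams q s) : IsBraid n (h.bTSeq n μ) where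
  braid i hi := by
    refine Units.ext ?_
    have := bT_braid (μ := μ) h.s_ne h.zpow_ne_one (i := (⟨i, by omega⟩ : Fin n))
      (j := ⟨i + 1, hi⟩) rfl
    simpa [bTSeq, val_bTUnit, extendNat, hi, Nat.lt_of_succ_lt hi] using this
  comm i j hij hj := by
    refine Units.ext ?_
    have := (bT_comm (μ := μ) h.s_ne h.zpow_ne_one (i := (⟨i, by omega⟩ : Fin n))
      (j := ⟨j, hj⟩) hij).eq
    simpa [bTSeq, val_bTUnit, extendNat, hj, show i < n by omega] using this

theorem val_descProd_heckeSeq (h : GenericParams q s) :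
    (↑(descProd (h.heckeSeq n μ) n) : Module.End K (Vmod K n μ)) = heckeS s := by
  have := map_descProd (Units.coeHom (Module.End K (Vmod K n μ))) (h.heckeSeq n μ) n
  refine this.trans (rightProd_finRange_eq_descProd _ _ fun i => ?_).symm
  simp only [heckeSeq, extendNat_val]
  rfl

theorem bw_eq_map (h : GenericParams q s) :
    bw q s = TensorProduct.map (renameHom (thetaPerm n) * tauX q)
      (↑(descProd (h.heckeSeq n μ) n) : Module.End K (Vmod K n μ)) := by
  rw [val_descProd_heckeSeq, ← thetaX_eq]
  simp [bw, rightProd]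

/-- The affine element `w` as a unit. -/
def bwUnit (n : ℕ) (μ : YoungDiagram) (h : GenericParams q s) : (Module.End K (Mmod K n μ))ˣ where
  val := bw q s
  inv := TensorProduct.map (tauX q⁻¹ * renameHom (thetaPerm n)⁻¹)
    ↑(descProd (h.heckeSeq n μ) n)⁻¹
  val_inv := by
    rw [h.bw_eq_map, ← TensorProduct.map_mul, mul_assoc, ← mul_assoc (tauX q), tauX_mul_tauX,
      mul_inv_cancel₀ h.q_ne, tauX_one, one_mul, ← map_mul, mul_inv_cancel, map_one, Units.mul_inv,
      TensorProduct.map_one]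
  inv_val := by
    rw [h.bw_eq_map, ← TensorProduct.map_mul, mul_assoc, ← mul_assoc (renameHom _), ← map_mul,
      inv_mul_cancel, map_one, one_mul, tauX_mul_tauX, inv_mul_cancel₀ h.q_ne, tauX_one,
      Units.inv_mul, TensorProduct.map_one]

theorem val_bwUnit (h : GenericParams q s) :
    (h.bwUnit n μ : Module.End K (Mmod K n μ)) = bw q s := rfl

theorem bw_bT (h : GenericParams q s) {i j : Fin n} (hij : (i : ℕ) + 1 = j) :
    (bw q s * bT s j : Module.End K (Mmod K n μ)) = bT s i * bw q s := by
  have e : i.succ = j.castSucc := Fin.ext (by simp [hij])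
  refine Mmod.end_ext (fun v => ?_) fun k P hP => ?_
  · have := congrArg Units.val ((h.isBraid_heckeSeq (n := n) (μ := μ)).mul_descProd (i := i)
      (k := n) (by omega) le_rfl)
    rw [Units.val_mul, Units.val_mul, val_descProd_heckeSeq, hij] at this
    simp only [heckeSeq, extendNat_val] at this
    have := LinearMap.congr_fun this v
    simp only [Module.End.mul_apply, bT_const, bw_const]
    exact congrArg _ this.symm
  · simp only [Module.End.mul_apply] at hP ⊢
    have h₁ := bT_mulX_castSucc (μ := μ) s i
    have h₂ := bT_mulX_succ (μ := μ) s i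
    rw [e] at h₁ h₂
    by_cases k₁ : k = j.castSucc
    · subst k₁
      rw [bT_mulX_castSucc, map_add, map_smul, bw_mulX_succ, bw_mulX_succ, hP, ← e, bw_mulX_succ,
        bT_mulX_castSucc, e]
    by_cases k₂ : k = j.succ
    · subst k₂
      rw [bT_mulX_succ, map_sub, map_smul, bw_mulX_succ, h₂, ← hP, ← e, bw_mulX_succ]
    · rw [bT_mulX_of_ne s k₁ k₂]
      refine Fin.cases ?_ (fun l k₁ k₂ => ?_) k k₁ k₂
      · intro _ _
        rw [bw_mulX_zero, hP, bw_mulX_zero, map_smul, bT_mulX_of_ne]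
        · simp [Fin.ext_iff]; omega
        · simp [Fin.ext_iff]; omega
      · rw [bw_mulX_succ, hP, bw_mulX_succ, bT_mulX_of_ne]
        · intro e'
          exact k₁ (by rw [← e]; simpa [Fin.ext_iff] using e')
        · intro e'
          exact k₂ (by simp [Fin.ext_iff] at e' ⊢; omega)

theorem bw_bw_bT (h : GenericParams q s) {i j : Fin n} (hi : (i : ℕ) = 0) (hj : (j : ℕ) + 1 = n) :
    (bw q s * bw q s * bT s i : Module.End K (Mmod K n μ)) = bT s j * (bw q s * bw q s) := by
  have e₀ : i.castSucc = 0 := Fin.ext (by simp [hi])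
  have e₁ : j.succ = Fin.last n := Fin.ext (by simp [hj])
  refine Mmod.end_ext (fun v => ?_) fun k P hP => ?_
  · have := congrArg Units.val
      ((h.isBraid_heckeSeq (n := n) (μ := μ)).descProd_sq (m := j) hj.symm)
    simp only [Units.val_mul, val_descProd_heckeSeq] at this
    rw [← hi] at this
    simp only [heckeSeq, extendNat_val] at this
    have := LinearMap.congr_fun this v
    simp only [Module.End.mul_apply, bT_const, bw_const]
    exact congrArg _ this
  · simp only [Module.End.mul_apply] at hP ⊢
    have w₀ : ∀ P : Mmod K n μ, bw q s (mulX i.castSucc P) = q • mulX j.succ (bw q s P) := by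
      rw [e₀, e₁]; exact bw_mulX_zero q s
    have w₁ : ∀ P : Mmod K n μ, bw q s (mulX j.succ P) = mulX j.castSucc (bw q s P) :=
      bw_mulX_succ q s j
    have w₂ : ∀ P : Mmod K n μ, bw q s (mulX i.succ P) = mulX i.castSucc (bw q s P) :=
      bw_mulX_succ q s i
    by_cases k₁ : k = i.castSucc
    · subst k₁
      simp only [bT_mulX_castSucc, map_add, map_smul, w₀, w₁, w₂, hP]
      module
    by_cases k₂ : k = i.succ
    · subst k₂
      simp only [bT_mulX_succ, map_sub, map_smul, w₀, w₁, w₂, hP]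
      module
    · rw [bT_mulX_of_ne s k₁ k₂]
      obtain ⟨l, rfl⟩ : ∃ l : Fin n, k = l.succ :=
        ⟨k.pred (by rw [← e₀]; exact k₁), (Fin.succ_pred _ _).symm⟩
      obtain ⟨m, hm⟩ : ∃ m : Fin n, l.castSucc = m.succ :=
        ⟨⟨l - 1, by omega⟩, by
          simp only [Fin.ext_iff, Fin.val_succ, Fin.val_castSucc] at k₂ ⊢
          omega⟩
      rw [bw_mulX_succ, bw_mulX_succ, hm, bw_mulX_succ, bw_mulX_succ, hP, bT_mulX_of_ne]
      all_goals
        simp only [ne_eq, Fin.ext_iff, Fin.val_succ, Fin.val_castSucc] at hm ⊢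
        omega

/-- The multiplications by the variables as a sequence. -/
def _root_.VectorMacdonald.mulXSeq (K : Type*) [Field K] (n : ℕ) (μ : YoungDiagram) :
    ℕ → Module.End K (Mmod K n μ) :=
  extendNat mulX 0

/-- The bold operators satisfy the double affine Hecke relations. -/
theorem dahaRel (h : GenericParams q s) :
    DahaRel n q s (h.bTSeq n μ) (h.bwUnit n μ) (mulXSeq K n μ) where
  toIsBraid := h.isBraid_bTSeq
  shift i hi := by
    refine Units.ext ?_
    have := h.bw_bT (μ := μ) (i := (⟨i, by omega⟩ : Fin n)) (j := ⟨i + 1, hi⟩) rfl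
    simpa [bTSeq, val_bTUnit, val_bwUnit, extendNat, hi, Nat.lt_of_succ_lt hi] using this
  shift_sq m hm := by
    refine Units.ext ?_
    have := h.bw_bw_bT (μ := μ) (i := (⟨0, by omega⟩ : Fin n)) (j := ⟨m, by omega⟩) rfl hm.symm
    simpa [bTSeq, val_bTUnit, val_bwUnit, extendNat, show 0 < n by omega, show m < n by omega]
      using this
  q_ne := h.q_ne
  s_ne := h.s_ne
  smul_inv i hi := by
    obtain ⟨i, rfl⟩ : ∃ j : Fin n, (j : ℕ) = i := ⟨⟨i, hi⟩, rfl⟩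
    rw [bTSeq_val, val_inv_bTUnit, val_bTUnit, bTinv, smul_inv_smul₀ h.s_ne]
  t_X_t i hi := by
    obtain ⟨i, rfl⟩ : ∃ j : Fin n, (j : ℕ) = i := ⟨⟨i, hi⟩, rfl⟩
    have e₁ : mulXSeq K n μ i = mulX i.castSucc := extendNat_val mulX 0 i.castSucc
    have e₂ : mulXSeq K n μ (i + 1) = mulX i.succ := extendNat_val mulX 0 i.succ
    rw [bTSeq_val, val_bTUnit, e₁, e₂]
    refine LinearMap.ext fun P => ?_
    simp only [Module.End.mul_apply, LinearMap.smul_apply, bT_mulX_castSucc,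
      bT_bT h.s_ne h.zpow_ne_one, map_add, map_smul]
    module
  t_X i j hi hj h₁ h₂ := by
    obtain ⟨i, rfl⟩ : ∃ j : Fin n, (j : ℕ) = i := ⟨⟨i, hi⟩, rfl⟩
    obtain ⟨j, rfl⟩ : ∃ k : Fin (n + 1), (k : ℕ) = j := ⟨⟨j, by omega⟩, rfl⟩
    rw [bTSeq_val, val_bTUnit, mulXSeq, extendNat_val]
    exact LinearMap.ext fun P => bT_mulX_of_ne s (fun e => h₁ (by rw [e]; rfl))
      (fun e => h₂ (by rw [e]; rfl)) P
  X_X i j hi hj := by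
    obtain ⟨i, rfl⟩ : ∃ k : Fin (n + 1), (k : ℕ) = i := ⟨⟨i, by omega⟩, rfl⟩
    obtain ⟨j, rfl⟩ : ∃ k : Fin (n + 1), (k : ℕ) = j := ⟨⟨j, by omega⟩, rfl⟩
    rw [mulXSeq, extendNat_val, extendNat_val]
    exact mulX_comm i j
  W_X_zero := by
    have e₁ : mulXSeq K n μ 0 = mulX 0 := extendNat_val mulX 0 0
    have e₂ : mulXSeq K n μ n = mulX (Fin.last n) := extendNat_val mulX 0 (Fin.last n)
    rw [e₁, e₂, val_bwUnit]
    exact LinearMap.ext (bw_mulX_zero q s)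
  W_X_succ j hj := by
    obtain ⟨j, rfl⟩ : ∃ k : Fin n, (k : ℕ) = j := ⟨⟨j, by omega⟩, rfl⟩
    have e₁ : mulXSeq K n μ j = mulX j.castSucc := extendNat_val mulX 0 j.castSucc
    have e₂ : mulXSeq K n μ (j + 1) = mulX j.succ := extendNat_val mulX 0 j.succ
    rw [e₁, e₂, val_bwUnit]
    exact LinearMap.ext (bw_mulX_succ q s j)
  X_cancel j hj A B e := by
    obtain ⟨j, rfl⟩ : ∃ k : Fin (n + 1), (k : ℕ) = j := ⟨⟨j, by omega⟩, rfl⟩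
    rw [mulXSeq, extendNat_val] at e
    exact LinearMap.ext fun P => mulX_injective j (LinearMap.congr_fun e P)

end GenericParams

end

/-! ### Cherednik operators -/

theorem inv_descProd {G : Type*} [Group G] (σ : ℕ → G) (k : ℕ) :
    (descProd σ k)⁻¹ = ascProd (fun i => (σ i)⁻¹) k := by
  induction k with
  | zero => exact inv_one
  | succ k ih => rw [descProd_succ, mul_inv_rev, ih]; rfl

theorem inv_ascProd {G : Type*} [Group G] (σ : ℕ → G) (k : ℕ) :
    (ascProd σ k)⁻¹ = descProd (fun i => (σ i)⁻¹) k := by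
  induction k with
  | zero => exact inv_one
  | succ k ih => rw [ascProd_succ, mul_inv_rev, ih]; rfl

theorem finRange_ext {n : ℕ} {L L' : List (Fin n)} (hL : L.Pairwise (· < ·))
    (hL' : L'.Pairwise (· < ·)) (h : ∀ i, i ∈ L ↔ i ∈ L') : L = L' := by
  refine List.Perm.eq_of_pairwise (fun a b _ _ h₁ h₂ => absurd h₂ h₁.not_gt) hL hL' ?_
  rw [List.perm_ext_iff_of_nodup (hL.imp ne_of_lt) (hL'.imp ne_of_lt)]
  exact h

theorem filter_lt_succ {n : ℕ} (i : Fin n) :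
    (List.finRange n).filter (fun j : Fin n => (j : ℕ) < (i : ℕ) + 1) =
      (List.finRange n).filter (fun j : Fin n => (j : ℕ) < (i : ℕ)) ++ [i] := by
  refine finRange_ext ((List.pairwise_lt_finRange n).filter _) ?_ fun j => ?_
  · rw [List.pairwise_append]
    refine ⟨(List.pairwise_lt_finRange n).filter _, List.pairwise_singleton _ _, ?_⟩
    intro a ha b hb
    simp only [List.mem_filter, decide_eq_true_eq, List.mem_singleton] at ha hb
    rw [hb]
    exact ha.2
  · simp [Fin.ext_iff]
    omega

theorem filter_le {n : ℕ} (i : Fin n) :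
    (List.finRange n).filter (fun j : Fin n => (i : ℕ) ≤ (j : ℕ)) =
      i :: (List.finRange n).filter (fun j : Fin n => (i : ℕ) + 1 ≤ (j : ℕ)) := by
  refine finRange_ext ((List.pairwise_lt_finRange n).filter _) ?_ fun j => ?_
  · rw [List.pairwise_cons]
    refine ⟨fun a ha => ?_, (List.pairwise_lt_finRange n).filter _⟩
    simp only [List.mem_filter, decide_eq_true_eq] at ha
    exact ha.2
  · simp [Fin.ext_iff]
    omega

section

variable {K : Type*} [Field K] {n : ℕ} {μ : YoungDiagram} {q s : K}

theorem cherednik_eq (q s : K) (i : Fin (n + 1)) :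
    (cherednik q s i : Module.End K (Mmod K n μ)) = s ^ ((i : ℤ) - (n : ℤ)) •
      ((((List.finRange n).filter (fun j : Fin n => (i : ℕ) ≤ (j : ℕ))).map (bT s)).prod * bw q s *
        (((List.finRange n).filter (fun j : Fin n => (j : ℕ) < (i : ℕ))).map (bTinv s)).prod) := by
  rw [cherednik, rightProd]
  simp only [List.reverse_append, List.map_reverse, List.reverse_reverse, List.prod_append,
    List.reverse_singleton, List.prod_singleton, mul_assoc]

namespace GenericParams

theorem cherednik_castSucc (h : GenericParams q s) (i : Fin n) :
    (cherednik q s i.castSucc : Module.End K (Mmod K n μ)) =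
      s⁻¹ • (bT s i * cherednik q s i.succ * bT s i) := by
  have e : (bTinv s i * bT s i : Module.End K (Mmod K n μ)) = 1 := (h.bTUnit μ i).inv_mul
  have hs : s ^ ((i : ℤ) - n) = s⁻¹ * s ^ ((i : ℤ) + 1 - n) := by
    rw [← zpow_neg_one, ← zpow_add₀ h.s_ne]
    congr 1
    ring
  rw [cherednik_eq, cherednik_eq]
  simp only [Fin.val_castSucc, Fin.val_succ, filter_lt_succ, filter_le, List.map_cons,
    List.prod_cons, List.map_append, List.prod_append, List.map_nil, List.prod_nil, mul_one,
    mul_smul_comm, smul_mul_assoc, smul_smul, mul_assoc, e, Nat.cast_add, Nat.cast_one, hs]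

theorem cherednik_last (h : GenericParams q s) :
    (cherednik q s (Fin.last n) : Module.End K (Mmod K n μ)) =
      ↑(h.bwUnit n μ * (descProd (h.bTSeq n μ) n)⁻¹) := by
  have e₁ : (List.finRange n).filter
      (fun j : Fin n => ((Fin.last n : Fin (n + 1)) : ℕ) ≤ j) = [] := by
    simp
  have e₂ : (List.finRange n).filter (fun j : Fin n => (j : ℕ) < (Fin.last n : Fin (n + 1))) =
      List.finRange n := by
    simp
  have e₃ : (((List.finRange n).map (bTinv s)).prod : Module.End K (Mmod K n μ)) =
      ↑(descProd (h.bTSeq n μ) n)⁻¹ := by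
    rw [inv_descProd]
    refine (prod_finRange_eq_ascProd _ _ fun i => ?_).trans
      (map_ascProd (Units.coeHom (Module.End K (Mmod K n μ))) _ n).symm
    simp only [bTSeq_val]
    rfl
  rw [cherednik_eq, e₁, e₂, e₃, Fin.val_last, sub_self, zpow_zero, one_smul, List.map_nil,
    List.prod_nil, one_mul]
  rfl

/-- The Cherednik operators as a sequence. -/
def _root_.VectorMacdonald.cherednikSeq (q s : K) (n : ℕ) (μ : YoungDiagram) :
    ℕ → Module.End K (Mmod K n μ) :=
  extendNat (cherednik q s) 0

theorem _root_.VectorMacdonald.cherednikSeq_val (i : Fin (n + 1)) :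
    cherednikSeq q s n μ i = cherednik q s i :=
  extendNat_val _ _ i

theorem _root_.VectorMacdonald.cherednikSeq_castSucc (i : Fin n) :
    cherednikSeq q s n μ i = cherednik q s i.castSucc :=
  cherednikSeq_val i.castSucc

theorem _root_.VectorMacdonald.cherednikSeq_succ (i : Fin n) :
    cherednikSeq q s n μ (i + 1) = cherednik q s i.succ :=
  cherednikSeq_val i.succ

theorem _root_.VectorMacdonald.cherednikSeq_last :
    cherednikSeq q s n μ n = cherednik q s (Fin.last n) :=
  cherednikSeq_val (Fin.last n)

theorem _root_.VectorMacdonald.cherednikSeq_zero :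
    cherednikSeq q s n μ 0 = cherednik q s 0 :=
  cherednikSeq_val 0

theorem isHeckeFamily_cherednikSeq (h : GenericParams q s) :
    IsHeckeFamily n s (h.bTSeq n μ) (cherednikSeq q s n μ) := by
  intro i hi
  obtain ⟨i, rfl⟩ : ∃ j : Fin n, (j : ℕ) = i := ⟨⟨i, hi⟩, rfl⟩
  rw [cherednikSeq_castSucc, cherednikSeq_succ, h.cherednik_castSucc, bTSeq_val, val_bTUnit]

theorem cherednikSeq_last_eq (h : GenericParams q s) :
    cherednikSeq q s n μ n = ↑(h.bwUnit n μ * (descProd (h.bTSeq n μ) n)⁻¹) := by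
  rw [cherednikSeq_last, h.cherednik_last]

theorem isUnit_cherednik (h : GenericParams q s) (i : Fin (n + 1)) :
    IsUnit (cherednik q s i : Module.End K (Mmod K n μ)) := by
  induction i using Fin.reverseInduction with
  | last => rw [h.cherednik_last]; exact Units.isUnit _
  | cast i ih =>
    rw [h.cherednik_castSucc]
    exact (((h.bTUnit μ i).isUnit.mul ih).mul (h.bTUnit μ i).isUnit).smul
      (Units.mk0 _ (inv_ne_zero h.s_ne))

theorem commute_bT_cherednik (h : GenericParams q s) {i : Fin n} {j : Fin (n + 1)}
    (h₁ : j ≠ i.castSucc) (h₂ : j ≠ i.succ) :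
    Commute (bT s i : Module.End K (Mmod K n μ)) (cherednik q s j) := by
  have hd := h.dahaRel (n := n) (μ := μ)
  have := hd.commute_family h.isHeckeFamily_cherednikSeq
    (fun i hi => by rw [h.cherednikSeq_last_eq]; exact (hd.commute_last hi).units_val) i.isLt
    (Nat.lt_succ_iff.1 j.isLt) (fun e => h₁ (Fin.ext e)) (fun e => h₂ (Fin.ext e))
  rwa [bTSeq_val, val_bTUnit, cherednikSeq_val] at this

theorem cherednik_mul_bT (h : GenericParams q s) (i : Fin n) :
    (cherednik q s i.castSucc * bT s i : Module.End K (Mmod K n μ)) =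
      bT s i * cherednik q s i.succ + (s - 1) • cherednik q s i.castSucc := by
  have := (h.dahaRel (n := n) (μ := μ)).family_mul_t
    h.isHeckeFamily_cherednikSeq i.isLt
  rwa [cherednikSeq_castSucc, cherednikSeq_succ, bTSeq_val, val_bTUnit] at this

theorem cherednik_succ_mul_bT (h : GenericParams q s) (i : Fin n) :
    (cherednik q s i.succ * bT s i : Module.End K (Mmod K n μ)) =
      bT s i * cherednik q s i.castSucc + (1 - s) • cherednik q s i.castSucc := by
  have := (h.dahaRel (n := n) (μ := μ)).family_succ_mul_t
    h.isHeckeFamily_cherednikSeq i.isLt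
  rwa [cherednikSeq_castSucc, cherednikSeq_succ, bTSeq_val, val_bTUnit] at this

theorem raising_eq (h : GenericParams q s) :
    (raising s : Module.End K (Mmod K n μ)) =
      mulXSeq K n μ n * ↑(ascProd (h.bTSeq n μ) n)⁻¹ := by
  have e₁ : mulXSeq K n μ n = mulX (Fin.last n) := extendNat_val mulX 0 (Fin.last n)
  have e₂ : (rightProd ((List.finRange n).map (bTinv s)) : Module.End K (Mmod K n μ)) =
      ↑(ascProd (h.bTSeq n μ) n)⁻¹ := by
    rw [inv_ascProd]
    refine (rightProd_finRange_eq_descProd _ _ fun i => ?_).trans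
      (map_descProd (Units.coeHom (Module.End K (Mmod K n μ))) _ n).symm
    simp only [bTSeq_val]
    rfl
  rw [e₁, ← e₂, raising, rightProd, rightProd, List.reverse_append, List.reverse_singleton,
    List.prod_append, List.prod_singleton]

theorem cherednik_mul_raising (h : GenericParams q s) (j : Fin n) :
    (cherednik q s j.castSucc * raising s : Module.End K (Mmod K n μ)) =
      raising s * cherednik q s j.succ := by
  have := (h.dahaRel (n := n) (μ := μ)).family_mul_raising
    h.isHeckeFamily_cherednikSeq h.cherednikSeq_last_eq j.isLt
  rwa [cherednikSeq_castSucc, cherednikSeq_succ, ← h.raising_eq] at this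

theorem cherednik_last_mul_raising (h : GenericParams q s) :
    (cherednik q s (Fin.last n) * raising s : Module.End K (Mmod K n μ)) =
      q • (raising s * cherednik q s 0) := by
  have := (h.dahaRel (n := n) (μ := μ)).last_mul_raising
    h.isHeckeFamily_cherednikSeq h.cherednikSeq_last_eq
  rwa [cherednikSeq_last, cherednikSeq_zero, ← h.raising_eq] at this

/-! ### Constants -/

theorem descProd_bTSeq_const (h : GenericParams q s) (v : Vmod K n μ) : ∀ k,
    (↑(descProd (h.bTSeq n μ) k) : Module.End K (Mmod K n μ)) ((1 : Pol K n) ⊗ₜ[K] v) =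
      1 ⊗ₜ[K] (↑(descProd (h.heckeSeq n μ) k) : Module.End K (Vmod K n μ)) v
  | 0 => by simp [descProd]
  | k + 1 => by
    rw [descProd_succ, descProd_succ, Units.val_mul, Units.val_mul, Module.End.mul_apply,
      Module.End.mul_apply, h.descProd_bTSeq_const v k]
    by_cases hk : k < n
    · rw [show k = ((⟨k, hk⟩ : Fin n) : ℕ) from rfl, bTSeq_val, heckeSeq, extendNat_val, val_bTUnit,
        val_heckeUnit, bT_const]
    · simp [bTSeq, heckeSeq, extendNat, hk]

/-- The two factors of `ξ_N`, namely `w` and the inverse of a product of bold generators, act on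
constants by `S` and by its inverse. -/
theorem cherednik_last_const (h : GenericParams q s) (v : Vmod K n μ) :
    cherednik q s (Fin.last n) ((1 : Pol K n) ⊗ₜ[K] v) = 1 ⊗ₜ[K] v := by
  set u : Vmod K n μ := (↑(descProd (h.heckeSeq n μ) n)⁻¹ : Module.End K (Vmod K n μ)) v with hu
  have hv : v = (↑(descProd (h.heckeSeq n μ) n) : Module.End K (Vmod K n μ)) u := by
    rw [hu, ← Module.End.mul_apply, Units.mul_inv, Module.End.one_apply]
  rw [h.cherednik_last, Units.val_mul, Module.End.mul_apply, val_bwUnit]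
  have e : (↑(descProd (h.bTSeq n μ) n)⁻¹ : Module.End K (Mmod K n μ)) (1 ⊗ₜ[K] v) =
      1 ⊗ₜ[K] u := by
    rw [hv, ← h.descProd_bTSeq_const, ← Module.End.mul_apply, Units.inv_mul, Module.End.one_apply]
  rw [e, bw_const, ← h.val_descProd_heckeSeq, ← hv]

/-- On constants, the Cherednik operators are the Jucys--Murphy elements: they act on tableaux by
the contents. -/
theorem cherednik_ofTab (h : GenericParams q s) (i : Fin (n + 1)) (T : RST n μ) :
    cherednik q s i (ofTab T : Mmod K n μ) = s ^ T.ct i • ofTab T := by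
  induction i using Fin.reverseInduction generalizing T with
  | last => rw [ofTab, h.cherednik_last_const, T.ct_last, zpow_zero, one_smul]
  | cast i ih =>
    let Y : Module.End K (Vmod K n μ) := Finsupp.linearCombination K fun T =>
      s ^ T.ct i.succ • Finsupp.single T 1
    have hY : ∀ T, Y (Finsupp.single T 1) = s ^ T.ct i.succ • Finsupp.single T 1 :=
      fun T => by simp [Y]
    have hc : ∀ v : Vmod K n μ, cherednik q s i.succ ((1 : Pol K n) ⊗ₜ[K] v) = 1 ⊗ₜ[K] Y v := by
      intro v
      suffices e : cherednik q s i.succ ∘ₗ TensorProduct.mk K (Pol K n) (Vmod K n μ) 1 =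
          TensorProduct.mk K (Pol K n) (Vmod K n μ) 1 ∘ₗ Y from LinearMap.congr_fun e v
      refine Finsupp.lhom_ext' fun T => LinearMap.ext_ring ?_
      simp only [LinearMap.comp_apply, Finsupp.lsingle_apply, hY, map_smul, TensorProduct.mk_apply]
      exact ih T
    rw [h.cherednik_castSucc, LinearMap.smul_apply, Module.End.mul_apply, Module.End.mul_apply,
      ofTab, bT_const, hc, bT_const, heckeV_content_step h.s_ne h.zpow_ne_one i Y hY,
      TensorProduct.tmul_smul, smul_smul, inv_mul_cancel_left₀ h.s_ne]

/-! ### Dunkl operators -/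

theorem divX_mulX (P : Mmod K n μ) : divX (mulX (Fin.last n) P) = P := by
  induction P using TensorProduct.induction_on with
  | zero => simp
  | add P Q hP hQ => rw [map_add, map_add, hP, hQ]
  | tmul f v =>
    rw [mulX_tmul, divX, TensorProduct.map_tmul]
    exact congrArg (· ⊗ₜ[K] v) (MvPolynomial.X_mul_divMonomial _ _)

/-- The values of `1 - ξ_N` are divisible by `x_N`. The constants are annihilated, and divisibility
is preserved by the multiplications. -/
theorem exists_bF_eq_mulX (h : GenericParams q s) (Q : Mmod K n μ) :
    ∃ P, bF q s Q = mulX (Fin.last n) P := by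
  induction Q using Mmod.induction with
  | const v =>
    refine ⟨0, ?_⟩
    rw [bF, LinearMap.sub_apply, h.cherednik_last_const, Module.End.one_apply, sub_self, map_zero]
  | add P Q hP hQ =>
    obtain ⟨P', hP⟩ := hP
    obtain ⟨Q', hQ⟩ := hQ
    exact ⟨P' + Q', by rw [map_add, map_add, hP, hQ]⟩
  | mul j P hP =>
    obtain ⟨P', hP⟩ := hP
    obtain ⟨C, hC⟩ := (h.dahaRel (n := n) (μ := μ)).one_sub_last_mul_X (Nat.lt_succ_iff.1 j.isLt)
    have e : mulXSeq K n μ n = mulX (Fin.last n) := extendNat_val mulX 0 (Fin.last n)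
    rw [← h.cherednik_last, e, mulXSeq, extendNat_val] at hC
    have := LinearMap.congr_fun hC P
    simp only [Module.End.mul_apply, LinearMap.add_apply] at this
    rw [bF] at hP ⊢
    refine ⟨mulX j P' + C P, ?_⟩
    rw [this, hP, map_add, ← Module.End.mul_apply, (mulX_comm j (Fin.last n)).eq,
      Module.End.mul_apply]

theorem dunkl_last (q s : K) : (dunkl q s (Fin.last n) : Module.End K (Mmod K n μ)) =
    divX * bF q s := by
  rw [dunkl, Fin.reverseInduction_last]
  simp [rightProd]

theorem dunkl_castSucc (q s : K) (i : Fin n) :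
    (dunkl q s i.castSucc : Module.End K (Mmod K n μ)) =
      s⁻¹ • (bT s i * dunkl q s i.succ * bT s i) := by
  rw [dunkl, Fin.reverseInduction_castSucc]
  simp [rightProd, dunkl, mul_assoc]

theorem mulX_dunkl_last (h : GenericParams q s) (Q : Mmod K n μ) :
    mulX (Fin.last n) (dunkl q s (Fin.last n) Q) = bF q s Q := by
  obtain ⟨P, hP⟩ := h.exists_bF_eq_mulX Q
  rw [dunkl_last, Module.End.mul_apply, hP, divX_mulX]

/-- The Dunkl operators as a sequence. -/
def _root_.VectorMacdonald.dunklSeq (q s : K) (n : ℕ) (μ : YoungDiagram) :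
    ℕ → Module.End K (Mmod K n μ) :=
  extendNat (dunkl q s) 0

theorem _root_.VectorMacdonald.dunklSeq_val (i : Fin (n + 1)) :
    dunklSeq q s n μ i = dunkl q s i :=
  extendNat_val _ _ i

theorem _root_.VectorMacdonald.dunklSeq_castSucc (i : Fin n) :
    dunklSeq q s n μ i = dunkl q s i.castSucc :=
  dunklSeq_val i.castSucc

theorem _root_.VectorMacdonald.dunklSeq_succ (i : Fin n) :
    dunklSeq q s n μ (i + 1) = dunkl q s i.succ :=
  dunklSeq_val i.succ

theorem _root_.VectorMacdonald.dunklSeq_last :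
    dunklSeq q s n μ n = dunkl q s (Fin.last n) :=
  dunklSeq_val (Fin.last n)

theorem _root_.VectorMacdonald.dunklSeq_zero :
    dunklSeq q s n μ 0 = dunkl q s 0 :=
  dunklSeq_val 0

theorem isDunkl (h : GenericParams q s) :
    DahaRel.IsDunkl n s (h.bTSeq n μ) (h.bwUnit n μ) (mulXSeq K n μ) (dunklSeq q s n μ) where
  family i hi := by
    obtain ⟨i, rfl⟩ : ∃ j : Fin n, (j : ℕ) = i := ⟨⟨i, hi⟩, rfl⟩
    rw [dunklSeq_castSucc, dunklSeq_succ, dunkl_castSucc, bTSeq_val, val_bTUnit]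
  X_mul_last := by
    have e₁ : mulXSeq K n μ n = mulX (Fin.last n) := extendNat_val mulX 0 (Fin.last n)
    rw [e₁, dunklSeq_last, ← h.cherednik_last]
    exact LinearMap.ext h.mulX_dunkl_last

theorem commute_dunkl (h : GenericParams q s) (i j : Fin (n + 1)) :
    Commute (dunkl q s i : Module.End K (Mmod K n μ)) (dunkl q s j) := by
  have := (h.dahaRel (n := n) (μ := μ)).commute_dunkl h.isDunkl
    (Nat.lt_succ_iff.1 i.isLt) (Nat.lt_succ_iff.1 j.isLt)
  rwa [dunklSeq_val, dunklSeq_val] at this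

theorem commute_bT_dunkl (h : GenericParams q s) {i : Fin n} {j : Fin (n + 1)}
    (h₁ : j ≠ i.castSucc) (h₂ : j ≠ i.succ) :
    Commute (bT s i : Module.End K (Mmod K n μ)) (dunkl q s j) := by
  have := (h.dahaRel (n := n) (μ := μ)).commute_t_dunkl h.isDunkl i.isLt
    (Nat.lt_succ_iff.1 j.isLt) (fun e => h₁ (Fin.ext e)) (fun e => h₂ (Fin.ext e))
  rwa [bTSeq_val, val_bTUnit, dunklSeq_val] at this

theorem dunkl_castSucc_mul_bT (h : GenericParams q s) (i : Fin n) :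
    (dunkl q s i.castSucc * bT s i : Module.End K (Mmod K n μ)) =
      bT s i * dunkl q s i.succ + (s - 1) • dunkl q s i.castSucc := by
  have := (h.dahaRel (n := n) (μ := μ)).family_mul_t (h.isDunkl (n := n) (μ := μ)).family i.isLt
  rwa [dunklSeq_castSucc, dunklSeq_succ, bTSeq_val, val_bTUnit] at this

theorem dunkl_succ_mul_bT (h : GenericParams q s) (i : Fin n) :
    (dunkl q s i.succ * bT s i : Module.End K (Mmod K n μ)) =
      bT s i * dunkl q s i.castSucc + (1 - s) • dunkl q s i.castSucc := by
  have := (h.dahaRel (n := n) (μ := μ)).family_succ_mul_t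
    (h.isDunkl (n := n) (μ := μ)).family i.isLt
  rwa [dunklSeq_castSucc, dunklSeq_succ, bTSeq_val, val_bTUnit] at this

theorem dunkl_mul_bw (h : GenericParams q s) (j : Fin n) :
    (dunkl q s j.castSucc * bw q s : Module.End K (Mmod K n μ)) = bw q s * dunkl q s j.succ := by
  have := (h.dahaRel (n := n) (μ := μ)).dunkl_mul_W (h.isDunkl (n := n) (μ := μ)) j.isLt
  rwa [dunklSeq_castSucc, dunklSeq_succ, val_bwUnit] at this

theorem bw_mul_dunkl_zero (h : GenericParams q s) :
    (bw q s * dunkl q s 0 : Module.End K (Mmod K n μ)) =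
      q⁻¹ • (dunkl q s (Fin.last n) * bw q s) := by
  have := (h.dahaRel (n := n) (μ := μ)).W_mul_dunkl_zero (h.isDunkl (n := n) (μ := μ))
  rwa [dunklSeq_last, dunklSeq_zero, val_bwUnit] at this

end GenericParams

end

section

variable {K : Type*} [Field K] {n : ℕ} {μ : YoungDiagram} {q s : K}

/-! ### The constant term -/

/-- The constant term of a vector valued polynomial. -/
def constTerm : Mmod K n μ →ₗ[K] Vmod K n μ :=
  (TensorProduct.lid K (Vmod K n μ)).toLinearMap ∘ₗ
    TensorProduct.map (MvPolynomial.aeval fun _ => (0 : K)).toLinearMap LinearMap.id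

theorem constTerm_tmul (f : Pol K n) (v : Vmod K n μ) :
    constTerm (f ⊗ₜ[K] v) = MvPolynomial.aeval (fun _ => (0 : K)) f • v := by
  simp [constTerm]

theorem constTerm_const (v : Vmod K n μ) : constTerm ((1 : Pol K n) ⊗ₜ[K] v) = v := by
  rw [constTerm_tmul, map_one, one_smul]

theorem constTerm_mulX (j : Fin (n + 1)) (P : Mmod K n μ) : constTerm (mulX j P) = 0 := by
  induction P using TensorProduct.induction_on with
  | zero => simp
  | add P Q hP hQ => rw [map_add, map_add, hP, hQ, add_zero]
  | tmul f v => rw [mulX_tmul, constTerm_tmul, map_mul, MvPolynomial.aeval_X, zero_mul, zero_smul]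

theorem constTerm_bT (s : K) (i : Fin n) (P : Mmod K n μ) :
    constTerm (bT s i P) = heckeV s i (constTerm P) := by
  induction P using Mmod.induction with
  | const v => rw [bT_const, constTerm_const, constTerm_const]
  | add P Q hP hQ => simp only [map_add, hP, hQ]
  | mul j P hP =>
    rw [constTerm_mulX, map_zero]
    by_cases h₁ : j = i.castSucc
    · rw [h₁, bT_mulX_castSucc, map_add, map_smul, constTerm_mulX, constTerm_mulX, smul_zero,
        add_zero]
    by_cases h₂ : j = i.succ
    · rw [h₂, bT_mulX_succ, map_sub, map_smul, constTerm_mulX, constTerm_mulX, smul_zero, sub_zero]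
    · rw [bT_mulX_of_ne s h₁ h₂, constTerm_mulX]

theorem constTerm_bw (q s : K) (P : Mmod K n μ) :
    constTerm (bw q s P) = heckeS s (constTerm P) := by
  induction P using Mmod.induction with
  | const v => rw [bw_const, constTerm_const, constTerm_const]
  | add P Q hP hQ => simp only [map_add, hP, hQ]
  | mul j P hP =>
    rw [constTerm_mulX, map_zero]
    refine Fin.cases ?_ (fun j => ?_) j
    · rw [bw_mulX_zero, map_smul, constTerm_mulX, smul_zero]
    · rw [bw_mulX_succ, constTerm_mulX]

theorem constTerm_monTab {u : Fin (n + 1) →₀ ℕ} (hu : u ≠ 0) (T : RST n μ) :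
    constTerm (monTab u T : Mmod K n μ) = 0 := by
  obtain ⟨j, hj⟩ := Finsupp.ne_iff.1 hu
  rw [monTab, constTerm_tmul, MvPolynomial.aeval_monomial, Finsupp.prod,
    Finset.prod_eq_zero (Finsupp.mem_support_iff.2 hj) (zero_pow hj), mul_zero, zero_smul]

/-! ### Scaling of the variables -/

/-- The operator multiplying all variables by `c`. -/
def scaleX (c : K) : Module.End K (Mmod K n μ) :=
  TensorProduct.map
    (MvPolynomial.aeval fun j : Fin (n + 1) => c • (MvPolynomial.X j : Pol K n)).toLinearMap
    LinearMap.id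

theorem scaleX_const (c : K) (v : Vmod K n μ) :
    scaleX c ((1 : Pol K n) ⊗ₜ[K] v) = 1 ⊗ₜ[K] v := by
  simp [scaleX]

theorem scaleX_mulX (c : K) (j : Fin (n + 1)) (P : Mmod K n μ) :
    scaleX c (mulX j P) = c • mulX j (scaleX c P) := by
  induction P using TensorProduct.induction_on with
  | zero => simp
  | add P Q hP hQ => simp only [map_add, hP, hQ, smul_add]
  | tmul f v =>
    rw [mulX_tmul, scaleX, TensorProduct.map_tmul, TensorProduct.map_tmul, mulX_tmul]
    simp [TensorProduct.smul_tmul']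

theorem scaleX_monTab (c : K) (u : Fin (n + 1) →₀ ℕ) (T : RST n μ) :
    scaleX c (monTab u T : Mmod K n μ) = c ^ u.degree • monTab u T := by
  rw [monTab, scaleX, TensorProduct.map_tmul, TensorProduct.smul_tmul']
  congr 1
  rw [AlgHom.toLinearMap_apply, MvPolynomial.aeval_monomial, map_one, one_mul]
  simp only [smul_pow]
  rw [Finsupp.prod, Finset.prod_smul, Finset.prod_pow_eq_pow_sum, Finsupp.degree_apply]
  congr 1
  rw [MvPolynomial.monomial_eq, map_one, one_mul, Finsupp.prod]

theorem constTerm_scaleX (c : K) (P : Mmod K n μ) : constTerm (scaleX c P) = constTerm P := by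
  induction P using Mmod.induction with
  | const v => rw [scaleX_const]
  | add P Q hP hQ => simp only [map_add, hP, hQ]
  | mul j P hP => rw [scaleX_mulX, map_smul, constTerm_mulX, constTerm_mulX, smul_zero]

theorem commute_scaleX_bT (c s : K) (i : Fin n) :
    Commute (scaleX c : Module.End K (Mmod K n μ)) (bT s i) := by
  refine Mmod.end_ext (fun v => ?_) fun j P hP => ?_
  · simp only [Module.End.mul_apply, bT_const, scaleX_const]
  · simp only [Module.End.mul_apply] at hP ⊢
    by_cases h₁ : j = i.castSucc
    · subst h₁
      simp only [bT_mulX_castSucc, scaleX_mulX, map_add, map_smul, hP]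
      module
    by_cases h₂ : j = i.succ
    · subst h₂
      simp only [bT_mulX_succ, scaleX_mulX, map_sub, map_smul, hP]
      module
    · simp only [bT_mulX_of_ne s h₁ h₂, scaleX_mulX, map_smul, hP]

theorem commute_scaleX_bw (c q s : K) :
    Commute (scaleX c : Module.End K (Mmod K n μ)) (bw q s) := by
  refine Mmod.end_ext (fun v => ?_) fun j P hP => ?_
  · simp only [Module.End.mul_apply, bw_const, scaleX_const]
  · simp only [Module.End.mul_apply] at hP ⊢
    induction j using Fin.cases with
    | zero => simp only [bw_mulX_zero, scaleX_mulX, map_smul, hP, smul_comm c q]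
    | succ j => simp only [bw_mulX_succ, scaleX_mulX, map_smul, hP]

namespace GenericParams

/-- The Dunkl operators are homogeneous of degree `-1`. -/
theorem dunkl_scaleX (h : GenericParams q s) (c : K) (i : Fin (n + 1)) :
    (dunkl q s i * scaleX c : Module.End K (Mmod K n μ)) = c • (scaleX c * dunkl q s i) := by
  induction i using Fin.reverseInduction with
  | last =>
    have hd : ∀ k, Commute (scaleX c : Module.End K (Mmod K n μ)) ↑(descProd (h.bTSeq n μ) k) := by
      intro k
      induction k with
      | zero => exact Commute.one_right _
      | succ k ih =>
        rw [descProd_succ, Units.val_mul]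
        refine Commute.mul_right ?_ ih
        rw [bTSeq, extendNat]
        split_ifs with hk
        · exact commute_scaleX_bT c s _
        · exact Commute.one_right _
    have hξ (P : Mmod K n μ) : bF q s (scaleX c P) = scaleX c (bF q s P) := by
      have hc := (commute_scaleX_bw (μ := μ) c q s).mul_right (hd n).units_inv_right
      have e := LinearMap.congr_fun hc.eq P
      rw [bF, h.cherednik_last, Units.val_mul]
      simp only [LinearMap.sub_apply, Module.End.one_apply, map_sub]
      exact congrArg (scaleX c P - ·) e.symm
    refine LinearMap.ext fun P => mulX_injective (Fin.last n) ?_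
    rw [LinearMap.smul_apply, map_smul, Module.End.mul_apply, Module.End.mul_apply, ← scaleX_mulX,
      h.mulX_dunkl_last, h.mulX_dunkl_last]
    exact hξ P
  | cast i ih =>
    have hc := (commute_scaleX_bT (μ := μ) c s i).eq
    rw [dunkl_castSucc, smul_mul_assoc, mul_smul_comm, smul_comm c, mul_assoc, ← hc, mul_assoc,
      ← mul_assoc (dunkl q s i.succ), ih]
    simp only [mul_smul_comm, smul_mul_assoc]
    rw [← mul_assoc, ← mul_assoc, ← hc]
    simp only [mul_assoc]

end GenericParams

/-! ### The bilinear form -/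

/-- The recursive description of the bilinear form: its values on constants in the left argument
are prescribed, and the Dunkl operators are adjoint to the multiplications. -/
structure IsPairing (q s : K) (B : Mmod K n μ →ₗ[K] Mmod K n μ →ₗ[K] K) : Prop where
  const : ∀ (v : Vmod K n μ) (Q : Mmod K n μ), B (1 ⊗ₜ[K] v) Q = nuForm s v (constTerm Q)
  adjoint : ∀ (i : Fin (n + 1)) (P Q : Mmod K n μ), B (mulX i P) Q = B P (dunkl q s i Q)

theorem IsPairing.unique {B B' : Mmod K n μ →ₗ[K] Mmod K n μ →ₗ[K] K} (hB : IsPairing q s B)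
    (hB' : IsPairing q s B') : B = B' := by
  refine LinearMap.ext fun P => ?_
  induction P using Mmod.induction with
  | const v => exact LinearMap.ext fun Q => by rw [hB.const, hB'.const]
  | add P Q hP hQ => rw [map_add, map_add, hP, hQ]
  | mul j P hP => exact LinearMap.ext fun Q => by rw [hB.adjoint, hB'.adjoint, hP]

theorem monTab_zero (T : RST n μ) : (monTab 0 T : Mmod K n μ) = ofTab T := rfl

theorem Mmod.lhom_ext {N : Type*} [AddCommMonoid N] [Module K N] {f g : Mmod K n μ →ₗ[K] N}
    (h : ∀ u T, f (monTab u T) = g (monTab u T)) : f = g := by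
  refine TensorProduct.ext ?_
  refine (MvPolynomial.basisMonomials (Fin (n + 1)) K).ext fun u => ?_
  refine Finsupp.lhom_ext' fun T => LinearMap.ext_ring ?_
  simpa [monTab] using h u T

/-- Orthogonality of different degrees determines the values on constants in the left argument. -/
theorem IsForm.isPairing {B : Mmod K n μ →ₗ[K] Mmod K n μ →ₗ[K] K} (hB : IsForm q s B) :
    IsPairing q s B := by
  refine ⟨fun v Q => ?_, hB.adjoint⟩
  suffices h : B ∘ₗ TensorProduct.mk K (Pol K n) (Vmod K n μ) 1 = (nuForm s).compl₂ constTerm from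
    LinearMap.congr_fun₂ h v Q
  refine Finsupp.lhom_ext' fun T => LinearMap.ext_ring (Mmod.lhom_ext fun u T' => ?_)
  simp only [LinearMap.comp_apply, Finsupp.lsingle_apply, LinearMap.compl₂_apply,
    TensorProduct.mk_apply]
  change B (ofTab T) _ = _
  by_cases hu : u = 0
  · subst hu
    rw [monTab_zero, ofTab, ofTab, constTerm_const, nuForm_single]
    by_cases hT : T = T'
    · subst hT
      rw [Finsupp.single_eq_same, mul_one]
      exact hB.tableau_self T
    · rw [Finsupp.single_eq_of_ne hT, mul_zero]
      exact hB.tableau_ne T T' hT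
  · rw [constTerm_monTab hu, map_zero, ← monTab_zero]
    refine hB.degree _ _ _ _ ?_
    rw [map_zero]
    exact fun e => hu ((Finsupp.degree_eq_zero_iff u).1 e.symm)

open scoped IsMulCommutative in
/-- Polynomials can be evaluated at commuting elements of a noncommutative algebra. -/
theorem exists_algHom_of_commute {σ R : Type*} [Ring R] [Algebra K R] (D : σ → R)
    (h : ∀ i j, Commute (D i) (D j)) :
    ∃ ψ : MvPolynomial σ K →ₐ[K] R, ∀ i, ψ (MvPolynomial.X i) = D i := by
  have := Algebra.isMulCommutative_adjoin K (s := Set.range D) (by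
    rintro _ ⟨i, rfl⟩ _ ⟨j, rfl⟩
    exact h i j)
  refine ⟨(Algebra.adjoin K (Set.range D)).val.comp (MvPolynomial.aeval fun i =>
    (⟨D i, Algebra.subset_adjoin ⟨i, rfl⟩⟩ : Algebra.adjoin K (Set.range D))), fun i => ?_⟩
  simp

namespace GenericParams

/-- Since the Dunkl operators commute, they can be substituted for the variables; the form is
`(f v, Q) ↦ (v, (f(D) Q)₀)`. -/
theorem exists_isPairing (h : GenericParams q s) :
    ∃ B : Mmod K n μ →ₗ[K] Mmod K n μ →ₗ[K] K, IsPairing q s B := by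
  obtain ⟨ψ, hψ⟩ := exists_algHom_of_commute (K := K)
    (fun i : Fin (n + 1) => (dunkl q s i : Module.End K (Mmod K n μ))) h.commute_dunkl
  let β : Pol K n →ₗ[K] Vmod K n μ →ₗ[K] Mmod K n μ →ₗ[K] K :=
    LinearMap.mk₂ K (fun f v => nuForm s v ∘ₗ constTerm ∘ₗ ψ f)
      (fun f g v => by ext; simp) (fun c f v => by ext; simp) (fun f v w => by ext; simp)
      (fun c f v => by ext; simp)
  refine ⟨TensorProduct.lift β, fun v Q => ?_, fun i P Q => ?_⟩
  · simp [β]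
  · induction P using TensorProduct.induction_on with
    | zero => simp
    | add P P' hP hP' => rw [map_add, map_add, map_add, LinearMap.add_apply, hP, hP',
        LinearMap.add_apply]
    | tmul f v =>
      rw [mulX_tmul, mul_comm, TensorProduct.lift.tmul, TensorProduct.lift.tmul]
      simp [β, hψ]

end GenericParams

namespace IsPairing

variable {B : Mmod K n μ →ₗ[K] Mmod K n μ →ₗ[K] K}

theorem scaleX (hB : IsPairing q s B) (h : GenericParams q s) (c : K) (P Q : Mmod K n μ) :
    B (VectorMacdonald.scaleX c P) Q = B P (VectorMacdonald.scaleX c Q) := by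
  induction P using Mmod.induction generalizing Q with
  | const v => rw [scaleX_const, hB.const, hB.const, constTerm_scaleX]
  | add P P' hP hP' => simp only [map_add, LinearMap.add_apply, hP, hP']
  | mul j P hP =>
    have := LinearMap.congr_fun (h.dunkl_scaleX c j) Q
    simp only [Module.End.mul_apply, LinearMap.smul_apply] at this
    rw [scaleX_mulX, map_smul, LinearMap.smul_apply, hB.adjoint, hB.adjoint, hP, this, map_smul]

/-- Scaling all variables by `2` is self-adjoint and multiplies degree `d` by `2 ^ d`, which
separates the degrees in characteristic zero. -/
theorem isForm [CharZero K] (hB : IsPairing q s B) (h : GenericParams q s) : IsForm q s B where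
  degree u v T T' huv := by
    have := hB.scaleX h 2 (monTab u T) (monTab v T')
    rw [scaleX_monTab, scaleX_monTab, map_smul, map_smul, LinearMap.smul_apply, smul_eq_mul,
      smul_eq_mul, ← sub_eq_zero, ← sub_mul] at this
    refine (mul_eq_zero.1 this).resolve_left (sub_ne_zero.2 fun e => huv ?_)
    exact Nat.pow_right_injective le_rfl (by exact_mod_cast e)
  tableau_self T := by
    rw [ofTab, hB.const, constTerm_const, nuForm_single, Finsupp.single_eq_same, mul_one]
  tableau_ne T T' hT := by
    rw [ofTab, ofTab, hB.const, constTerm_const, nuForm_single, Finsupp.single_eq_of_ne hT,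
      mul_zero]
  adjoint := hB.adjoint

/-! ### Isometries -/

/-- The adjoint of a bold generator with parameter `s⁻¹` is the inverse of the generator with
parameter `s`. -/
theorem bT_adjoint (hB : IsPairing q s B) (h : GenericParams q s) (i : Fin n) (P Q : Mmod K n μ) :
    B (bT s⁻¹ i P) Q = B P (bTinv s i Q) := by
  have hinv : ∀ Q : Mmod K n μ, bTinv s i Q = s⁻¹ • (bT s i Q + (1 - s) • Q) := fun _ => rfl
  induction P using Mmod.induction generalizing Q with
  | const v =>
    rw [bT_const, hB.const, hB.const, nuForm_heckeV h.s_ne h.zpow_ne_one, hinv,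
      map_smul constTerm, map_add constTerm, map_smul constTerm, constTerm_bT]
  | add P P' hP hP' => simp only [map_add, LinearMap.add_apply, hP, hP']
  | mul j P hP =>
    by_cases h₁ : j = i.castSucc
    · subst h₁
      have e : dunkl q s i.castSucc (bTinv s i Q) = s⁻¹ • bT s i (dunkl q s i.succ Q) := by
        have := LinearMap.congr_fun (h.dunkl_castSucc_mul_bT i) Q
        simp only [Module.End.mul_apply, LinearMap.add_apply, LinearMap.smul_apply] at this
        rw [hinv, map_smul, map_add, map_smul, this]
        module
      rw [bT_mulX_castSucc, map_add, map_smul, LinearMap.add_apply, LinearMap.smul_apply,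
        hB.adjoint, hB.adjoint, hB.adjoint, hP, hinv, e]
      simp only [map_add, map_smul, smul_eq_mul]
      have := h.s_ne
      field_simp
      ring
    by_cases h₂ : j = i.succ
    · subst h₂
      have e : dunkl q s i.succ (bTinv s i Q) = s⁻¹ • (bT s i (dunkl q s i.castSucc Q) +
          (1 - s) • dunkl q s i.castSucc Q + (1 - s) • dunkl q s i.succ Q) := by
        have := LinearMap.congr_fun (h.dunkl_succ_mul_bT i) Q
        simp only [Module.End.mul_apply, LinearMap.add_apply, LinearMap.smul_apply] at this
        rw [hinv, map_smul, map_add, map_smul, this]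
      rw [bT_mulX_succ, map_sub, map_smul, LinearMap.sub_apply, LinearMap.smul_apply, hB.adjoint,
        hB.adjoint, hB.adjoint, hP, hinv, e]
      simp only [map_add, map_smul, smul_eq_mul]
      have := h.s_ne
      field_simp
      ring
    · have := LinearMap.congr_fun (h.commute_bT_dunkl (μ := μ) h₁ h₂).eq Q
      simp only [Module.End.mul_apply] at this
      rw [bT_mulX_of_ne _ h₁ h₂, hB.adjoint, hP, hB.adjoint, hinv, hinv,
        map_smul (dunkl q s j), map_add (dunkl q s j), map_smul (dunkl q s j), this]

theorem bT_isometry (hB : IsPairing q s B) (h : GenericParams q s) (i : Fin n) (P Q : Mmod K n μ) :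
    B (bT s⁻¹ i P) (bT s i Q) = B P Q := by
  have e : bTinv s i (bT s i Q) = Q := LinearMap.congr_fun (h.bTUnit μ i).inv_mul Q
  rw [hB.bT_adjoint h, e]

theorem _root_.VectorMacdonald.nuForm_heckeS (h : GenericParams q s) (v w : Vmod K n μ) :
    nuForm s (heckeS s⁻¹ v) (heckeS s w) = nuForm s v w := by
  have key : ∀ (L : List (Fin n)) (v w : Vmod K n μ),
      nuForm s (rightProd (L.map (heckeV s⁻¹)) v) (rightProd (L.map (heckeV s)) w) =
        nuForm s v w := by
    intro L
    induction L with
    | nil => intro v w; rfl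
    | cons i L ih =>
      intro v w
      have e : ∀ (r : K) (u : Vmod K n μ), rightProd ((i :: L).map (heckeV r)) u =
          rightProd (L.map (heckeV r)) (heckeV r i u) := fun r u => by
        simp [rightProd]
      have e' : s⁻¹ • (heckeV s i (heckeV s i w) + (1 - s) • heckeV s i w) = w :=
        LinearMap.congr_fun (h.heckeUnit μ i).inv_mul w
      rw [e, e, ih, nuForm_heckeV h.s_ne h.zpow_ne_one, e']
  exact key _ v w

/-- The affine element with inverse parameters on the left and with the given parameters on the
right forms an isometry. -/
theorem bw_isometry (hB : IsPairing q s B) (h : GenericParams q s) (P Q : Mmod K n μ) :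
    B (bw q⁻¹ s⁻¹ P) (bw q s Q) = B P Q := by
  induction P using Mmod.induction generalizing Q with
  | const v => rw [bw_const, hB.const, hB.const, constTerm_bw, nuForm_heckeS h]
  | add P P' hP hP' => simp only [map_add, LinearMap.add_apply, hP, hP']
  | mul j P hP =>
    induction j using Fin.cases with
    | zero =>
      have := LinearMap.congr_fun (h.bw_mul_dunkl_zero (n := n) (μ := μ)) Q
      simp only [Module.End.mul_apply, LinearMap.smul_apply] at this
      rw [bw_mulX_zero, map_smul, LinearMap.smul_apply, hB.adjoint, ← map_smul, ← this, hP,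
        hB.adjoint]
    | succ j =>
      have := LinearMap.congr_fun (h.dunkl_mul_bw (μ := μ) j) Q
      simp only [Module.End.mul_apply] at this
      rw [bw_mulX_succ, hB.adjoint, this, hP, hB.adjoint]

/-- The Cherednik operators with inverse parameters on the left and with the given parameters on
the right form isometries. -/
theorem cherednik_isometry (hB : IsPairing q s B) (h : GenericParams q s) (i : Fin (n + 1))
    (P Q : Mmod K n μ) : B (cherednik q⁻¹ s⁻¹ i P) (cherednik q s i Q) = B P Q := by
  induction i using Fin.reverseInduction generalizing P Q with
  | last =>
    have hd : ∀ k (P Q : Mmod K n μ),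
        B ((↑(descProd (h.inv.bTSeq n μ) k)⁻¹ : Module.End K (Mmod K n μ)) P)
          ((↑(descProd (h.bTSeq n μ) k)⁻¹ : Module.End K (Mmod K n μ)) Q) = B P Q := by
      intro k
      induction k with
      | zero => intro P Q; simp [descProd]
      | succ k ih =>
        intro P Q
        rw [descProd_succ, descProd_succ, mul_inv_rev, mul_inv_rev, Units.val_mul, Units.val_mul,
          Module.End.mul_apply, Module.End.mul_apply, ih]
        by_cases hk : k < n
        · rw [show k = ((⟨k, hk⟩ : Fin n) : ℕ) from rfl, GenericParams.bTSeq_val,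
            GenericParams.bTSeq_val]
          have e₁ : P = bT s⁻¹ ⟨k, hk⟩ (bTinv s⁻¹ ⟨k, hk⟩ P) :=
            (LinearMap.congr_fun (h.inv.bTUnit μ ⟨k, hk⟩).mul_inv P).symm
          have e₂ : Q = bT s ⟨k, hk⟩ (bTinv s ⟨k, hk⟩ Q) :=
            (LinearMap.congr_fun (h.bTUnit μ ⟨k, hk⟩).mul_inv Q).symm
          conv_rhs => rw [e₁, e₂, hB.bT_isometry h]
          rfl
        · simp [GenericParams.bTSeq, extendNat, hk]
    rw [h.cherednik_last, h.inv.cherednik_last, Units.val_mul, Units.val_mul, Module.End.mul_apply,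
      Module.End.mul_apply, GenericParams.val_bwUnit, GenericParams.val_bwUnit, hB.bw_isometry h,
      hd]
  | cast i ih =>
    rw [h.cherednik_castSucc, h.inv.cherednik_castSucc]
    simp only [LinearMap.smul_apply, Module.End.mul_apply, map_smul, smul_eq_mul]
    rw [hB.bT_isometry h, ih, hB.bT_isometry h, ← mul_assoc, inv_inv, inv_mul_cancel₀ h.s_ne,
      one_mul]

end IsPairing

end

section

variable {K : Type*} [Field K] {n : ℕ} {μ : YoungDiagram} {q s : K}

/-! ### Macdonald polynomials are eigenvectors -/

/-- The invariant along a path of the Yang--Baxter graph: the spectral vector is read off from the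
tableau, the exponent vector and the permutation, and consists of the eigenvalues of the Cherednik
operators on the polynomial. -/
structure IsSpectral (q s : K) (X : Vertex K n μ) (P : Mmod K n μ) : Prop where
  zeta_eq : ∀ i, X.zeta i = q ^ (X.vec i : ℤ) * s ^ X.tab.ct (X.sigma i)
  sigma_inj : Function.Injective X.sigma
  eigen : ∀ i, cherednik q s i P = X.zeta i • P

namespace IsSpectral

variable {X : Vertex K n μ} {P : Mmod K n μ}

/-- The intertwiner `T_i + (1 - s) / (1 - ζ_{i+1} / ζ_i)` exchanges the eigenvalues `ζ_i`,
`ζ_{i+1}`. -/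
theorem eigen_step (h : GenericParams q s) (hX : IsSpectral q s X P) {i : Fin n}
    (hne : X.zeta i.castSucc ≠ X.zeta i.succ) (j : Fin (n + 1)) :
    cherednik q s j (X.arrowOp s (.s i) P) = swapVec i X.zeta j • X.arrowOp s (.s i) P := by
  have h0 : X.zeta i.castSucc ≠ 0 := by
    rw [hX.zeta_eq]
    exact mul_ne_zero (zpow_ne_zero _ h.q_ne) (zpow_ne_zero _ h.s_ne)
  have e₁ := hX.eigen i.castSucc
  have e₂ := hX.eigen i.succ
  simp only [Vertex.arrowOp, LinearMap.add_apply, LinearMap.smul_apply, Module.End.one_apply,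
    map_add, map_smul]
  have hκ : (1 - s) / (1 - X.zeta i.succ / X.zeta i.castSucc) *
      (X.zeta i.castSucc - X.zeta i.succ) = (1 - s) * X.zeta i.castSucc := by
    have : X.zeta i.castSucc - X.zeta i.succ ≠ 0 := sub_ne_zero.2 hne
    have e : 1 - X.zeta i.succ / X.zeta i.castSucc =
        (X.zeta i.castSucc - X.zeta i.succ) / X.zeta i.castSucc := by field_simp
    rw [e]
    field_simp
  by_cases h₁ : j = i.castSucc
  · subst h₁
    have := LinearMap.congr_fun (h.cherednik_mul_bT i) P
    simp only [Module.End.mul_apply, LinearMap.add_apply, LinearMap.smul_apply] at this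
    rw [this, e₁, e₂, map_smul, swapVec, Function.comp_apply, Equiv.swap_apply_left]
    match_scalars
    · ring
    · linear_combination hκ
  by_cases h₂ : j = i.succ
  · subst h₂
    have := LinearMap.congr_fun (h.cherednik_succ_mul_bT i) P
    simp only [Module.End.mul_apply, LinearMap.add_apply, LinearMap.smul_apply] at this
    rw [this, e₁, e₂, map_smul, swapVec, Function.comp_apply, Equiv.swap_apply_right]
    match_scalars
    · ring
    · linear_combination -hκ
  · have := LinearMap.congr_fun (h.commute_bT_cherednik (μ := μ) h₁ h₂).eq P
    simp only [Module.End.mul_apply] at this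
    rw [← this, hX.eigen j, map_smul, swapVec, Function.comp_apply,
      Equiv.swap_apply_of_ne_of_ne h₁ h₂]
    module

/-- The invariant is preserved by every arrow that is not a fall. The eigenvalues `ζ_i`, `ζ_{i+1}`
are distinct at every arrow `s_i`, since either the powers of `q` or the contents differ. -/
theorem act (h : GenericParams q s) (hX : IsSpectral q s X P) {a : Arrow n} (ha : X.IsArrow a) :
    IsSpectral q s (X.act q a) (X.arrowOp s a P) := by
  cases a with
  | s i =>
    by_cases hv : X.vec i.castSucc = X.vec i.succ
    · obtain ⟨hj, hct⟩ : X.CanJump i ∧ _ := ha.resolve_left (fun hlt => hlt.ne hv)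
      have hne : X.zeta i.castSucc ≠ X.zeta i.succ := by
        intro e
        rw [hX.zeta_eq, hX.zeta_eq] at e
        have := (h.eq_of_zpow_mul_zpow_eq e).2
        omega
      have hsw : X.tab.IsSwap (X.sigma i.castSucc) (X.sigma i.succ)
          (X.tab.swap (X.sigma i.castSucc) (X.sigma i.succ)) := by
        rw [RST.swap, dif_pos hj.2]
        exact hj.2.choose_spec
      have hact : X.act q (.s i) = ⟨X.tab.swap (X.sigma i.castSucc) (X.sigma i.succ),
          swapVec i X.zeta, X.vec, X.sigma⟩ := by
        simp only [Vertex.act]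
        rw [if_neg (not_not.2 hv), if_pos hj]
      have hvec : ∀ j, X.vec (Equiv.swap i.castSucc i.succ j) = X.vec j := by
        intro j
        rw [Equiv.swap_apply_def]
        split_ifs with h₁ h₂
        · rw [h₁, hv]
        · rw [h₂, hv]
        · rfl
      rw [hact]
      refine ⟨fun j => ?_, hX.sigma_inj, fun j => hX.eigen_step h hne j⟩
      have hcell : (X.tab.swap (X.sigma i.castSucc) (X.sigma i.succ)).cell (X.sigma j) =
          X.tab.cell (X.sigma (Equiv.swap i.castSucc i.succ j)) := by
        rw [show (X.tab.swap _ _).cell = _ from hsw, Function.comp_apply,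
          hX.sigma_inj.map_swap]
      change X.zeta (Equiv.swap i.castSucc i.succ j) = _
      rw [hX.zeta_eq, hvec]
      simp only [RST.ct, RST.row, RST.col, hcell]
    · have hne : X.zeta i.castSucc ≠ X.zeta i.succ := by
        intro e
        rw [hX.zeta_eq, hX.zeta_eq] at e
        exact hv (by exact_mod_cast (h.eq_of_zpow_mul_zpow_eq e).1)
      have hact : X.act q (.s i) = ⟨X.tab, swapVec i X.zeta, swapVec i X.vec,
          swapVec i X.sigma⟩ := by
        simp only [Vertex.act]
        rw [if_pos hv]
      rw [hact]
      exact ⟨fun j => hX.zeta_eq _, hX.sigma_inj.comp (Equiv.injective _),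
        fun j => hX.eigen_step h hne j⟩
  | Psi =>
    refine ⟨fun j => ?_, ?_, fun j => ?_⟩
    · induction j using Fin.lastCases with
      | last =>
        simp only [Vertex.act, shiftVec, Fin.snoc_last, hX.zeta_eq 0, id]
        rw [Nat.cast_add, Nat.cast_one, zpow_add_one₀ h.q_ne]
        ring
      | cast j => simp only [Vertex.act, shiftVec, Fin.snoc_castSucc, hX.zeta_eq]
    · intro j k
      simp only [Vertex.act, shiftVec, id]
      induction j using Fin.lastCases with
      | last =>
        induction k using Fin.lastCases with
        | last => exact fun _ => rfl
        | cast k =>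
          rw [Fin.snoc_last, Fin.snoc_castSucc]
          exact fun e => absurd (hX.sigma_inj e) (Fin.succ_ne_zero k).symm
      | cast j =>
        induction k using Fin.lastCases with
        | last =>
          rw [Fin.snoc_last, Fin.snoc_castSucc]
          exact fun e => absurd (hX.sigma_inj e) (Fin.succ_ne_zero j)
        | cast k =>
          rw [Fin.snoc_castSucc, Fin.snoc_castSucc]
          exact fun e => congrArg _ (Fin.succ_injective _ (hX.sigma_inj e))
    · change cherednik q s j (raising s P) = shiftVec (fun z => q * z) X.zeta j • raising s P
      induction j using Fin.lastCases with
      | last =>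
        have := LinearMap.congr_fun (h.cherednik_last_mul_raising (n := n) (μ := μ)) P
        simp only [Module.End.mul_apply, LinearMap.smul_apply] at this
        rw [this, hX.eigen, map_smul, smul_smul, shiftVec, Fin.snoc_last]
      | cast j =>
        have := LinearMap.congr_fun (h.cherednik_mul_raising (μ := μ) j) P
        simp only [Module.End.mul_apply] at this
        rw [this, hX.eigen, map_smul, shiftVec, Fin.snoc_castSucc]

theorem follow (h : GenericParams q s) (hX : IsSpectral q s X P) (p : List (Arrow n))
    (hp : X.IsPath q p) : IsSpectral q s (X.endpoint q p) (X.follow q s P p) := by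
  induction p generalizing X P with
  | nil => exact hX
  | cons a p ih => exact ih (hX.act h hp.1) hp.2

theorem root (h : GenericParams q s) (hμ : μ.card = n + 1) :
    IsSpectral q s (rootVertex s hμ) (ofTab (RST.root hμ)) where
  zeta_eq i := by simp [rootVertex]
  sigma_inj := fun _ _ e => e
  eigen i := h.cherednik_ofTab i _

end IsSpectral

/-! ### Inverse parameters -/

/-- Two vertices that differ at most in the spectral vector. Inverting the parameters affects only
this component, so that the same labels form a path for both choices of parameters. -/
def SameShape (X Y : Vertex K n μ) : Prop :=
  X.tab = Y.tab ∧ X.vec = Y.vec ∧ X.sigma = Y.sigma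

theorem SameShape.canJump_iff {L : Type*} {X Y : Vertex L n μ} (hXY : SameShape X Y) (i : Fin n) :
    X.CanJump i ↔ Y.CanJump i := by
  rw [Vertex.CanJump, Vertex.CanJump, hXY.1, hXY.2.1, hXY.2.2]

theorem SameShape.act {X Y : Vertex K n μ} (hXY : SameShape X Y) (q q' : K) (a : Arrow n) :
    SameShape (X.act q a) (Y.act q' a) := by
  have hXY' := hXY
  obtain ⟨hT, hv, hσ⟩ := hXY'
  cases a with
  | s i =>
    simp only [Vertex.act]
    by_cases h : X.vec i.castSucc = X.vec i.succ
    · rw [if_neg (not_not.2 h), if_neg (not_not.2 (hv ▸ h))]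
      by_cases hj : X.CanJump i
      · rw [if_pos hj, if_pos ((hXY.canJump_iff i).1 hj)]
        exact ⟨by rw [hT, hσ], hv, hσ⟩
      · rw [if_neg hj, if_neg (mt (hXY.canJump_iff i).2 hj)]
        exact hXY
    · rw [if_pos h, if_pos (hv ▸ h)]
      exact ⟨hT, by rw [hv], by rw [hσ]⟩
  | Psi => exact ⟨hT, by rw [Vertex.act, Vertex.act, hv], by rw [Vertex.act, Vertex.act, hσ]⟩

theorem SameShape.isArrow {L : Type*} {X Y : Vertex L n μ} (hXY : SameShape X Y) {a : Arrow n}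
    (ha : X.IsArrow a) : Y.IsArrow a := by
  obtain ⟨T, ζ, v, σ⟩ := X
  obtain ⟨T', ζ', v', σ'⟩ := Y
  obtain ⟨rfl, rfl, rfl⟩ := hXY
  cases a <;> exact ha

theorem SameShape.isPath {X Y : Vertex K n μ} (hXY : SameShape X Y) {q : K} (q' : K)
    {p : List (Arrow n)} (hp : X.IsPath q p) : Y.IsPath q' p := by
  induction p generalizing X Y with
  | nil => trivial
  | cons a p ih => exact ⟨hXY.isArrow hp.1, ih (hXY.act q q' a) hp.2⟩

theorem SameShape.endpoint {X Y : Vertex K n μ} (hXY : SameShape X Y) (q q' : K)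
    (p : List (Arrow n)) : SameShape (X.endpoint q p) (Y.endpoint q' p) := by
  induction p generalizing X Y with
  | nil => exact hXY
  | cons a p ih => exact ih (hXY.act q q' a)

/-- The parameters are multiplicatively independent if they are algebraically independent. -/
theorem genericParams_of_algebraicIndependent [CharZero K] (hqs : AlgebraicIndependent ℚ ![q, s]) :
    GenericParams q s where
  q_ne := hqs.ne_zero 0
  s_ne := hqs.ne_zero 1
  indep a b e := by
    have hq : q ≠ 0 := hqs.ne_zero 0
    have hs : s ≠ 0 := hqs.ne_zero 1
    -- negative powers are moved to the other side, which gives an equality of monomials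
    obtain ⟨a₁, a₂, rfl⟩ : ∃ a₁ a₂ : ℕ, a = a₁ - a₂ := ⟨a.toNat, (-a).toNat, by omega⟩
    obtain ⟨b₁, b₂, rfl⟩ : ∃ b₁ b₂ : ℕ, b = b₁ - b₂ := ⟨b.toNat, (-b).toNat, by omega⟩
    have e' : q ^ a₁ * s ^ b₁ = q ^ a₂ * s ^ b₂ := by
      rw [zpow_sub₀ hq, zpow_sub₀ hs] at e
      simp only [zpow_natCast] at e
      field_simp at e
      exact e
    have hm : MvPolynomial.monomial (Finsupp.single (0 : Fin 2) a₁ + Finsupp.single 1 b₁) (1 : ℚ) =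
        MvPolynomial.monomial (Finsupp.single (0 : Fin 2) a₂ + Finsupp.single 1 b₂) 1 := by
      refine hqs ?_
      have hmon : ∀ a b : ℕ, MvPolynomial.aeval ![q, s]
          (MvPolynomial.monomial (Finsupp.single (0 : Fin 2) a + Finsupp.single 1 b) (1 : ℚ)) =
          q ^ a * s ^ b := by
        intro a b
        rw [MvPolynomial.aeval_monomial, map_one, one_mul, Finsupp.prod_add_index']
        · simp
        · simp
        · intros; rw [pow_add]
      rw [hmon, hmon, e']
    have := MvPolynomial.monomial_left_injective (one_ne_zero' ℚ) hm
    have h₀ := DFunLike.congr_fun this 0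
    have h₁ := DFunLike.congr_fun this 1
    simp at h₀ h₁
    omega

end

end VectorMacdonald

end

open VectorMacdonald
theorem mainTheorem11 {K : Type*} [Field K] [CharZero K] (q s : K)
    (hqs : AlgebraicIndependent ℚ ![q, s]) (n : ℕ) (μ : YoungDiagram) (hμ : μ.card = n + 1) :
    (∀ Q : Mmod K n μ, mulX (Fin.last n) (dunkl q s (Fin.last n) Q) = bF q s Q) ∧
    ∃ B : Mmod K n μ →ₗ[K] Mmod K n μ →ₗ[K] K,
      IsForm q s B ∧
      (∀ B' : Mmod K n μ →ₗ[K] Mmod K n μ →ₗ[K] K, IsForm q s B' → B' = B) ∧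
      (∀ i : Fin (n + 1), ∃ ξ : Mmod K n μ ≃ₗ[K] Mmod K n μ,
        (∀ Q, ξ Q = cherednik q s i Q) ∧
        ∀ P Q : Mmod K n μ, B (cherednik q⁻¹ s⁻¹ i P) Q = B P (ξ.symm Q)) ∧
      (∀ p p' : List (Arrow n), IsGraphPath q s hμ p → IsGraphPath q s hμ p' →
        spectralVector q s hμ p ≠ spectralVector q s hμ p' →
        B (macdonald q⁻¹ s⁻¹ hμ p) (macdonald q s hμ p') = 0) := by
  have h := genericParams_of_algebraicIndependent hqs
  refine ⟨h.mulX_dunkl_last, ?_⟩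
  obtain ⟨B, hB⟩ := h.exists_isPairing (n := n) (μ := μ)
  refine ⟨B, hB.isForm h, fun B' hB' => hB'.isPairing.unique hB, fun i => ?_, ?_⟩
  · refine ⟨LinearEquiv.ofBijective (cherednik q s i)
      ((Module.End.isUnit_iff _).1 (h.isUnit_cherednik i)), fun Q => rfl, fun P Q => ?_⟩
    conv_lhs => rw [← LinearEquiv.apply_symm_apply (LinearEquiv.ofBijective (cherednik q s i)
      ((Module.End.isUnit_iff _).1 (h.isUnit_cherednik i))) Q]
    exact hB.cherednik_isometry h i _ _
  · intro p p' hp hp' hne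
    have hroot : SameShape (rootVertex (μ := μ) s hμ) (rootVertex s⁻¹ hμ) := ⟨rfl, rfl, rfl⟩
    have hX := (IsSpectral.root h hμ).follow h p hp
    have hX' := (IsSpectral.root h hμ).follow h p' hp'
    have hY := (IsSpectral.root h.inv hμ).follow h.inv p (hroot.isPath q⁻¹ hp)
    obtain ⟨hT, hv, hσ⟩ := hroot.endpoint q q⁻¹ p
    obtain ⟨i, hi⟩ := Function.ne_iff.1 hne
    have hinv : ((rootVertex s⁻¹ hμ).endpoint q⁻¹ p).zeta i = (spectralVector q s hμ p i)⁻¹ := by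
      rw [spectralVector, hX.zeta_eq, hY.zeta_eq, hT, hv, hσ, mul_inv, inv_zpow, inv_zpow]
    have h0 : spectralVector q s hμ p i ≠ 0 := by
      rw [spectralVector, hX.zeta_eq]
      exact mul_ne_zero (zpow_ne_zero _ h.q_ne) (zpow_ne_zero _ h.s_ne)
    have e₁ : cherednik q⁻¹ s⁻¹ i (macdonald q⁻¹ s⁻¹ hμ p) =
        (spectralVector q s hμ p i)⁻¹ • macdonald q⁻¹ s⁻¹ hμ p := by
      rw [← hinv]
      exact hY.eigen i
    have e₂ : cherednik q s i (macdonald q s hμ p') =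
        spectralVector q s hμ p' i • macdonald q s hμ p' := hX'.eigen i
    -- the isometry multiplies the value of the form by the ratio of the two eigenvalues
    have := hB.cherednik_isometry h i (macdonald q⁻¹ s⁻¹ hμ p) (macdonald q s hμ p')
    rw [e₁, e₂, map_smul, map_smul, LinearMap.smul_apply, smul_eq_mul, smul_eq_mul, ← mul_assoc,
      ← sub_eq_zero, ← sub_one_mul] at this
    refine (mul_eq_zero.1 this).resolve_left (sub_ne_zero.2 fun e => hi ?_)
    field_simp at e
    exact e.symm
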